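/- **Setting.** Let $\mathcal K=(\mathcal V,\mathcal E)$ be a connected, locally finite graph without loops, where $\mathcal V$ is at most countable and $\mathcal E\subset\mathcal V\times\mathcal V$ is symmetric. Let $\mathcal F\subset\mathcal V^3$ be a symmetric set of triangular faces: $(x,y,z)\in\mathcal F$ implies $(x,y),(y,z),(z,x)\in\mathcal E$, $(y,x,z)\in\mathcal F$ and $(y,z,x)\in\mathcal F$. Let $\alpha:\mathcal E\to\mathbb R$ be a magnetic potential, $\alpha(x,y)=-\alpha(y,x)$, and let $c:\mathcal V\to(0,\infty)$, $r:\mathcal E\to(0,\infty)$, $s:\mathcal F\to(0,\infty)$ be weights, $r$ and $s$ being invariant under all permutations of the vertices. For $(x,y)\in\mathcal E$ put $\mathcal F_{xy}=\{t:(x,y,t)\in\mathcal F\}$. These data form a weighted magnetic triangulation $\mathcal T_\alpha$. Let $\mathcal C(\mathcal V)$ be the space of functions $\mathcal V\to\mathbb C$, and let $\mathcal C_{skew}(\mathcal E)$, $\mathcal C_{skew}(\mathcal F)$ be the spaces of complex functions on $\mathcal E$, resp. $\mathcal F$, that change sign under odd permutations of the vertices and are invariant under even ones. An exponent $c$ on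 these spaces denotes the functions of finite support. Let $l^2(\mathcal T_\alpha)=l^2(\mathcal V)\oplus l^2(\mathcal E)\oplus l^2(\mathcal F)$ be the Hilbert space of the triples $(f,\varphi,\psi)\in\mathcal C(\mathcal V)\oplus\mathcal C_{skew}(\mathcal E)\oplus\mathcal C_{skew}(\mathcal F)$ of finite norm for the scalar product $$\sum_{x\in\mathcal V}c(x)f_1(x)\overline{f_2(x)}+\frac12\sum_{(x,y)\in\mathcal E}r(x,y)\varphi_1(x,y)\overline{\varphi_2(x,y)}+\frac16\sum_{(x,y,z)\in\mathcal F}s(x,y,z)\psi_1(x,y,z)\overline{\psi_2(x,y,z)}.$$ Define $$d^0_\alpha g(x,y)=e^{\frac{i\alpha(y,x)}2}g(y)-e^{\frac{i\alpha(x,y)}2}g(x),\qquad \delta^0_\alpha\varphi(x)=\frac1{c(x)}\sum_{y\sim x}r(y,x)e^{\frac{i\alpha(y,x)}2}\varphi(y,x),$$ $$d^1_\alpha\varphi(x,y,z)=e^{\frac i6(\alpha(x,z)+\alpha(y,z))}\varphi(x,y)+e^{\frac i6(\alpha(y,x)+\alpha(z,x))}\varphi(y,z)+e^{\frac i6(\alpha(z,y)+\alpha(x,y))}\varphi(z,x),$$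 $$\delta^1_\alpha\psi(x,y)=\frac1{r(x,y)}\sum_{t\in\mathcal F_{xy}}s(x,y,t)e^{\frac i6(\alpha(t,x)+\alpha(t,y))}\psi(x,y,t).$$ The magnetic Gauß–Bonnet operator $T_\alpha(f,\varphi,\psi)=(\delta^0_\alpha\varphi,\;d^0_\alpha f+\delta^1_\alpha\psi,\;d^1_\alpha\varphi)$ maps $\mathcal D:=\mathcal C^c(\mathcal V)\oplus\mathcal C^c_{skew}(\mathcal E)\oplus\mathcal C^c_{skew}(\mathcal F)$ to itself, and the magnetic Hodge Laplacian is $\Delta_\alpha=T_\alpha^2:\mathcal D\to\mathcal D$. The triangulation is called $\chi$-complete if there are a constant $C>0$, an increasing sequence $B_0\subset B_1\subset\cdots$ of finite sets with $\bigcup_nB_n=\mathcal V$, and functions $\chi_n:\mathcal V\to[0,1]$ of finite support with $\chi_n=1$ on $B_n$, such that for all $n$ $$\frac1{c(x)}\sum_{y\sim x}r(x,y)|\chi_n(x)-\chi_n(y)|^2\le C\quad(x\in\mathcal V),$$ $$\frac1{r(x,y)}\sum_{t\in\mathcal F_{xy}}s(x,y,t)\,\bigl|(\chi_n(x)-\chi_n(t))+(\chi_n(y)-\chi_n(t))\bigr|^2\le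 C\quad((x,y)\in\mathcal E).$$ **Statement.** If the weighted magnetic triangulation $\mathcal T_\alpha$ is $\chi$-complete, then $\Delta_\alpha$ is essentially self-adjoint on $\mathcal C^c(\mathcal V)\oplus\mathcal C^c_{skew}(\mathcal E)\oplus\mathcal C^c_{skew}(\mathcal F)$: it is a densely defined symmetric operator in $l^2(\mathcal T_\alpha)$ and it has one and only one self-adjoint extension. -/

import Mathlib

open scoped ComplexConjugate

noncomputable section

/-! ### Weighted spaces of square-summable functions -/

section WeightedL2

/-- The functions of the class `K` that are square-summable for the weight `w`.
The weight has to be positive wherever a function of the class `K` may be nonzero. -/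
def weightedL2Submodule {ι : Type*} (w : ι → ℝ) (K : Submodule ℂ (ι → ℂ))
    (hw : ∀ f ∈ K, ∀ i, w i ≤ 0 → f i = 0) : Submodule ℂ (ι → ℂ) where
  carrier := {f | f ∈ K ∧ Summable fun i => w i * ‖f i‖ ^ 2}
  zero_mem' := ⟨K.zero_mem, by simp [summable_zero]⟩
  add_mem' := by
    rintro f g ⟨hf, hfs⟩ ⟨hg, hgs⟩
    refine ⟨K.add_mem hf hg, ?_⟩
    refine Summable.of_nonneg_of_le ?_ ?_ ((hfs.mul_left 2).add (hgs.mul_left 2))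
    · intro i
      rcases le_or_gt (w i) 0 with h | h
      · simp [hw f hf i h, hw g hg i h]
      · positivity
    · intro i
      rcases le_or_gt (w i) 0 with h | h
      · simp [hw f hf i h, hw g hg i h]
      · have h1 : ‖f i + g i‖ ^ 2 ≤ 2 * ‖f i‖ ^ 2 + 2 * ‖g i‖ ^ 2 := by
          have := norm_add_le (f i) (g i)
          nlinarith [norm_nonneg (f i + g i), sq_nonneg (‖f i‖ - ‖g i‖)]
        have h2 := mul_le_mul_of_nonneg_left h1 h.le
        simp only [Pi.add_apply]
        linarith
  smul_mem' := by
    rintro a f ⟨hf, hfs⟩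
    refine ⟨K.smul_mem a hf, (hfs.mul_left (‖a‖ ^ 2)).congr fun i => ?_⟩
    simp only [Pi.smul_apply, smul_eq_mul, norm_mul]
    ring

/-- The weighted `ℓ²` space `{f ∈ K : ∑ i, w i |f i|² < ∞}`. It is a separate type, so that its
only norm is the one coming from the weighted scalar product. -/
def WeightedL2 {ι : Type*} (w : ι → ℝ) (K : Submodule ℂ (ι → ℂ))
    (hw : ∀ f ∈ K, ∀ i, w i ≤ 0 → f i = 0) : Type _ :=
  weightedL2Submodule w K hw

namespace WeightedL2

variable {ι : Type*} {w : ι → ℝ} {K : Submodule ℂ (ι → ℂ)}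
  {hw : ∀ f ∈ K, ∀ i, w i ≤ 0 → f i = 0}

instance : AddCommGroup (WeightedL2 w K hw) :=
  inferInstanceAs (AddCommGroup (weightedL2Submodule w K hw))

instance : Module ℂ (WeightedL2 w K hw) :=
  inferInstanceAs (Module ℂ (weightedL2Submodule w K hw))

/-- The underlying function of an element of a weighted `ℓ²` space. -/
def toFun (f : WeightedL2 w K hw) : ι → ℂ := f.1

/-- A square-summable function of the class `K` as an element of the weighted `ℓ²` space. -/
def mk (f : ι → ℂ) (hf : f ∈ K) (hs : Summable fun i => w i * ‖f i‖ ^ 2) :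
    WeightedL2 w K hw := ⟨f, hf, hs⟩

theorem toFun_mem (f : WeightedL2 w K hw) : f.toFun ∈ K := f.2.1

theorem toFun_summable (f : WeightedL2 w K hw) :
    Summable fun i => w i * ‖f.toFun i‖ ^ 2 := f.2.2

theorem toFun_injective : Function.Injective (toFun : WeightedL2 w K hw → ι → ℂ) :=
  Subtype.val_injective

@[simp] theorem toFun_mk (f : ι → ℂ) (hf : f ∈ K) (hs : Summable fun i => w i * ‖f i‖ ^ 2) :
    (mk f hf hs : WeightedL2 w K hw).toFun = f := rfl

@[simp] theorem toFun_add (f g : WeightedL2 w K hw) (i : ι) :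
    (f + g).toFun i = f.toFun i + g.toFun i := rfl

@[simp] theorem toFun_smul (a : ℂ) (f : WeightedL2 w K hw) (i : ι) :
    (a • f).toFun i = a * f.toFun i := rfl

@[simp] theorem toFun_sub (f g : WeightedL2 w K hw) (i : ι) :
    (f - g).toFun i = f.toFun i - g.toFun i := rfl

theorem toFun_eq_zero (f : WeightedL2 w K hw) {i : ι} (h : w i ≤ 0) : f.toFun i = 0 :=
  hw _ f.toFun_mem i h

theorem summable_inner (f g : WeightedL2 w K hw) :
    Summable fun i => (w i : ℂ) * (conj (f.toFun i) * g.toFun i) := by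
  refine Summable.of_norm_bounded (f.toFun_summable.add g.toFun_summable) fun i => ?_
  rcases le_or_gt (w i) 0 with h | h
  · simp [f.toFun_eq_zero h, g.toFun_eq_zero h]
  · have h1 : ‖f.toFun i‖ * ‖g.toFun i‖ ≤ ‖f.toFun i‖ ^ 2 + ‖g.toFun i‖ ^ 2 := by
      nlinarith [sq_nonneg (‖f.toFun i‖ - ‖g.toFun i‖), sq_nonneg ‖f.toFun i‖,
        sq_nonneg ‖g.toFun i‖]
    have h2 := mul_le_mul_of_nonneg_left h1 h.le
    simp only [norm_mul, Complex.norm_real, Real.norm_eq_abs, abs_of_pos h, RCLike.norm_conj]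
    linarith

/-- The weighted scalar product `∑ i, w i * conj (f i) * g i` (conjugate-linear in the first
variable, which is the convention of Mathlib). -/
instance instCore : InnerProductSpace.Core ℂ (WeightedL2 w K hw) where
  inner f g := ∑' i, (w i : ℂ) * (conj (f.toFun i) * g.toFun i)
  conj_inner_symm f g := by
    rw [Complex.conj_tsum]
    refine tsum_congr fun i => ?_
    simp only [map_mul, Complex.conj_conj, Complex.conj_ofReal]
    ring
  re_inner_nonneg f := by
    have h : ∀ i, (w i : ℂ) * (conj (f.toFun i) * f.toFun i)
        = ((w i * ‖f.toFun i‖ ^ 2 : ℝ) : ℂ) := fun i => by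
      rw [mul_comm (conj _), Complex.mul_conj']; push_cast; ring
    simp only [h, ← Complex.ofReal_tsum]
    refine tsum_nonneg fun i => ?_
    rcases le_or_gt (w i) 0 with h | h
    · simp [f.toFun_eq_zero h]
    · positivity
  add_left f g h := by
    rw [← (summable_inner f h).tsum_add (summable_inner g h)]
    refine tsum_congr fun i => ?_
    simp only [toFun_add, map_add]
    ring
  smul_left f g a := by
    rw [← tsum_mul_left]
    refine tsum_congr fun i => ?_
    simp only [toFun_smul, map_mul]
    ring
  definite f hf := by
    have h : ∀ i, (w i : ℂ) * (conj (f.toFun i) * f.toFun i)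
        = ((w i * ‖f.toFun i‖ ^ 2 : ℝ) : ℂ) := fun i => by
      rw [mul_comm (conj _), Complex.mul_conj']; push_cast; ring
    simp only [h, ← Complex.ofReal_tsum, Complex.ofReal_eq_zero] at hf
    have hn : ∀ i, 0 ≤ w i * ‖f.toFun i‖ ^ 2 := fun i => by
      rcases le_or_gt (w i) 0 with h | h
      · simp [f.toFun_eq_zero h]
      · positivity
    have h0 := (hasSum_zero_iff_of_nonneg hn).1 (hf ▸ f.toFun_summable.hasSum)
    refine toFun_injective (funext fun i => ?_)
    change f.toFun i = 0
    rcases le_or_gt (w i) 0 with h | h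
    · exact f.toFun_eq_zero h
    · have := congrFun h0 i
      simpa [h.ne'] using this

instance instNormedAddCommGroup : NormedAddCommGroup (WeightedL2 w K hw) :=
  (instCore (w := w) (K := K) (hw := hw)).toNormedAddCommGroup

instance instInnerProductSpace : InnerProductSpace ℂ (WeightedL2 w K hw) :=
  InnerProductSpace.ofCore (instCore (w := w) (K := K) (hw := hw)).toCore

theorem inner_def (f g : WeightedL2 w K hw) :
    inner ℂ f g = ∑' i, (w i : ℂ) * (conj (f.toFun i) * g.toFun i) := rfl

theorem norm_sq_eq (f : WeightedL2 w K hw) :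
    ‖f‖ ^ 2 = ∑' i, w i * ‖f.toFun i‖ ^ 2 := by
  have h1 : inner ℂ f f = ((‖f‖ : ℂ)) ^ 2 := inner_self_eq_norm_sq_to_K f
  have h : ∀ i, (w i : ℂ) * (conj (f.toFun i) * f.toFun i)
      = ((w i * ‖f.toFun i‖ ^ 2 : ℝ) : ℂ) := fun i => by
    rw [mul_comm (conj _), Complex.mul_conj']; push_cast; ring
  rw [inner_def] at h1
  simp only [h, ← Complex.ofReal_tsum] at h1
  exact_mod_cast h1.symm

theorem sqrt_mul_sq (f : WeightedL2 w K hw) (i : ι) :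
    ‖(Real.sqrt (w i) : ℂ) * f.toFun i‖ ^ 2 = w i * ‖f.toFun i‖ ^ 2 := by
  rcases le_or_gt (w i) 0 with h | h
  · simp [f.toFun_eq_zero h]
  · rw [norm_mul, mul_pow, Complex.norm_real, Real.norm_eq_abs, sq_abs, Real.sq_sqrt h.le]

/-- The map `f ↦ √w f` to the unweighted space `ℓ²(ι)`; it serves to prove completeness. -/
def toLp (f : WeightedL2 w K hw) : lp (fun _ : ι => ℂ) 2 :=
  ⟨fun i => (Real.sqrt (w i) : ℂ) * f.toFun i, by
    refine memℓp_gen ?_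
    refine f.toFun_summable.congr fun i => ?_
    have := f.sqrt_mul_sq i
    rw [← this]
    norm_num⟩

theorem toLp_isometry : Isometry (toLp : WeightedL2 w K hw → lp (fun _ : ι => ℂ) 2) := by
  refine Isometry.of_dist_eq fun f g => ?_
  rw [dist_eq_norm, dist_eq_norm]
  have hsub : toLp f - toLp g = toLp (f - g) := by
    refine Subtype.ext (funext fun i => ?_)
    change (Real.sqrt (w i) : ℂ) * f.toFun i - (Real.sqrt (w i) : ℂ) * g.toFun i
      = (Real.sqrt (w i) : ℂ) * (f.toFun i - g.toFun i)
    ring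
  rw [hsub]
  have h1 : ‖toLp (f - g)‖ ^ 2 = ‖f - g‖ ^ 2 := by
    have h2 := lp.norm_rpow_eq_tsum (p := 2) (by norm_num) (toLp (f - g))
    rw [norm_sq_eq]
    simp only [ENNReal.toReal_ofNat, Real.rpow_ofNat] at h2
    rw [h2]
    exact tsum_congr fun i => (f - g).sqrt_mul_sq i
  exact (sq_eq_sq₀ (norm_nonneg _) (norm_nonneg _)).1 h1

/-- A weighted `ℓ²` space is complete as soon as the class `K` is closed for pointwise
convergence. -/
theorem completeSpace (hK : IsClosed (K : Set (ι → ℂ))) : CompleteSpace (WeightedL2 w K hw) := by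
  rw [completeSpace_iff_isComplete_range toLp_isometry.isUniformInducing]
  have hcoord : ∀ i, Continuous fun g : lp (fun _ : ι => ℂ) 2 => g i := fun i =>
    (continuous_apply i).comp
      (lp.uniformContinuous_coe (E := fun _ : ι => ℂ) (p := 2)).continuous
  have hr : Set.range (toLp : WeightedL2 w K hw → lp (fun _ : ι => ℂ) 2)
      = {g | (fun i => g i / (Real.sqrt (w i) : ℂ)) ∈ K} ∩
        ⋂ i, {g | w i ≤ 0 → g i = 0} := by
    ext g
    simp only [Set.mem_range, Set.mem_inter_iff, Set.mem_ofPred_eq, Set.mem_iInter]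
    constructor
    · rintro ⟨f, rfl⟩
      refine ⟨?_, fun i hi => ?_⟩
      · convert f.toFun_mem using 1
        funext i
        rcases le_or_gt (w i) 0 with h | h
        · simp [toLp, f.toFun_eq_zero h]
        · have : (Real.sqrt (w i) : ℂ) ≠ 0 := by
            exact_mod_cast (Real.sqrt_pos.2 h).ne'
          simp [toLp, this]
      · simp [toLp, f.toFun_eq_zero hi]
    · rintro ⟨hg, h0⟩
      have hmul : ∀ i, (Real.sqrt (w i) : ℂ) * (g i / (Real.sqrt (w i) : ℂ)) = g i := fun i => by
        rcases le_or_gt (w i) 0 with h | h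
        · simp [h0 i h]
        · have : (Real.sqrt (w i) : ℂ) ≠ 0 := by
            exact_mod_cast (Real.sqrt_pos.2 h).ne'
          field_simp
      refine ⟨mk _ hg ?_, ?_⟩
      · have hs := (lp.memℓp g).summable (by norm_num)
        refine hs.congr fun i => ?_
        simp only [ENNReal.toReal_ofNat, Real.rpow_ofNat]
        rcases le_or_gt (w i) 0 with h | h
        · simp [h0 i h]
        · conv_lhs => rw [← hmul i]
          rw [norm_mul, mul_pow, Complex.norm_real, Real.norm_eq_abs, sq_abs, Real.sq_sqrt h.le]
      · ext i
        exact hmul i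
  rw [hr]
  refine (IsClosed.inter ?_ (isClosed_iInter fun i => ?_)).isComplete
  · exact hK.preimage (continuous_pi fun i => (hcoord i).div_const _)
  · by_cases h : w i ≤ 0
    · simp only [h, forall_const]
      exact isClosed_eq (hcoord i) continuous_const
    · simp [h]

end WeightedL2

end WeightedL2

/-! ### Essential self-adjointness -/

/-- A densely defined symmetric operator is essentially self-adjoint if it has one and only one
self-adjoint extension. -/
def IsEssentiallySelfAdjoint {H : Type*} [NormedAddCommGroup H] [InnerProductSpace ℂ H]
    [CompleteSpace H] (A : H →ₗ.[ℂ] H) : Prop :=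
  Dense (A.domain : Set H) ∧ A.IsFormalAdjoint A ∧ ∃! B : H →ₗ.[ℂ] H, A ≤ B ∧ IsSelfAdjoint B

/-! ### Weighted magnetic triangulations -/

/-- A connected, locally finite graph without loops, with a symmetric set of triangular faces,
a skewsymmetric real magnetic potential on the edges, and positive weights on the vertices, edges
and faces. Edges and faces are oriented: `Adj x y` says that `(x, y)` is an edge and `face x y z`
that `(x, y, z)` is a face. The values of the potential and of the weights off the edges or
faces are never used. -/
structure MagneticTriangulation (V : Type*) where
  graph : SimpleGraph V
  connected : graph.Connected
  locallyFinite : ∀ x, (graph.neighborSet x).Finite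
  face : V → V → V → Prop
  face_cycle : ∀ x y z, face x y z → graph.Adj x y ∧ graph.Adj y z ∧ graph.Adj z x
  face_swap : ∀ x y z, face x y z → face y x z
  face_rot : ∀ x y z, face x y z → face y z x
  /-- the magnetic potential -/
  α : V → V → ℝ
  α_skew : ∀ x y, graph.Adj x y → α x y = -α y x
  /-- the weight on the vertices -/
  c : V → ℝ
  c_pos : ∀ x, 0 < c x
  /-- the weight on the edges -/
  r : V → V → ℝ
  r_pos : ∀ x y, graph.Adj x y → 0 < r x y
  r_symm : ∀ x y, graph.Adj x y → r x y = r y x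
  /-- the weight on the faces -/
  s : V → V → V → ℝ
  s_pos : ∀ x y z, face x y z → 0 < s x y z
  s_swap : ∀ x y z, face x y z → s x y z = s x z y
  s_rot : ∀ x y z, face x y z → s x y z = s y z x

namespace MagneticTriangulation

variable {V : Type*} (T : MagneticTriangulation V)

/-- The neighbours of the vertex `x`. -/
def nbr (x : V) : Finset V := (T.locallyFinite x).toFinset

open Classical in
/-- The vertices `t` such that `(x, y, t)` is a face. -/
def faceNbr (x y : V) : Finset V := (T.nbr x).filter fun t => T.face x y t

theorem mem_nbr {x y : V} : y ∈ T.nbr x ↔ T.graph.Adj x y := by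
  simp [nbr]

theorem mem_faceNbr {x y t : V} : t ∈ T.faceNbr x y ↔ T.face x y t := by
  simp only [faceNbr, Finset.mem_filter, mem_nbr, and_iff_right_iff_imp]
  exact fun h => (T.face_cycle _ _ _ h).2.2.symm

/-! ### Cochains -/

/-- The skewsymmetric functions on the edges, extended by `0` off the edges. -/
def skewEdge : Submodule ℂ (V × V → ℂ) where
  carrier := {φ | (∀ x y, φ (x, y) = -φ (y, x)) ∧ ∀ x y, ¬ T.graph.Adj x y → φ (x, y) = 0}
  zero_mem' := by simp
  add_mem' := by
    rintro a b ⟨ha, ha'⟩ ⟨hb, hb'⟩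
    refine ⟨fun x y => ?_, fun x y h => ?_⟩
    · rw [Pi.add_apply, Pi.add_apply, ha x y, hb x y]; ring
    · rw [Pi.add_apply, ha' x y h, hb' x y h, add_zero]
  smul_mem' := by
    rintro k a ⟨ha, ha'⟩
    refine ⟨fun x y => ?_, fun x y h => ?_⟩
    · rw [Pi.smul_apply, Pi.smul_apply, ha x y, smul_neg]
    · rw [Pi.smul_apply, ha' x y h, smul_zero]

/-- The functions on the oriented faces that are skewsymmetric under a change of orientation,
extended by `0` off the faces. -/
def skewFace : Submodule ℂ (V × V × V → ℂ) where
  carrier := {ψ | (∀ x y z, ψ (x, y, z) = -ψ (x, z, y)) ∧ (∀ x y z, ψ (x, y, z) = ψ (y, z, x)) ∧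
    ∀ x y z, ¬ T.face x y z → ψ (x, y, z) = 0}
  zero_mem' := by simp
  add_mem' := by
    rintro a b ⟨ha, hr, ha'⟩ ⟨hb, hs, hb'⟩
    refine ⟨fun x y z => ?_, fun x y z => ?_, fun x y z h => ?_⟩
    · rw [Pi.add_apply, Pi.add_apply, ha x y, hb x y]; ring
    · rw [Pi.add_apply, Pi.add_apply, hr x y, hs x y]
    · rw [Pi.add_apply, ha' x y z h, hb' x y z h, add_zero]
  smul_mem' := by
    rintro k a ⟨ha, hr, ha'⟩
    refine ⟨fun x y z => ?_, fun x y z => ?_, fun x y z h => ?_⟩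
    · rw [Pi.smul_apply, Pi.smul_apply, ha x y, smul_neg]
    · rw [Pi.smul_apply, Pi.smul_apply, hr x y]
    · rw [Pi.smul_apply, ha' x y z h, smul_zero]

/-- The 0-cochains, 1-cochains and 2-cochains taken together. -/
abbrev Cochain : Type _ := (V → ℂ) × T.skewEdge × T.skewFace

/-! ### The magnetic operators

As the graph is locally finite, their expressions make sense on all cochains. -/

/-- The phase `exp (i t)`. -/
def phase (t : ℝ) : ℂ := Complex.exp (Complex.I * t)

open Classical in
/-- The difference magnetic operator
`(d⁰ g)(x, y) = exp (i α(y,x) / 2) g(y) - exp (i α(x,y) / 2) g(x)`. -/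
def d0 : (V → ℂ) →ₗ[ℂ] T.skewEdge where
  toFun g := ⟨fun e => if T.graph.Adj e.1 e.2 then
      phase (T.α e.2 e.1 / 2) * g e.2 - phase (T.α e.1 e.2 / 2) * g e.1 else 0, by
    refine ⟨fun x y => ?_, fun x y h => by simp [h]⟩
    by_cases h : T.graph.Adj x y
    · simp [h, h.symm]
    · have h' : ¬ T.graph.Adj y x := fun h' => h h'.symm
      simp [h, h']⟩
  map_add' g h := by
    ext e
    simp only [Submodule.coe_add, Pi.add_apply]
    split_ifs <;> ring
  map_smul' a g := by
    ext e
    simp only [Submodule.coe_smul, Pi.smul_apply, smul_eq_mul, RingHom.id_apply]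
    split_ifs <;> ring

/-- The formal adjoint of `d0`, the co-boundary magnetic operator
`(δ⁰ φ)(x) = (1 / c(x)) ∑_{y ∼ x} r(y,x) exp (i α(y,x) / 2) φ(y,x)`. -/
def delta0 : T.skewEdge →ₗ[ℂ] (V → ℂ) where
  toFun φ := fun x => (1 / (T.c x : ℂ)) *
    ∑ y ∈ T.nbr x, (T.r y x : ℂ) * phase (T.α y x / 2) * φ.1 (y, x)
  map_add' φ φ' := by
    funext x
    simp only [Submodule.coe_add, Pi.add_apply, mul_add, Finset.sum_add_distrib]
  map_smul' a φ := by
    funext x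
    simp only [Submodule.coe_smul, Pi.smul_apply, smul_eq_mul, RingHom.id_apply, Finset.mul_sum]
    exact Finset.sum_congr rfl fun y _ => by ring

open Classical in
/-- The exterior magnetic derivative
`(d¹ φ)(x, y, z) = exp (i (α(x,z) + α(y,z)) / 6) φ(x,y) + exp (i (α(y,x) + α(z,x)) / 6) φ(y,z)
  + exp (i (α(z,y) + α(x,y)) / 6) φ(z,x)`. -/
def d1 : T.skewEdge →ₗ[ℂ] T.skewFace where
  toFun φ := ⟨fun f => if T.face f.1 f.2.1 f.2.2 then
      phase ((T.α f.1 f.2.2 + T.α f.2.1 f.2.2) / 6) * φ.1 (f.1, f.2.1)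
      + phase ((T.α f.2.1 f.1 + T.α f.2.2 f.1) / 6) * φ.1 (f.2.1, f.2.2)
      + phase ((T.α f.2.2 f.2.1 + T.α f.1 f.2.1) / 6) * φ.1 (f.2.2, f.1) else 0, by
    have hsw : ∀ x y z, T.face x y z → T.face x z y := fun x y z h =>
      T.face_swap _ _ _ (T.face_rot _ _ _ (T.face_rot _ _ _ h))
    refine ⟨fun x y z => ?_, fun x y z => ?_, fun x y z h => by simp [h]⟩
    · by_cases h : T.face x y z
      · simp only [h, hsw x y z h, if_true]
        rw [φ.2.1 x z, φ.2.1 z y, φ.2.1 y x, add_comm (T.α x y) (T.α z y),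
          add_comm (T.α z x) (T.α y x), add_comm (T.α y z) (T.α x z)]
        ring
      · have h' : ¬ T.face x z y := fun h' => h (hsw _ _ _ h')
        simp [h, h']
    · by_cases h : T.face x y z
      · simp only [h, T.face_rot x y z h, if_true]
        rw [add_comm (T.α y x) (T.α z x), add_comm (T.α z y) (T.α x y),
          add_comm (T.α x z) (T.α y z)]
        ring
      · have h' : ¬ T.face y z x := fun h' => h (T.face_rot _ _ _ (T.face_rot _ _ _ h'))
        simp [h, h']⟩
  map_add' φ φ' := by
    ext f
    simp only [Submodule.coe_add, Pi.add_apply]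
    split_ifs <;> ring
  map_smul' a φ := by
    ext f
    simp only [Submodule.coe_smul, Pi.smul_apply, smul_eq_mul, RingHom.id_apply]
    split_ifs <;> ring

/-- The formal adjoint of `d1`, the co-exterior magnetic derivative
`(δ¹ ψ)(x, y) = (1 / r(x,y)) ∑_t s(x,y,t) exp (i (α(t,x) + α(t,y)) / 6) ψ(x,y,t)`, the sum being
over the vertices `t` such that `(x, y, t)` is a face. -/
def delta1 : T.skewFace →ₗ[ℂ] T.skewEdge where
  toFun ψ := ⟨fun e => (1 / (T.r e.1 e.2 : ℂ)) * ∑ t ∈ T.faceNbr e.1 e.2,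
      (T.s e.1 e.2 t : ℂ) * phase ((T.α t e.1 + T.α t e.2) / 6) * ψ.1 (e.1, e.2, t), by
    have hvan : ∀ x y, ¬ T.graph.Adj x y → T.faceNbr x y = ∅ := fun x y h =>
      Finset.eq_empty_of_forall_notMem fun t ht => h (T.face_cycle _ _ _ (T.mem_faceNbr.1 ht)).1
    refine ⟨fun x y => ?_, fun x y h => by simp [hvan x y h]⟩
    by_cases h : T.graph.Adj x y
    · have hset : T.faceNbr y x = T.faceNbr x y := by
        ext t
        simp only [mem_faceNbr]
        exact ⟨T.face_swap _ _ _, T.face_swap _ _ _⟩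
      simp only [hset, T.r_symm y x h.symm]
      rw [← mul_neg, ← Finset.sum_neg_distrib]
      congr 1
      refine Finset.sum_congr rfl fun t ht => ?_
      have hf := T.mem_faceNbr.1 ht
      have hs : T.s y x t = T.s x y t := by
        rw [T.s_rot x y t hf, T.s_swap y t x (T.face_rot _ _ _ hf)]
      have hψ : ψ.1 (y, x, t) = -ψ.1 (x, y, t) := by
        rw [ψ.2.2.1 x y t, ψ.2.1 y x t]
      rw [hs, hψ, add_comm (T.α t y)]
      ring
    · simp [hvan x y h, hvan y x fun h' => h h'.symm]⟩
  map_add' ψ ψ' := by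
    ext e
    simp only [Submodule.coe_add, Pi.add_apply, mul_add, Finset.sum_add_distrib]
  map_smul' a ψ := by
    ext e
    simp only [Submodule.coe_smul, Pi.smul_apply, smul_eq_mul, RingHom.id_apply, Finset.mul_sum]
    exact Finset.sum_congr rfl fun y _ => by ring

/-- The magnetic Gauß–Bonnet operator `T_α = d + δ` on all cochains,
`(f, φ, ψ) ↦ (δ⁰ φ, d⁰ f + δ¹ ψ, d¹ φ)`. -/
def gaussBonnetAll : T.Cochain →ₗ[ℂ] T.Cochain where
  toFun F := (T.delta0 F.2.1, T.d0 F.1 + T.delta1 F.2.2, T.d1 F.2.1)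
  map_add' F G := by
    simp only [Prod.fst_add, Prod.snd_add, map_add, Prod.mk_add_mk]
    congr 2
    abel
  map_smul' a F := by
    simp only [Prod.smul_fst, Prod.smul_snd, map_smul, RingHom.id_apply, Prod.smul_mk, smul_add]

/-- The cochains of finite support. -/
def finCochain : Submodule ℂ T.Cochain where
  carrier := {F | F.1.support.Finite ∧ F.2.1.1.support.Finite ∧ F.2.2.1.support.Finite}
  zero_mem' := by
    refine ⟨?_, ?_, ?_⟩ <;> simp
  add_mem' := by
    rintro F G ⟨h1, h2, h3⟩ ⟨k1, k2, k3⟩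
    exact ⟨(h1.union k1).subset (Function.support_add _ _),
      (h2.union k2).subset (Function.support_add _ _),
      (h3.union k3).subset (Function.support_add _ _)⟩
  smul_mem' := by
    rintro a F ⟨h1, h2, h3⟩
    exact ⟨h1.subset (Function.support_const_smul_subset _ _),
      h2.subset (Function.support_const_smul_subset _ _),
      h3.subset (Function.support_const_smul_subset _ _)⟩

open Classical in
/-- A finite set of vertices together with its neighbours. -/
def thicken (S : Finset V) : Finset V := S ∪ S.biUnion T.nbr

theorem mem_thicken_of_mem {S : Finset V} {x : V} (h : x ∈ S) : x ∈ T.thicken S := by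
  classical
  exact Finset.mem_union_left _ h

theorem mem_thicken_of_adj {S : Finset V} {x y : V} (h : x ∈ S) (hxy : T.graph.Adj x y) :
    y ∈ T.thicken S := by
  classical
  exact Finset.mem_union_right _ (Finset.mem_biUnion.2 ⟨x, h, T.mem_nbr.2 hxy⟩)

theorem d0_support_finite {g : V → ℂ} (hg : g.support.Finite) :
    (T.d0 g).1.support.Finite := by
  refine ((T.thicken hg.toFinset).finite_toSet.prod
    (T.thicken hg.toFinset).finite_toSet).subset ?_
  rintro ⟨x, y⟩ h
  by_cases hxy : T.graph.Adj x y
  · have hor : x ∈ hg.toFinset ∨ y ∈ hg.toFinset := by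
      by_contra hc
      simp only [Set.Finite.mem_toFinset, Function.mem_support, not_or, not_not] at hc
      exact h (by simp [d0, hc.1, hc.2])
    rcases hor with hx | hy
    · exact ⟨T.mem_thicken_of_mem hx, T.mem_thicken_of_adj hx hxy⟩
    · exact ⟨T.mem_thicken_of_adj hy hxy.symm, T.mem_thicken_of_mem hy⟩
  · exact absurd (by simp [d0, hxy]) h

theorem delta0_support_finite {φ : T.skewEdge} (hφ : φ.1.support.Finite) :
    (T.delta0 φ).support.Finite := by
  refine (hφ.image Prod.snd).subset fun x hx => ?_
  by_contra hc
  refine hx ?_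
  have h0 : ∀ y, φ.1 (y, x) = 0 := fun y => by
    by_contra hy
    exact hc ⟨(y, x), hy, rfl⟩
  simp [delta0, h0]

theorem d1_support_finite {φ : T.skewEdge} (hφ : φ.1.support.Finite) :
    (T.d1 φ).1.support.Finite := by
  classical
  set S : Finset V := hφ.toFinset.image Prod.fst with hS
  have hmem : ∀ x y, φ.1 (x, y) ≠ 0 → x ∈ S := fun x y h =>
    Finset.mem_image.2 ⟨(x, y), hφ.mem_toFinset.2 h, rfl⟩
  refine ((T.thicken S).finite_toSet.prod
    ((T.thicken S).finite_toSet.prod (T.thicken S).finite_toSet)).subset ?_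
  rintro ⟨x, y, z⟩ h
  by_cases hf : T.face x y z
  · obtain ⟨hxy, hyz, hzx⟩ := T.face_cycle _ _ _ hf
    have hor : x ∈ S ∨ y ∈ S ∨ z ∈ S := by
      by_contra hc
      simp only [not_or] at hc
      have h1 : φ.1 (x, y) = 0 := by_contra fun h => hc.1 (hmem _ _ h)
      have h2 : φ.1 (y, z) = 0 := by_contra fun h => hc.2.1 (hmem _ _ h)
      have h3 : φ.1 (z, x) = 0 := by_contra fun h => hc.2.2 (hmem _ _ h)
      exact h (by simp [d1, h1, h2, h3])
    rcases hor with hx | hy | hz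
    · exact ⟨T.mem_thicken_of_mem hx, T.mem_thicken_of_adj hx hxy,
        T.mem_thicken_of_adj hx hzx.symm⟩
    · exact ⟨T.mem_thicken_of_adj hy hxy.symm, T.mem_thicken_of_mem hy,
        T.mem_thicken_of_adj hy hyz⟩
    · exact ⟨T.mem_thicken_of_adj hz hzx, T.mem_thicken_of_adj hz hyz.symm,
        T.mem_thicken_of_mem hz⟩
  · exact absurd (by simp [d1, hf]) h

theorem delta1_support_finite {ψ : T.skewFace} (hψ : ψ.1.support.Finite) :
    (T.delta1 ψ).1.support.Finite := by
  refine (hψ.image fun f => (f.1, f.2.1)).subset ?_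
  rintro ⟨x, y⟩ hx
  by_contra hc
  refine hx ?_
  have h0 : ∀ t, ψ.1 (x, y, t) = 0 := fun t => by
    by_contra ht
    exact hc ⟨(x, y, t), ht, rfl⟩
  simp [delta1, h0]

/-- The magnetic Gauß–Bonnet operator `T_α`, from the cochains of finite support to
themselves. -/
def gaussBonnet : T.finCochain →ₗ[ℂ] T.finCochain :=
  T.gaussBonnetAll.restrict fun _ hF =>
    ⟨T.delta0_support_finite hF.2.1,
      ((T.d0_support_finite hF.1).union (T.delta1_support_finite hF.2.2)).subset
        (Function.support_add _ _),
      T.d1_support_finite hF.2.1⟩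

/-- The magnetic Hodge Laplacian `Δ_α = T_α²`, from the cochains of finite support to
themselves. -/
def hodgeLaplacian : T.finCochain →ₗ[ℂ] T.finCochain :=
  T.gaussBonnet ∘ₗ T.gaussBonnet

/-! ### The Hilbert space -/

/-- `ℓ²(V)`, with the scalar product `∑_x c(x) conj f(x) g(x)`. -/
abbrev L2Vertex : Type _ :=
  WeightedL2 T.c ⊤ fun _ _ i h => absurd (T.c_pos i) (not_lt.2 h)

theorem skewEdge_vanish (φ : V × V → ℂ) (hφ : φ ∈ T.skewEdge) (e : V × V)
    (h : T.r e.1 e.2 / 2 ≤ 0) : φ e = 0 :=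
  hφ.2 e.1 e.2 fun hadj => by linarith [T.r_pos e.1 e.2 hadj]

/-- `ℓ²(E)`, with the scalar product `(1/2) ∑_{(x,y)} r(x,y) conj φ(x,y) φ'(x,y)`. -/
abbrev L2Edge : Type _ :=
  WeightedL2 (fun e : V × V => T.r e.1 e.2 / 2) T.skewEdge T.skewEdge_vanish

theorem skewFace_vanish (ψ : V × V × V → ℂ) (hψ : ψ ∈ T.skewFace) (f : V × V × V)
    (h : T.s f.1 f.2.1 f.2.2 / 6 ≤ 0) : ψ f = 0 :=
  hψ.2.2 f.1 f.2.1 f.2.2 fun hf => by linarith [T.s_pos f.1 f.2.1 f.2.2 hf]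

/-- `ℓ²(F)`, with the scalar product `(1/6) ∑_{(x,y,z)} s(x,y,z) conj ψ(x,y,z) ψ'(x,y,z)`. -/
abbrev L2Face : Type _ :=
  WeightedL2 (fun f : V × V × V => T.s f.1 f.2.1 f.2.2 / 6) T.skewFace T.skewFace_vanish

instance : CompleteSpace T.L2Vertex := WeightedL2.completeSpace isClosed_univ

instance : CompleteSpace T.L2Edge := by
  refine WeightedL2.completeSpace ?_
  have h : (T.skewEdge : Set (V × V → ℂ)) = (⋂ x, ⋂ y, {φ | φ (x, y) = -φ (y, x)}) ∩
      ⋂ x, ⋂ y, ⋂ (_ : ¬ T.graph.Adj x y), {φ | φ (x, y) = 0} := by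
    ext φ
    simp only [Set.mem_inter_iff, Set.mem_iInter]
    rfl
  rw [h]
  refine IsClosed.inter ?_ ?_
  · refine isClosed_iInter fun x => isClosed_iInter fun y => ?_
    exact isClosed_eq (continuous_apply (x, y)) (continuous_apply (y, x)).neg
  · refine isClosed_iInter fun x => isClosed_iInter fun y => isClosed_iInter fun _ => ?_
    exact isClosed_eq (continuous_apply (x, y)) continuous_const

instance : CompleteSpace T.L2Face := by
  refine WeightedL2.completeSpace ?_
  have h : (T.skewFace : Set (V × V × V → ℂ)) =
      (⋂ x, ⋂ y, ⋂ z, {ψ | ψ (x, y, z) = -ψ (x, z, y)}) ∩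
      ((⋂ x, ⋂ y, ⋂ z, {ψ | ψ (x, y, z) = ψ (y, z, x)}) ∩
      ⋂ x, ⋂ y, ⋂ z, ⋂ (_ : ¬ T.face x y z), {ψ | ψ (x, y, z) = 0}) := by
    ext ψ
    simp only [Set.mem_inter_iff, Set.mem_iInter]
    rfl
  rw [h]
  refine IsClosed.inter ?_ (IsClosed.inter ?_ ?_)
  · refine isClosed_iInter fun x => isClosed_iInter fun y => isClosed_iInter fun z => ?_
    exact isClosed_eq (continuous_apply (x, y, z)) (continuous_apply (x, z, y)).neg
  · refine isClosed_iInter fun x => isClosed_iInter fun y => isClosed_iInter fun z => ?_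
    exact isClosed_eq (continuous_apply (x, y, z)) (continuous_apply (y, z, x))
  · refine isClosed_iInter fun x => isClosed_iInter fun y => isClosed_iInter fun z =>
      isClosed_iInter fun _ => ?_
    exact isClosed_eq (continuous_apply (x, y, z)) continuous_const

/-- The Hilbert space `ℓ²(T) = ℓ²(V) ⊕ ℓ²(E) ⊕ ℓ²(F)`. -/
abbrev L2 : Type _ := WithLp 2 (T.L2Vertex × WithLp 2 (T.L2Edge × T.L2Face))

theorem summable_of_support_finite {ι : Type*} (w : ι → ℝ) {f : ι → ℂ}
    (h : f.support.Finite) : Summable fun i => w i * ‖f i‖ ^ 2 :=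
  summable_of_hasFiniteSupport (h.subset fun i hi hf => hi (by simp [hf]))

/-- The inclusion of the cochains of finite support in the Hilbert space. -/
def toL2 : T.finCochain →ₗ[ℂ] T.L2 where
  toFun F := WithLp.toLp 2
    (WeightedL2.mk F.1.1 trivial (summable_of_support_finite _ F.2.1),
      WithLp.toLp 2
        (WeightedL2.mk F.1.2.1.1 F.1.2.1.2 (summable_of_support_finite _ F.2.2.1),
          WeightedL2.mk F.1.2.2.1 F.1.2.2.2 (summable_of_support_finite _ F.2.2.2)))
  map_add' _ _ := rfl
  map_smul' _ _ := rfl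

theorem toL2_injective : Function.Injective T.toL2 := by
  intro F G h
  have h1 : F.1.1 = G.1.1 := congrArg (fun u : T.L2 => u.fst.toFun) h
  have h2 : F.1.2.1.1 = G.1.2.1.1 := congrArg (fun u : T.L2 => u.snd.fst.toFun) h
  have h3 : F.1.2.2.1 = G.1.2.2.1 := congrArg (fun u : T.L2 => u.snd.snd.toFun) h
  exact Subtype.ext (Prod.ext h1 (Prod.ext (Subtype.ext h2) (Subtype.ext h3)))

/-- An operator from the cochains of finite support to themselves, seen as an unbounded operator
of the Hilbert space whose domain consists of the cochains of finite support. -/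
def toUnbounded (A : T.finCochain →ₗ[ℂ] T.finCochain) : T.L2 →ₗ.[ℂ] T.L2 where
  domain := LinearMap.range T.toL2
  toFun := T.toL2 ∘ₗ A ∘ₗ (LinearEquiv.ofInjective T.toL2 T.toL2_injective).symm.toLinearMap

/-! ### Completeness -/

/-- `χ`-completeness: there are an exhaustion by finite sets of vertices and cut-off functions of
finite support, equal to `1` on these sets, whose differences are bounded, in the sense of the
last two conditions, by a constant `C`. -/
def IsChiComplete : Prop :=
  ∃ C : ℝ, 0 < C ∧ ∃ (B : ℕ → Finset V) (χ : ℕ → V → ℝ),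
    Monotone B ∧ (∀ x, ∃ n, x ∈ B n) ∧
    (∀ n, (χ n).support.Finite ∧ (∀ x, 0 ≤ χ n x ∧ χ n x ≤ 1) ∧ ∀ x ∈ B n, χ n x = 1) ∧
    (∀ n x, 1 / T.c x * ∑ y ∈ T.nbr x, T.r y x * |χ n x - χ n y| ^ 2 ≤ C) ∧
    (∀ n x y, T.graph.Adj x y → 1 / T.r x y * ∑ t ∈ T.faceNbr x y,
      T.s x y t * |(χ n x - χ n t) + (χ n y - χ n t)| ^ 2 ≤ C)

end MagneticTriangulation

end

/-!
The Laplacian `Δ = T²` is symmetric, nonnegative and densely defined, so it is enough to show that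
for some `l > 0` the range of `Δ + l` is dense (`isEssentiallySelfAdjoint_of_nonneg`). An element
`u = (f, φ, ψ)` of `ℓ²` that is orthogonal to this range solves the equation `Δ u = -l u` pointwise,
and the task is to show that `u = 0` when `l` is large compared to the constant `K` of
`χ`-completeness. The equation splits by parity: one system for `(f, ψ)`, one equation for `φ`.

Everything rests on one summation by parts (`cutoff_identity`). Weights `μV`, `μE`, `μF` are put on
the vertices, edges and faces; the failure of `d⁰ + δ¹` to be adjoint to `(δ⁰, d¹)` for the weighted
scalar products is a sum over the edges with the factor `μV - μE` plus a sum over the faces with the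
factor `μF - μE`. With `D = |χ(x) - χ(y)|` and `D' = |χ(x) + χ(y) - 2 χ(t)|`,
`χ`-completeness bounds `∑ ρ D² |v(y)|²` by `K ∑ c |v|²` and `∑ σ D'² |w(x, y)|²` by
`K ∑ ρ |w|²` (`IsCutoff.sum_edge_le`, `IsCutoff.sum_face_le`), where `c`, `ρ`, `σ` are
the weights on the vertices, edges and faces.

For `(f, ψ)` the weights are `χ²` on the vertices, the square of the mean of `χ` on the edges, and
the square of the *median* of `χ` on the faces. Then `|μV - μE|` is at most a constant times `D`
times the mean of `χ` on the edge, and `|μF - μE|` at most a constant times `D'` times this mean, so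
the energy of `d⁰ f + δ¹ ψ` on the edges absorbs all the error terms. This leaves
`l ‖(f, ψ)‖² ≤ (27/2) K ‖(f, ψ)‖²` (`IsCutoff.vertex_face_le`, `vertex_face_eq_zero`).

For `φ` the errors must be absorbed by the energies of `δ⁰ φ` on the vertices and of `d¹ φ` on the
faces. Once `δ⁰ φ` and `d¹ φ` are known to be square-summable, this works for large `l`
(`edge_eq_zero`). That they are square-summable is an a priori estimate (`exists_cutoff_bound`),
which is not immediate: at a vertex `y` where `χ(y)` is much smaller than at a neighbour, the weight
`χ(y)²` does not control the error. The bad term is governed by `Θ = ∑ ρ D⁴ |δ⁰ φ(y)|²`. At the end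
of an edge where `χ` is smaller, `δ⁰ φ` is bounded by its value at the other end and by `d⁰ δ⁰ φ`,
so `Θ` is bounded by the good energy and `A = ∑ ρ D⁴ |d⁰ δ⁰ φ|²`. The equation
`d⁰ δ⁰ φ + δ¹ d¹ φ = -l φ`, tested with `D⁴ d⁰ δ⁰ φ`, bounds `A` by `φ`, `Θ` and the energy `Y` of
`d¹ φ` weighted by the squared diameter of the values of `χ` on the faces, and `cutoff_identity`
with the weights `0`, `D²`, diameter squared bounds `Y` in its turn. The resulting system of
inequalities is solved by absorption (`exists_bound_of_energy_system`).
-/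

noncomputable section

/-! ### A criterion for essential self-adjointness -/

section Criterion

open Filter Topology LinearPMap

variable {H : Type*} [NormedAddCommGroup H] [InnerProductSpace ℂ H]

/-- If `A ≥ 0`, then `A + l` is bounded from below by `l`. -/
theorem norm_le_of_nonneg_re_inner {A : H →ₗ.[ℂ] H}
    (hpos : ∀ v : A.domain, 0 ≤ (inner ℂ (v : H) (A v)).re) {l : ℝ} (hl : 0 < l)
    (v : A.domain) : ‖(v : H)‖ ≤ l⁻¹ * ‖A v + (l : ℂ) • (v : H)‖ := by
  have h1 : (inner ℂ (v : H) (A v + (l : ℂ) • (v : H))).re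
      = (inner ℂ (v : H) (A v)).re + l * ‖(v : H)‖ ^ 2 := by
    rw [inner_add_right, inner_smul_right, inner_self_eq_norm_sq_to_K, Complex.add_re]
    congr 1
    rw [Complex.re_ofReal_mul]
    norm_cast
  have h2 := (Complex.re_le_norm _).trans
    (norm_inner_le_norm (𝕜 := ℂ) (v : H) (A v + (l : ℂ) • (v : H)))
  rw [h1] at h2
  have h3 := hpos v
  rw [inv_mul_eq_div, le_div_iff₀ hl]
  rcases (norm_nonneg (v : H)).eq_or_lt with h | h
  · rw [← h, zero_mul]; exact norm_nonneg _
  · nlinarith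

variable [CompleteSpace H]

/-- If `A + l` has dense range and `A ≥ 0`, then the graph of `A` is dense in the graph of its
adjoint. -/
theorem exists_seq_tendsto_adjoint {A : H →ₗ.[ℂ] H} (hd : Dense (A.domain : Set H))
    (hs : A.IsFormalAdjoint A)
    (hpos : ∀ v : A.domain, 0 ≤ (inner ℂ (v : H) (A v)).re) {l : ℝ} (hl : 0 < l)
    (hker : ∀ u : H, (∀ v : A.domain, inner ℂ u (A v + (l : ℂ) • (v : H)) = 0) → u = 0)
    (u : A.adjoint.domain) :
    ∃ v : ℕ → A.domain, Tendsto (fun n => (v n : H)) atTop (𝓝 u) ∧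
      Tendsto (fun n => A (v n)) atTop (𝓝 (A.adjoint u)) := by
  set L : A.domain →ₗ[ℂ] H := A.toFun + (l : ℂ) • A.domain.subtype with hL
  have hLa : ∀ v, L v = A v + (l : ℂ) • (v : H) := fun v => rfl
  have hdense : (LinearMap.range L).topologicalClosure = ⊤ := by
    rw [Submodule.topologicalClosure_eq_top_iff, eq_bot_iff]
    intro x hx
    refine hker x fun v => ?_
    exact (Submodule.mem_orthogonal' _ x).1 hx _ ⟨v, rfl⟩
  have hmem : A.adjoint u + (l : ℂ) • (u : H) ∈ closure (LinearMap.range L : Set H) := by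
    rw [← Submodule.topologicalClosure_coe, hdense]
    trivial
  obtain ⟨y, hy, hlim⟩ := mem_closure_iff_seq_limit.1 hmem
  choose v hv using hy
  have hbound : ∀ v w : A.domain, dist (v : H) w ≤ l⁻¹ * dist (L v) (L w) := fun v w => by
    rw [dist_eq_norm, dist_eq_norm, ← _root_.map_sub]
    exact norm_le_of_nonneg_re_inner hpos hl (v - w)
  have hcau : CauchySeq fun n => (v n : H) := by
    rw [Metric.cauchySeq_iff]
    intro ε hε
    obtain ⟨N, hN⟩ := Metric.cauchySeq_iff.1 hlim.cauchySeq (l * ε) (by positivity)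
    refine ⟨N, fun m hm n hn => ?_⟩
    have h1 := hN m hm n hn
    rw [← hv, ← hv] at h1
    have h2 := hbound (v m) (v n)
    calc dist (v m : H) (v n) ≤ l⁻¹ * dist (L (v m)) (L (v n)) := h2
      _ < l⁻¹ * (l * ε) := by gcongr
      _ = ε := by field_simp
  obtain ⟨u', hu'⟩ := cauchySeq_tendsto_of_complete hcau
  have hA : Tendsto (fun n => A (v n)) atTop
      (𝓝 (A.adjoint u + (l : ℂ) • (u : H) - (l : ℂ) • u')) := by
    refine (hlim.sub (hu'.const_smul (l : ℂ))).congr fun n => ?_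
    rw [← hv, hLa, add_sub_cancel_right]
  -- the limit `u'` solves the same equation as `u`, so the two agree
  have huu : (u : H) - u' = 0 := by
    refine hker _ fun w => ?_
    have h1 : inner ℂ u' (A w) =
        inner ℂ (A.adjoint u + (l : ℂ) • (u : H) - (l : ℂ) • u') (w : H) := by
      have h2 := hu'.inner (𝕜 := ℂ) (tendsto_const_nhds (x := A w))
      have h3 := hA.inner (𝕜 := ℂ) (tendsto_const_nhds (x := (w : H)))
      exact tendsto_nhds_unique h2 (h3.congr fun n => hs (v n) w)
    have h4 : inner ℂ (A.adjoint u) (w : H) = inner ℂ (u : H) (A w) :=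
      adjoint_isFormalAdjoint hd u w
    rw [inner_sub_left, inner_add_right, inner_add_right, h1, ← h4]
    simp only [inner_sub_left, inner_add_left, inner_smul_left, inner_smul_right,
      Complex.conj_ofReal]
    ring
  have hu : (u : H) = u' := sub_eq_zero.1 huu
  refine ⟨v, hu ▸ hu', ?_⟩
  rw [← hu, add_sub_cancel_right] at hA
  exact hA

/-- A nonnegative symmetric operator `A` is essentially self-adjoint as soon as the range of
`A + l` is dense for one `l > 0`; the self-adjoint extension is then the adjoint. -/
theorem isEssentiallySelfAdjoint_of_nonneg {A : H →ₗ.[ℂ] H} (hd : Dense (A.domain : Set H))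
    (hs : A.IsFormalAdjoint A)
    (hpos : ∀ v : A.domain, 0 ≤ (inner ℂ (v : H) (A v)).re) {l : ℝ} (hl : 0 < l)
    (hker : ∀ u : H, (∀ v : A.domain, inner ℂ u (A v + (l : ℂ) • (v : H)) = 0) → u = 0) :
    IsEssentiallySelfAdjoint A := by
  have hle : A ≤ A.adjoint := hs.le_adjoint hd
  have hd' : Dense (A.adjoint.domain : Set H) := hd.mono hle.1
  have anti : ∀ {B C : H →ₗ.[ℂ] H}, Dense (B.domain : Set H) → B ≤ C → C.adjoint ≤ B.adjoint := by
    intro B C hB hBC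
    have hC : Dense (C.domain : Set H) := hB.mono hBC.1
    refine IsFormalAdjoint.le_adjoint hB fun x y => ?_
    rw [hBC.2 (x := x) (y := ⟨x, hBC.1 x.2⟩) rfl]
    exact (adjoint_isFormalAdjoint hC).symm ⟨x, hBC.1 x.2⟩ y
  have hsymm : A.adjoint.IsFormalAdjoint A.adjoint := by
    intro u y
    obtain ⟨v, hv, hAv⟩ := exists_seq_tendsto_adjoint hd hs hpos hl hker u
    have h2 := hAv.inner (𝕜 := ℂ) (tendsto_const_nhds (x := (y : H)))
    have h3 := hv.inner (𝕜 := ℂ) (tendsto_const_nhds (x := A.adjoint y))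
    exact tendsto_nhds_unique h2
      (h3.congr fun n => ((adjoint_isFormalAdjoint hd).symm (v n) y).symm)
  have hsa : IsSelfAdjoint A.adjoint :=
    isSelfAdjoint_def.2 (le_antisymm (anti hd hle) (hsymm.le_adjoint hd'))
  refine ⟨hd, hs, A.adjoint, ⟨hle, hsa⟩, ?_⟩
  rintro B ⟨hAB, hB⟩
  have h1 : B ≤ A.adjoint := by
    have := anti hd hAB
    rwa [isSelfAdjoint_def.1 hB] at this
  have h2 : A.adjoint ≤ B := by
    have := anti (hd.mono hAB.1) h1
    rwa [isSelfAdjoint_def.1 hB, isSelfAdjoint_def.1 hsa] at this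
  exact le_antisymm h1 h2

end Criterion

/-! ### Summation by parts with weights -/

theorem sum_sum_sum_rotate {V M : Type*} [AddCommMonoid M] (S : Finset V) (f : V → V → V → M) :
    ∑ x ∈ S, ∑ y ∈ S, ∑ z ∈ S, f y z x = ∑ x ∈ S, ∑ y ∈ S, ∑ z ∈ S, f x y z := by
  rw [Finset.sum_comm]
  exact Finset.sum_congr rfl fun y _ => Finset.sum_comm

namespace MagneticTriangulation

variable {V : Type*} (T : MagneticTriangulation V)

theorem conj_phase (t : ℝ) : conj (phase t) = phase (-t) := by
  simp [phase, ← Complex.exp_conj]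

theorem norm_phase (t : ℝ) : ‖phase t‖ = 1 := by
  rw [phase, mul_comm]; exact Complex.norm_exp_ofReal_mul_I t

open Classical in
/-- The weight on the edges, extended by `0` to all pairs of vertices. -/
def edgeWeight (x y : V) : ℝ := if T.graph.Adj x y then T.r x y else 0

open Classical in
/-- The weight on the faces, extended by `0` to all triples of vertices. -/
def faceWeight (x y t : V) : ℝ := if T.face x y t then T.s x y t else 0

theorem edgeWeight_nonneg (x y : V) : 0 ≤ T.edgeWeight x y := by
  unfold edgeWeight; split_ifs with h
  · exact (T.r_pos _ _ h).le
  · rfl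

theorem faceWeight_nonneg (x y t : V) : 0 ≤ T.faceWeight x y t := by
  unfold faceWeight; split_ifs with h
  · exact (T.s_pos _ _ _ h).le
  · rfl

theorem edgeWeight_symm (x y : V) : T.edgeWeight x y = T.edgeWeight y x := by
  unfold edgeWeight
  by_cases h : T.graph.Adj x y
  · simp [h, h.symm, T.r_symm x y h]
  · have h' : ¬ T.graph.Adj y x := fun h' => h h'.symm
    simp [h, h']

theorem faceWeight_rot (x y t : V) : T.faceWeight x y t = T.faceWeight y t x := by
  unfold faceWeight
  by_cases h : T.face x y t
  · simp [h, T.face_rot _ _ _ h, T.s_rot x y t h]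
  · have h' : ¬ T.face y t x := fun h' => h (T.face_rot _ _ _ (T.face_rot _ _ _ h'))
    simp [h, h']

theorem faceWeight_swap (x y t : V) : T.faceWeight x y t = T.faceWeight x t y := by
  have hsw : ∀ x y z, T.face x y z → T.face x z y := fun x y z h =>
    T.face_swap _ _ _ (T.face_rot _ _ _ (T.face_rot _ _ _ h))
  unfold faceWeight
  by_cases h : T.face x y t
  · simp [h, hsw _ _ _ h, T.s_swap x y t h]
  · have h' : ¬ T.face x t y := fun h' => h (hsw _ _ _ h')
    simp [h, h']

theorem edgeWeight_eq_zero {x y : V} (h : ¬ T.graph.Adj x y) : T.edgeWeight x y = 0 := by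
  simp [edgeWeight, h]

theorem faceWeight_eq_zero {x y t : V} (h : ¬ T.face x y t) : T.faceWeight x y t = 0 := by
  simp [faceWeight, h]

/-- A sum over the neighbours of `y` as a sum over a set of vertices containing them. -/
theorem sum_edgeWeight_eq {M : Type*} [AddCommMonoid M] {S : Finset V} {y : V}
    (hS : T.nbr y ⊆ S) (f : ℝ → V → M) (h0 : ∀ x, f 0 x = 0) :
    ∑ x ∈ S, f (T.edgeWeight x y) x = ∑ x ∈ T.nbr y, f (T.r x y) x := by
  rw [← Finset.sum_subset hS fun x _ hx => ?_]
  · refine Finset.sum_congr rfl fun x hx => ?_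
    have := (T.mem_nbr.1 hx).symm
    simp [edgeWeight, this]
  · have : ¬ T.graph.Adj x y := fun h => hx (T.mem_nbr.2 h.symm)
    rw [T.edgeWeight_eq_zero this, h0]

theorem sum_faceWeight_eq {M : Type*} [AddCommMonoid M] {S : Finset V} {x y : V}
    (hS : T.faceNbr x y ⊆ S) (f : ℝ → V → M) (h0 : ∀ t, f 0 t = 0) :
    ∑ t ∈ S, f (T.faceWeight x y t) t = ∑ t ∈ T.faceNbr x y, f (T.s x y t) t := by
  rw [← Finset.sum_subset hS fun t _ ht => ?_]
  · refine Finset.sum_congr rfl fun t ht => ?_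
    simp [faceWeight, T.mem_faceNbr.1 ht]
  · have : ¬ T.face x y t := fun h => ht (T.mem_faceNbr.2 h)
    rw [T.faceWeight_eq_zero this, h0]

theorem nbr_subset_of_thicken {S S₁ : Finset V} (hS : T.thicken S₁ ⊆ S) {x : V} (hx : x ∈ S₁) :
    T.nbr x ⊆ S := fun _ hy => hS (T.mem_thicken_of_adj hx (T.mem_nbr.1 hy))

theorem faceNbr_subset_of_thicken {S S₁ : Finset V} (hS : T.thicken S₁ ⊆ S) {x y : V}
    (hxy : x ∈ S₁ ∨ y ∈ S₁) : T.faceNbr x y ⊆ S := by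
  intro t ht
  obtain ⟨_, hyt, htx⟩ := T.face_cycle _ _ _ (T.mem_faceNbr.1 ht)
  rcases hxy with h | h
  · exact hS (T.mem_thicken_of_adj h htx.symm)
  · exact hS (T.mem_thicken_of_adj h hyt)

theorem c_mul_conj_delta0 {S S₁ : Finset V} (hS : T.thicken S₁ ⊆ S) (φ : T.skewEdge) {y : V}
    (hy : y ∈ S₁) : (T.c y : ℂ) * conj (T.delta0 φ y)
      = ∑ x ∈ S, (T.edgeWeight x y : ℂ) * (conj (φ.1 (x, y)) * phase (T.α y x / 2)) := by
  rw [T.sum_edgeWeight_eq (T.nbr_subset_of_thicken hS hy)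
    (fun w x => (w : ℂ) * (conj (φ.1 (x, y)) * phase (T.α y x / 2))) (by simp)]
  have hc : (T.c y : ℂ) ≠ 0 := by exact_mod_cast (T.c_pos y).ne'
  simp only [delta0, LinearMap.coe_mk, AddHom.coe_mk, map_mul, map_sum, map_div₀, map_one,
    Complex.conj_ofReal, conj_phase]
  rw [← mul_assoc, mul_one_div_cancel hc, one_mul]
  refine Finset.sum_congr rfl fun x hx => ?_
  rw [T.α_skew y x (T.mem_nbr.1 hx), neg_div]
  ring

theorem edgeWeight_mul_delta1 {S S₁ : Finset V} (hS : T.thicken S₁ ⊆ S) (ψ : T.skewFace)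
    {x y : V} (hxy : x ∈ S₁ ∨ y ∈ S₁) : (T.edgeWeight x y : ℂ) * (T.delta1 ψ).1 (x, y)
      = ∑ t ∈ S, (T.faceWeight x y t : ℂ) *
        (phase ((T.α t x + T.α t y) / 6) * ψ.1 (x, y, t)) := by
  by_cases h : T.graph.Adj x y
  · rw [T.sum_faceWeight_eq (T.faceNbr_subset_of_thicken hS hxy)
      (fun w t => (w : ℂ) * (phase ((T.α t x + T.α t y) / 6) * ψ.1 (x, y, t))) (by simp)]
    have hr : (T.r x y : ℂ) ≠ 0 := by exact_mod_cast (T.r_pos x y h).ne'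
    simp only [delta1, LinearMap.coe_mk, AddHom.coe_mk, edgeWeight, h, if_true]
    rw [← mul_assoc, mul_one_div_cancel hr, one_mul]
    exact Finset.sum_congr rfl fun t _ => by ring
  · rw [T.edgeWeight_eq_zero h, Finset.sum_eq_zero fun t _ => ?_]
    · simp
    · rw [T.faceWeight_eq_zero fun hf => h (T.face_cycle _ _ _ hf).1]; simp

/-- As both factors are skewsymmetric, the two vertices of an edge contribute the same. -/
theorem sum_edge_conj_mul_d0 (S : Finset V) (μE : V → V → ℝ) (hμ : ∀ x y, μE x y = μE y x)
    (g : V → ℂ) (φ : T.skewEdge) :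
    1 / 2 * ∑ x ∈ S, ∑ y ∈ S, (T.edgeWeight x y : ℂ) * μE x y *
        (conj (φ.1 (x, y)) * (T.d0 g).1 (x, y))
      = ∑ x ∈ S, ∑ y ∈ S, (T.edgeWeight x y : ℂ) * μE x y *
        (conj (φ.1 (x, y)) * phase (T.α y x / 2) * g y) := by
  have h1 : ∀ x y, (T.edgeWeight x y : ℂ) * μE x y * (conj (φ.1 (x, y)) * (T.d0 g).1 (x, y))
      = (T.edgeWeight x y : ℂ) * μE x y * (conj (φ.1 (x, y)) * phase (T.α y x / 2) * g y)
        + (T.edgeWeight y x : ℂ) * μE y x *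
          (conj (φ.1 (y, x)) * phase (T.α x y / 2) * g x) := fun x y => by
    rw [T.edgeWeight_symm y x, hμ y x, φ.2.1 y x, map_neg]
    by_cases h : T.graph.Adj x y
    · simp only [d0, LinearMap.coe_mk, AddHom.coe_mk, h, if_true]
      ring
    · simp [T.edgeWeight_eq_zero h]
  simp only [h1, Finset.sum_add_distrib]
  rw [Finset.sum_comm (f := fun x y => (T.edgeWeight y x : ℂ) * μE y x *
          (conj (φ.1 (y, x)) * phase (T.α x y / 2) * g x))]
  ring

/-- The three edges of a face contribute the same. -/
theorem sum_face_conj_d1_mul (S : Finset V) (μF : V → V → V → ℝ)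
    (hμ : ∀ x y t, μF x y t = μF y t x) (φ : T.skewEdge) (ψ : T.skewFace) :
    1 / 6 * ∑ x ∈ S, ∑ y ∈ S, ∑ t ∈ S, (T.faceWeight x y t : ℂ) * μF x y t *
        (conj ((T.d1 φ).1 (x, y, t)) * ψ.1 (x, y, t))
      = 1 / 2 * ∑ x ∈ S, ∑ y ∈ S, ∑ t ∈ S, (T.faceWeight x y t : ℂ) * μF x y t *
        (conj (φ.1 (x, y)) * phase ((T.α t x + T.α t y) / 6) * ψ.1 (x, y, t)) := by
  set f : V → V → V → ℂ := fun x y t => (T.faceWeight x y t : ℂ) * μF x y t *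
        (conj (φ.1 (x, y)) * phase ((T.α t x + T.α t y) / 6) * ψ.1 (x, y, t)) with hf
  have h1 : ∀ x y t, (T.faceWeight x y t : ℂ) * μF x y t *
        (conj ((T.d1 φ).1 (x, y, t)) * ψ.1 (x, y, t)) = f x y t + f y t x + f t x y := by
    intro x y t
    have e1 : T.faceWeight y t x = T.faceWeight x y t := (T.faceWeight_rot x y t).symm
    have e2 : T.faceWeight t x y = T.faceWeight x y t := by rw [← e1, T.faceWeight_rot y t x]
    have m1 : μF y t x = μF x y t := (hμ x y t).symm
    have m2 : μF t x y = μF x y t := by rw [← m1, hμ y t x]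
    have p1 : ψ.1 (y, t, x) = ψ.1 (x, y, t) := (ψ.2.2.1 x y t).symm
    have p2 : ψ.1 (t, x, y) = ψ.1 (x, y, t) := by rw [← p1, ψ.2.2.1 y t x]
    simp only [hf, e1, e2, m1, m2, p1, p2]
    by_cases h : T.face x y t
    · obtain ⟨hxy, hyt, htx⟩ := T.face_cycle _ _ _ h
      have a1 : -((T.α x t + T.α y t) / 6) = (T.α t x + T.α t y) / 6 := by
        rw [T.α_skew x t htx.symm, T.α_skew y t hyt]; ring
      have a2 : -((T.α y x + T.α t x) / 6) = (T.α x y + T.α x t) / 6 := by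
        rw [T.α_skew y x hxy.symm, T.α_skew t x htx]; ring
      have a3 : -((T.α t y + T.α x y) / 6) = (T.α y t + T.α y x) / 6 := by
        rw [T.α_skew t y hyt.symm, T.α_skew x y hxy]; ring
      simp only [d1, LinearMap.coe_mk, AddHom.coe_mk, h, if_true, map_add, map_mul, conj_phase,
        a1, a2, a3]
      ring
    · simp [T.faceWeight_eq_zero h]
  simp only [h1, Finset.sum_add_distrib]
  rw [sum_sum_sum_rotate S f, ← sum_sum_sum_rotate S (fun x y t => f t x y)]
  ring

/-- Summation by parts against weights, those on the vertices and edges vanishing away from the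
finite set `S₁` and those on the faces being arbitrary: the differences of the weights
measure the failure of `(δ⁰, d¹)` and `d⁰ + δ¹` to be adjoint to each other. -/
theorem cutoff_identity {S S₁ : Finset V} (hS : T.thicken S₁ ⊆ S)
    (μV : V → ℝ) (μE : V → V → ℝ) (μF : V → V → V → ℝ)
    (hV : ∀ x, x ∉ S₁ → μV x = 0) (hE : ∀ x y, x ∉ S₁ → y ∉ S₁ → μE x y = 0)
    (hEs : ∀ x y, μE x y = μE y x) (hFr : ∀ x y t, μF x y t = μF y t x)
    (g : V → ℂ) (φ : T.skewEdge) (ψ : T.skewFace) :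
    ∑ x ∈ S, (T.c x : ℂ) * μV x * (conj (T.delta0 φ x) * g x)
      + 1 / 6 * ∑ x ∈ S, ∑ y ∈ S, ∑ t ∈ S, (T.faceWeight x y t : ℂ) * μF x y t *
        (conj ((T.d1 φ).1 (x, y, t)) * ψ.1 (x, y, t))
      - 1 / 2 * ∑ x ∈ S, ∑ y ∈ S, (T.edgeWeight x y : ℂ) * μE x y *
        (conj (φ.1 (x, y)) * (T.d0 g + T.delta1 ψ).1 (x, y))
    = ∑ x ∈ S, ∑ y ∈ S, (T.edgeWeight x y : ℂ) * ((μV y : ℂ) - μE x y) *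
        (conj (φ.1 (x, y)) * phase (T.α y x / 2) * g y)
      + 1 / 2 * ∑ x ∈ S, ∑ y ∈ S, ∑ t ∈ S, (T.faceWeight x y t : ℂ) *
        ((μF x y t : ℂ) - μE x y) *
        (conj (φ.1 (x, y)) * phase ((T.α t x + T.α t y) / 6) * ψ.1 (x, y, t)) := by
  have h0 : ∑ x ∈ S, (T.c x : ℂ) * μV x * (conj (T.delta0 φ x) * g x)
      = ∑ x ∈ S, ∑ y ∈ S, (T.edgeWeight x y : ℂ) * μV y *
        (conj (φ.1 (x, y)) * phase (T.α y x / 2) * g y) := by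
    rw [Finset.sum_comm]
    refine Finset.sum_congr rfl fun y _ => ?_
    by_cases hy : y ∈ S₁
    · calc (T.c y : ℂ) * μV y * (conj (T.delta0 φ y) * g y)
          = ((T.c y : ℂ) * conj (T.delta0 φ y)) * (μV y * g y) := by ring
        _ = _ := by
          rw [T.c_mul_conj_delta0 hS φ hy, Finset.sum_mul]
          exact Finset.sum_congr rfl fun x _ => by ring
    · simp [hV y hy]
  have h1 : ∑ x ∈ S, ∑ y ∈ S, (T.edgeWeight x y : ℂ) * μE x y *
        (conj (φ.1 (x, y)) * (T.d0 g + T.delta1 ψ).1 (x, y))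
      = ∑ x ∈ S, ∑ y ∈ S, (T.edgeWeight x y : ℂ) * μE x y *
        (conj (φ.1 (x, y)) * (T.d0 g).1 (x, y))
      + ∑ x ∈ S, ∑ y ∈ S, ∑ t ∈ S, (T.faceWeight x y t : ℂ) * μE x y *
        (conj (φ.1 (x, y)) * phase ((T.α t x + T.α t y) / 6) * ψ.1 (x, y, t)) := by
    rw [← Finset.sum_add_distrib]
    refine Finset.sum_congr rfl fun x _ => ?_
    rw [← Finset.sum_add_distrib]
    refine Finset.sum_congr rfl fun y _ => ?_
    by_cases hxy : x ∈ S₁ ∨ y ∈ S₁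
    · have h2 := T.edgeWeight_mul_delta1 hS ψ hxy
      calc (T.edgeWeight x y : ℂ) * μE x y * (conj (φ.1 (x, y)) * (T.d0 g + T.delta1 ψ).1 (x, y))
          = (T.edgeWeight x y : ℂ) * μE x y * (conj (φ.1 (x, y)) * (T.d0 g).1 (x, y))
            + ((T.edgeWeight x y : ℂ) * (T.delta1 ψ).1 (x, y)) *
              (μE x y * conj (φ.1 (x, y))) := by
            rw [Submodule.coe_add, Pi.add_apply]; ring
        _ = _ := by
          rw [h2, Finset.sum_mul]
          congr 1
          exact Finset.sum_congr rfl fun t _ => by ring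
    · rw [not_or] at hxy
      simp [hE x y hxy.1 hxy.2]
  rw [h0, h1, mul_add, T.sum_edge_conj_mul_d0 S μE hEs g φ, T.sum_face_conj_d1_mul S μF hFr φ ψ]
  simp only [mul_sub, sub_mul, Finset.sum_sub_distrib]
  ring

end MagneticTriangulation

/-! ### Elementary inequalities -/

theorem weighted_cauchy_schwarz {ι : Type*} (s : Finset ι) (w a b : ι → ℝ)
    (hw : ∀ i ∈ s, 0 ≤ w i) {A B : ℝ} (hA : ∑ i ∈ s, w i * a i ^ 2 ≤ A)
    (hB : ∑ i ∈ s, w i * b i ^ 2 ≤ B) :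
    ∑ i ∈ s, w i * (a i * b i) ≤ √A * √B := by
  have h1 := Real.sum_mul_le_sqrt_mul_sqrt s (fun i => √(w i) * a i) (fun i => √(w i) * b i)
  have h2 : ∑ i ∈ s, (√(w i) * a i) * (√(w i) * b i) = ∑ i ∈ s, w i * (a i * b i) :=
    Finset.sum_congr rfl fun i hi => by
      rw [mul_mul_mul_comm, Real.mul_self_sqrt (hw i hi)]
  have h3 : ∀ c : ι → ℝ, ∑ i ∈ s, (√(w i) * c i) ^ 2 = ∑ i ∈ s, w i * c i ^ 2 := fun c =>
    Finset.sum_congr rfl fun i hi => by rw [mul_pow, Real.sq_sqrt (hw i hi)]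
  rw [h2, h3, h3] at h1
  exact h1.trans (mul_le_mul (Real.sqrt_le_sqrt hA) (Real.sqrt_le_sqrt hB) (Real.sqrt_nonneg _)
    (Real.sqrt_nonneg _))

theorem weighted_cauchy_schwarz₂ {V : Type*} (S : Finset V) (w a b : V → V → ℝ)
    (hw : ∀ x y, 0 ≤ w x y) {A B : ℝ} (hA : ∑ x ∈ S, ∑ y ∈ S, w x y * a x y ^ 2 ≤ A)
    (hB : ∑ x ∈ S, ∑ y ∈ S, w x y * b x y ^ 2 ≤ B) :
    ∑ x ∈ S, ∑ y ∈ S, w x y * (a x y * b x y) ≤ √A * √B := by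
  rw [← Finset.sum_product'] at hA hB ⊢
  exact weighted_cauchy_schwarz (S ×ˢ S) (fun i => w i.1 i.2) (fun i => a i.1 i.2)
    (fun i => b i.1 i.2) (fun i _ => hw _ _) hA hB

theorem weighted_cauchy_schwarz₃ {V : Type*} (S : Finset V) (w a b : V → V → V → ℝ)
    (hw : ∀ x y t, 0 ≤ w x y t) {A B : ℝ}
    (hA : ∑ x ∈ S, ∑ y ∈ S, ∑ t ∈ S, w x y t * a x y t ^ 2 ≤ A)
    (hB : ∑ x ∈ S, ∑ y ∈ S, ∑ t ∈ S, w x y t * b x y t ^ 2 ≤ B) :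
    ∑ x ∈ S, ∑ y ∈ S, ∑ t ∈ S, w x y t * (a x y t * b x y t) ≤ √A * √B := by
  simp only [← Finset.sum_product'] at hA hB ⊢
  exact weighted_cauchy_schwarz (S ×ˢ S ×ˢ S) (fun i => w i.1 i.2.1 i.2.2)
    (fun i => a i.1 i.2.1 i.2.2)
    (fun i => b i.1 i.2.1 i.2.2) (fun i _ => hw _ _ _) hA hB

/-- The median of three numbers. -/
def median (a b t : ℝ) : ℝ := max (min a b) (min (max a b) t)

theorem median_rot (a b t : ℝ) : median a b t = median b t a := by
  unfold median
  rcases le_total a b with h1 | h1 <;> rcases le_total b t with h2 | h2 <;>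
    rcases le_total a t with h3 | h3 <;> simp [h1, h2, h3] <;> grind

/-- With `m` the median, `|m - (a + b) / 2| ≤ |a + b - 2 t| / 2` and `m ≤ a + b`. The second bound
is what makes the factor `(a + b) / 2` come out; it fails for the mean of the three numbers. -/
theorem abs_median_sq_sub_le {a b : ℝ} (ha : 0 ≤ a) (hb : 0 ≤ b) (t : ℝ) :
    |median a b t ^ 2 - ((a + b) / 2) ^ 2| ≤ 3 / 2 * (|a + b - 2 * t| * ((a + b) / 2)) := by
  have h1 : |median a b t - (a + b) / 2| ≤ |a + b - 2 * t| / 2 := by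
    unfold median
    rcases le_total a b with h1 | h1 <;> simp only [h1, min_eq_left, min_eq_right, max_eq_left,
      max_eq_right] <;> rw [abs_le] <;> constructor <;>
      cases abs_cases (a + b - 2 * t) <;> cases max_cases (min a b) (min (max a b) t) <;> grind
  have h2 : 0 ≤ median a b t ∧ median a b t ≤ a + b := by
    unfold median
    constructor
    · exact le_max_of_le_left (le_min ha hb)
    · refine max_le ((min_le_left _ _).trans (by linarith)) ((min_le_left _ _).trans ?_)
      exact max_le (by linarith) (by linarith)
  have h3 : median a b t ^ 2 - ((a + b) / 2) ^ 2
      = (median a b t - (a + b) / 2) * (median a b t + (a + b) / 2) := by ring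
  rw [h3, abs_mul, abs_of_nonneg (a := median a b t + (a + b) / 2) (by linarith)]
  calc _ ≤ |a + b - 2 * t| / 2 * (3 * ((a + b) / 2)) :=
        mul_le_mul h1 (by linarith) (by linarith) (by positivity)
    _ = _ := by ring

theorem abs_sq_sub_mean_sq_le {a b : ℝ} (ha : 0 ≤ a) (hb : 0 ≤ b) :
    |b ^ 2 - ((a + b) / 2) ^ 2| ≤ 3 / 2 * (|a - b| * ((a + b) / 2)) := by
  have h3 : b ^ 2 - ((a + b) / 2) ^ 2 = (b - a) / 2 * (b + (a + b) / 2) := by ring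
  rw [h3, abs_mul, abs_div, abs_sub_comm b a, abs_of_pos (two_pos : (0 : ℝ) < 2),
    abs_of_nonneg (a := b + (a + b) / 2) (by linarith)]
  have := mul_le_mul_of_nonneg_left (show b + (a + b) / 2 ≤ 3 * ((a + b) / 2) by linarith)
    (show 0 ≤ |a - b| / 2 by positivity)
  linarith

theorem abs_sq_sub_mean_sq_le' {a b : ℝ} (hb : 0 ≤ b) :
    |b ^ 2 - ((a + b) / 2) ^ 2| ≤ |a - b| * b + 1 / 4 * |a - b| ^ 2 := by
  have h3 : b ^ 2 - ((a + b) / 2) ^ 2 = (b - a) * b - 1 / 4 * (a - b) ^ 2 := by ring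
  rw [h3]
  refine (abs_sub _ _).trans ?_
  rw [abs_mul, abs_mul, abs_sub_comm b a, abs_of_nonneg hb, abs_of_pos (by norm_num : (0:ℝ) < 1/4),
    abs_pow]

theorem abs_sq_sub_mean_sq_le_abs {a b : ℝ} (ha : 0 ≤ a) (ha' : a ≤ 1) (hb : 0 ≤ b)
    (hb' : b ≤ 1) : |b ^ 2 - ((a + b) / 2) ^ 2| ≤ |a - b| := by
  have h3 : b ^ 2 - ((a + b) / 2) ^ 2 = (b - a) / 2 * (b + (a + b) / 2) := by ring
  rw [h3, abs_mul, abs_div, abs_sub_comm b a, abs_of_pos (two_pos : (0 : ℝ) < 2),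
    abs_of_nonneg (a := b + (a + b) / 2) (by linarith)]
  have := mul_le_mul_of_nonneg_left (show b + (a + b) / 2 ≤ 2 by linarith)
    (show 0 ≤ |a - b| / 2 by positivity)
  linarith

theorem abs_mean_sq_sub_le {a b t : ℝ} (ha : 0 ≤ a) (hb : 0 ≤ b) (ht : 0 ≤ t) :
    |((a + b + t) / 3) ^ 2 - ((a + b) / 2) ^ 2| ≤
      5 / 12 * (|a + b - 2 * t| * ((a + b + t) / 3)) := by
  have h3 : ((a + b + t) / 3) ^ 2 - ((a + b) / 2) ^ 2
      = -((a + b - 2 * t) / 6) * ((a + b + t) / 3 + (a + b) / 2) := by ring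
  rw [h3, abs_mul, abs_neg, abs_div, abs_of_pos (by norm_num : (0 : ℝ) < 6),
    abs_of_nonneg (a := (a + b + t) / 3 + (a + b) / 2) (by linarith)]
  have := mul_le_mul_of_nonneg_left
    (show (a + b + t) / 3 + (a + b) / 2 ≤ 5 / 2 * ((a + b + t) / 3) by linarith)
    (show 0 ≤ |a + b - 2 * t| / 6 by positivity)
  linarith

/-- The diameter of the set formed by three real numbers. -/
def diam₃ (a b t : ℝ) : ℝ := max |a - b| (max |b - t| |t - a|)

theorem diam₃_rot (a b t : ℝ) : diam₃ a b t = diam₃ b t a := by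
  unfold diam₃; rw [max_comm, max_assoc]

theorem abs_sub_le_diam₃ (a b t : ℝ) : |a - b| ≤ diam₃ a b t := le_max_left _ _

theorem diam₃_nonneg (a b t : ℝ) : 0 ≤ diam₃ a b t := (abs_nonneg _).trans (abs_sub_le_diam₃ a b t)

theorem diam₃_swap (a b t : ℝ) : diam₃ a b t = diam₃ b a t := by
  unfold diam₃; rw [abs_sub_comm a b, abs_sub_comm b t, abs_sub_comm t a, max_comm |t - b|]

/-- If `t` lies between `a` and `b`, then `|a - b|` is the diameter; otherwise the diameter is at
most `|a + b - 2 t|`. -/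
theorem abs_diam₃_sq_sub_le (a b t : ℝ) :
    |diam₃ a b t ^ 2 - |a - b| ^ 2| ≤ |a + b - 2 * t| * diam₃ a b t := by
  have h0 := abs_sub_le_diam₃ a b t
  have h1 := diam₃_nonneg a b t
  rw [abs_of_nonneg (by nlinarith [abs_nonneg (a - b)])]
  have h2 : diam₃ a b t = |a - b| ∨ diam₃ a b t ≤ |a + b - 2 * t| := by
    unfold diam₃
    cases abs_cases (a - b) <;> cases abs_cases (b - t) <;> cases abs_cases (t - a) <;>
      cases abs_cases (a + b - 2 * t) <;>
      cases max_cases |b - t| |t - a| <;> cases max_cases |a - b| (max |b - t| |t - a|) <;> grind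
  rcases h2 with h | h
  · rw [h]; nlinarith [abs_nonneg (a - b), abs_nonneg (a + b - 2 * t)]
  · nlinarith [sq_nonneg |a - b|]

/-- Here `p` and `q` are the differences along two sides of a triangle, `q` being the longer one. If
`p` is small compared to `q`, the second term is large, otherwise the first one is. -/
theorem sixth_power_le_of_abs_le {p q : ℝ} (h : |p| ≤ |q|) :
    q ^ 6 ≤ 64 * (p ^ 4 * (p - 2 * q) ^ 2 + q ^ 4 * (q - 2 * p) ^ 2) := by
  rcases le_or_gt |p| (3 / 8 * |q|) with h1 | h1
  · have h2 : q ^ 2 ≤ 16 * (q - 2 * p) ^ 2 := by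
      rw [show 16 * (q - 2 * p) ^ 2 = (4 * (q - 2 * p)) ^ 2 by ring, sq_le_sq, abs_mul,
        abs_of_pos (by norm_num : (0 : ℝ) < 4)]
      have := abs_sub_abs_le_abs_sub q (2 * p)
      rw [abs_mul 2 p, abs_two] at this
      linarith
    have h3 : 0 ≤ p ^ 4 * (p - 2 * q) ^ 2 := by positivity
    have h4 : 0 ≤ q ^ 4 * (q - 2 * p) ^ 2 := by positivity
    have h5 := mul_le_mul_of_nonneg_left h2 (show 0 ≤ q ^ 4 by positivity)
    nlinarith
  · have h2 : q ^ 2 ≤ (p - 2 * q) ^ 2 := by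
      rw [sq_le_sq]
      have := abs_sub_abs_le_abs_sub (2 * q) p
      rw [abs_mul 2 q, abs_two, abs_sub_comm] at this
      linarith
    have h3 : 9 / 64 * q ^ 2 ≤ p ^ 2 := by
      have : (3 / 8 * |q|) ^ 2 ≤ |p| ^ 2 := by gcongr
      rw [mul_pow, sq_abs, sq_abs] at this
      linarith
    have h4 : 0 ≤ q ^ 4 * (q - 2 * p) ^ 2 := by positivity
    have h5 : (9 / 64 * q ^ 2) ^ 2 * q ^ 2 ≤ (p ^ 2) ^ 2 * (p - 2 * q) ^ 2 := by gcongr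
    have h6 : 0 ≤ q ^ 6 := by positivity
    nlinarith

/-- At each vertex of a triangle one of the two edges `e` is such that both the difference along
`e` and the second difference attached to `e` are comparable to the diameter. -/
theorem diam₃_pow_six_le (a b t : ℝ) :
    diam₃ a b t ^ 6 ≤ 4096 * (|a - b| ^ 4 * |a + b - 2 * t| ^ 2
      + |a - t| ^ 4 * |a + t - 2 * b| ^ 2) := by
  have key : ∀ p q : ℝ, |p| ≤ |q| → max |p| (max |q| |p - q|) ≤ 2 * |q| := fun p q h => by
    have := abs_sub p q
    have := abs_nonneg q
    exact max_le (by linarith) (max_le (by linarith) (by linarith))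
  have hd : diam₃ a b t = max |b - a| (max |t - a| |(b - a) - (t - a)|) := by
    unfold diam₃
    rw [abs_sub_comm a b, max_comm |b - t|, sub_sub_sub_cancel_right]
  have e4 : ∀ z : ℝ, |z| ^ 4 = z ^ 4 := fun z => Even.pow_abs (by decide) z
  rw [sq_abs, sq_abs, e4, e4]
  have h0 := diam₃_nonneg a b t
  rcases le_total |b - a| |t - a| with h | h
  · have h1 := sixth_power_le_of_abs_le h
    have h2 : diam₃ a b t ≤ 2 * |t - a| := hd ▸ key _ _ h
    have h3 : diam₃ a b t ^ 6 ≤ (2 * |t - a|) ^ 6 := by gcongr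
    rw [mul_pow, Even.pow_abs (by decide) (t - a)] at h3
    calc _ ≤ _ := h3
      _ ≤ 2 ^ 6 * _ := mul_le_mul_of_nonneg_left h1 (by norm_num)
      _ = _ := by ring
  · have h1 := sixth_power_le_of_abs_le h
    have h2 : diam₃ a b t ≤ 2 * |b - a| := by
      have := key _ _ h
      rw [hd, abs_sub_comm (b - a), ← max_assoc, max_comm |b - a|, max_assoc]
      exact this
    have h3 : diam₃ a b t ^ 6 ≤ (2 * |b - a|) ^ 6 := by gcongr
    rw [mul_pow, Even.pow_abs (by decide) (b - a)] at h3
    calc _ ≤ _ := h3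
      _ ≤ 2 ^ 6 * _ := mul_le_mul_of_nonneg_left h1 (by norm_num)
      _ = _ := by ring

/-- The inequality of the arithmetic and geometric means, with weights. -/
theorem mul_sqrt_mul_sqrt_le {X Z k p q : ℝ} (hX : 0 ≤ X) (hZ : 0 ≤ Z) (hp : 0 ≤ p) (hq : 0 ≤ q)
    (hk : k ^ 2 ≤ 4 * (p * q)) : k * (√X * √Z) ≤ p * X + q * Z := by
  refine le_of_sq_le_sq ?_ (by positivity)
  rw [mul_pow, mul_pow, Real.sq_sqrt hX, Real.sq_sqrt hZ]
  nlinarith [mul_le_mul_of_nonneg_right hk (mul_nonneg hX hZ), sq_nonneg (p * X - q * Z)]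

/-- The system of inequalities satisfied by the cut-off energies can be solved by absorption. Here
`P` is the square norm of `φ`, `N` and `NF` are the energies of `δ⁰ φ` and `d¹ φ` weighted by the
squares of the means of `χ`, `Y` is the energy of `d¹ φ` weighted by the square of the diameter, `Θ`
and `A` are those of `δ⁰ φ` and `d⁰ δ⁰ φ` weighted by `|χ(x) - χ(y)|⁴`. -/
theorem exists_bound_of_energy_system {K : ℝ} (l : ℝ) (hK : 0 ≤ K) :
    ∃ C : ℝ, ∀ N NF Y A Θ P : ℝ, 0 ≤ N → 0 ≤ NF → 0 ≤ Y → 0 ≤ A → 0 ≤ Θ → 0 ≤ P →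
      N + NF / 6 ≤ √(K * N) * √P + 1 / 4 * (√Θ * √P) + 5 / 24 * (√NF * √(K * P)) →
      Y / 6 ≤ √Θ * √P + 1 / 2 * (√Y * √(K * P)) →
      A ≤ l * (√A * √P) + √Y * √(32768 * K * Θ) →
      Θ ≤ 3 * K * N + 2 * A →
      N ≤ C * P ∧ NF ≤ C * P := by
  obtain ⟨β, hβ⟩ : ∃ β : ℝ, β = 3 / 2 * K + 8 * 32768 * 12 * K := ⟨_, rfl⟩
  obtain ⟨α, hα⟩ : ∃ α : ℝ, α = 6 * K ^ 2 + 2 * l ^ 2 + 8 * 32768 * 9 * K ^ 2 := ⟨_, rfl⟩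
  have hα0 : 0 ≤ α := by rw [hα]; positivity
  refine ⟨12 * K + 2 + 6 * (α + β ^ 2), ?_⟩
  intro N NF Y A Θ P hN hNF hY hA hΘ hP ha hb hc hd
  have hKN := mul_nonneg hK hN
  have hKP := mul_nonneg hK hP
  have s0 : 0 ≤ √Θ * √P := by positivity
  obtain ⟨s, hs⟩ : ∃ s, s = √Θ * √P := ⟨_, rfl⟩
  rw [← hs] at ha hb s0
  have a1 : √(K * N) * √P ≤ 1 / 2 * N + 1 / 2 * (K * P) := by
    rw [Real.sqrt_mul hK, mul_comm √K, mul_assoc, ← Real.sqrt_mul hK, ← one_mul (√N * _)]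
    exact mul_sqrt_mul_sqrt_le hN hKP (by norm_num) (by norm_num) (by norm_num)
  have a2 : 5 / 24 * (√NF * √(K * P)) ≤ 1 / 12 * NF + 25 * 3 / 576 * (K * P) :=
    mul_sqrt_mul_sqrt_le hNF hKP (by norm_num) (by norm_num) (by norm_num)
  have b1 : 1 / 2 * (√Y * √(K * P)) ≤ 1 / 12 * Y + 3 / 4 * (K * P) :=
    mul_sqrt_mul_sqrt_le hY hKP (by norm_num) (by norm_num) (by norm_num)
  have c1 : l * (√A * √P) ≤ 1 / 2 * A + l ^ 2 / 2 * P :=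
    mul_sqrt_mul_sqrt_le hA hP (by norm_num) (by positivity) (by linarith)
  have c2 : √Y * √(32768 * K * Θ) ≤ 2 * (Y * (32768 * K)) + 1 / 8 * Θ := by
    rw [Real.sqrt_mul (by positivity), ← mul_assoc, ← Real.sqrt_mul hY, ← one_mul (√_ * √Θ)]
    exact mul_sqrt_mul_sqrt_le (by positivity) hΘ (by norm_num) (by norm_num) (by norm_num)
  have hN' : N ≤ 2 * (K * P) + 1 / 2 * s := by linarith
  have hNF' : NF ≤ 12 * (K * P) + 3 * s := by linarith
  have hY' : Y ≤ 12 * s + 9 * (K * P) := by linarith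
  have hA' : 2 * A ≤ 2 * (l ^ 2 * P) + Θ / 2 + 8 * 32768 * (K * Y) := by linarith
  have h1 : Θ / 2 ≤ α * P + β * s := by
    have e1 := mul_le_mul_of_nonneg_left hN' hK
    have e2 := mul_le_mul_of_nonneg_left hY' hK
    rw [hα, hβ]
    linarith
  have h2 : β * s ≤ 1 / 4 * Θ + β ^ 2 * P := by
    rw [hs]
    exact mul_sqrt_mul_sqrt_le hΘ hP (by norm_num) (by positivity) (by linarith)
  have h4 : s ≤ 1 / 2 * Θ + 1 / 2 * P := by
    rw [hs, ← one_mul (√_ * _)]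
    exact mul_sqrt_mul_sqrt_le hΘ hP (by norm_num) (by norm_num) (by norm_num)
  have h5 : 0 ≤ α * P := by positivity
  have h6 : 0 ≤ β ^ 2 * P := by positivity
  constructor <;> linarith

namespace MagneticTriangulation

variable {V : Type*} (T : MagneticTriangulation V)

/-! ### Weighted energy inequalities -/

theorem norm_commutator_le (S : Finset V) (μV : V → ℝ) (μE : V → V → ℝ) (μF : V → V → V → ℝ)
    (g : V → ℂ) (φ : T.skewEdge) (ψ : T.skewFace) :
    ‖∑ x ∈ S, ∑ y ∈ S, (T.edgeWeight x y : ℂ) * ((μV y : ℂ) - μE x y) *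
        (conj (φ.1 (x, y)) * phase (T.α y x / 2) * g y)
      + 1 / 2 * ∑ x ∈ S, ∑ y ∈ S, ∑ t ∈ S, (T.faceWeight x y t : ℂ) *
        ((μF x y t : ℂ) - μE x y) *
        (conj (φ.1 (x, y)) * phase ((T.α t x + T.α t y) / 6) * ψ.1 (x, y, t))‖
    ≤ ∑ x ∈ S, ∑ y ∈ S, T.edgeWeight x y * (|μV y - μE x y| * ‖g y‖ * ‖φ.1 (x, y)‖)
      + 1 / 2 * ∑ x ∈ S, ∑ y ∈ S, ∑ t ∈ S, T.faceWeight x y t *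
        (|μF x y t - μE x y| * ‖ψ.1 (x, y, t)‖ * ‖φ.1 (x, y)‖) := by
  refine (norm_add_le _ _).trans (add_le_add ?_ ?_)
  · refine (norm_sum_le _ _).trans (Finset.sum_le_sum fun x _ => ?_)
    refine (norm_sum_le _ _).trans (Finset.sum_le_sum fun y _ => le_of_eq ?_)
    rw [← Complex.ofReal_sub]
    simp only [norm_mul, norm_phase, RCLike.norm_conj, Complex.norm_real, Real.norm_eq_abs,
      abs_of_nonneg (T.edgeWeight_nonneg x y)]
    ring
  · rw [norm_mul, show ‖(1 / 2 : ℂ)‖ = 1 / 2 by norm_num]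
    refine mul_le_mul_of_nonneg_left ?_ (by norm_num)
    refine (norm_sum_le _ _).trans (Finset.sum_le_sum fun x _ => ?_)
    refine (norm_sum_le _ _).trans (Finset.sum_le_sum fun y _ => ?_)
    refine (norm_sum_le _ _).trans (Finset.sum_le_sum fun t _ => le_of_eq ?_)
    rw [← Complex.ofReal_sub]
    simp only [norm_mul, norm_phase, RCLike.norm_conj, Complex.norm_real, Real.norm_eq_abs,
      abs_of_nonneg (T.faceWeight_nonneg x y t)]
    ring

/-- The energy inequality for a solution of `Δ φ = -l φ` on the edges. -/
theorem edge_energy_le {S S₁ : Finset V} (hS : T.thicken S₁ ⊆ S)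
    (μV : V → ℝ) (μE : V → V → ℝ) (μF : V → V → V → ℝ)
    (hV : ∀ x, x ∉ S₁ → μV x = 0) (hE : ∀ x y, x ∉ S₁ → y ∉ S₁ → μE x y = 0)
    (hEs : ∀ x y, μE x y = μE y x) (hFr : ∀ x y t, μF x y t = μF y t x)
    {l : ℝ} {φ : T.skewEdge}
    (heq : T.d0 (T.delta0 φ) + T.delta1 (T.d1 φ) = -(l : ℂ) • φ) :
    ∑ x ∈ S, T.c x * μV x * ‖T.delta0 φ x‖ ^ 2
      + 1 / 6 * ∑ x ∈ S, ∑ y ∈ S, ∑ t ∈ S, T.faceWeight x y t * μF x y t *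
        ‖(T.d1 φ).1 (x, y, t)‖ ^ 2
      + l / 2 * ∑ x ∈ S, ∑ y ∈ S, T.edgeWeight x y * μE x y * ‖φ.1 (x, y)‖ ^ 2
    ≤ ∑ x ∈ S, ∑ y ∈ S, T.edgeWeight x y *
        (|μV y - μE x y| * ‖T.delta0 φ y‖ * ‖φ.1 (x, y)‖)
      + 1 / 2 * ∑ x ∈ S, ∑ y ∈ S, ∑ t ∈ S, T.faceWeight x y t *
        (|μF x y t - μE x y| * ‖(T.d1 φ).1 (x, y, t)‖ * ‖φ.1 (x, y)‖) := by
  have hid := T.cutoff_identity hS μV μE μF hV hE hEs hFr (T.delta0 φ) φ (T.d1 φ)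
  refine le_trans ?_ (T.norm_commutator_le S μV μE μF (T.delta0 φ) φ (T.d1 φ))
  rw [← hid, heq]
  refine (le_abs_self _).trans (le_of_eq ?_)
  rw [← Real.norm_eq_abs, ← Complex.norm_real]
  congr 1
  simp only [Complex.conj_mul', Submodule.coe_smul, Pi.smul_apply, smul_eq_mul,
    mul_left_comm (conj _) (-(l : ℂ))]
  push_cast
  have h : ∀ x y, (T.edgeWeight x y : ℂ) * μE x y * (-(l : ℂ) * (‖φ.1 (x, y)‖ : ℂ) ^ 2)
      = -(l : ℂ) * ((T.edgeWeight x y : ℂ) * μE x y * (‖φ.1 (x, y)‖ : ℂ) ^ 2) := fun x y => by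
    ring
  simp only [h, ← Finset.mul_sum]
  ring

/-- The energy inequality for a solution of `Δ (f, ψ) = -l (f, ψ)` on the vertices and faces. -/
theorem vertex_face_energy_le {S S₁ : Finset V} (hS : T.thicken S₁ ⊆ S)
    (μV : V → ℝ) (μE : V → V → ℝ) (μF : V → V → V → ℝ)
    (hV : ∀ x, x ∉ S₁ → μV x = 0) (hE : ∀ x y, x ∉ S₁ → y ∉ S₁ → μE x y = 0)
    (hEs : ∀ x y, μE x y = μE y x) (hFr : ∀ x y t, μF x y t = μF y t x)
    {l : ℝ} {f : V → ℂ} {ψ : T.skewFace}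
    (hf : T.delta0 (T.d0 f + T.delta1 ψ) = -(l : ℂ) • f)
    (hψ : T.d1 (T.d0 f + T.delta1 ψ) = -(l : ℂ) • ψ) :
    l * (∑ x ∈ S, T.c x * μV x * ‖f x‖ ^ 2
      + 1 / 6 * ∑ x ∈ S, ∑ y ∈ S, ∑ t ∈ S, T.faceWeight x y t * μF x y t *
        ‖ψ.1 (x, y, t)‖ ^ 2)
      + 1 / 2 * ∑ x ∈ S, ∑ y ∈ S, T.edgeWeight x y * μE x y *
        ‖(T.d0 f + T.delta1 ψ).1 (x, y)‖ ^ 2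
    ≤ ∑ x ∈ S, ∑ y ∈ S, T.edgeWeight x y *
        (|μV y - μE x y| * ‖f y‖ * ‖(T.d0 f + T.delta1 ψ).1 (x, y)‖)
      + 1 / 2 * ∑ x ∈ S, ∑ y ∈ S, ∑ t ∈ S, T.faceWeight x y t *
        (|μF x y t - μE x y| * ‖ψ.1 (x, y, t)‖ * ‖(T.d0 f + T.delta1 ψ).1 (x, y)‖) := by
  have hid := T.cutoff_identity hS μV μE μF hV hE hEs hFr f (T.d0 f + T.delta1 ψ) ψ
  refine le_trans ?_ (T.norm_commutator_le S μV μE μF f (T.d0 f + T.delta1 ψ) ψ)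
  rw [← hid, hf, hψ]
  refine (le_abs_self _).trans (le_of_eq ?_)
  rw [← Real.norm_eq_abs, ← Complex.norm_real, ← norm_neg]
  congr 1
  simp only [Submodule.coe_smul, Pi.smul_apply, smul_eq_mul, map_mul, map_neg,
    Complex.conj_ofReal, mul_assoc (-(l : ℂ)), Complex.conj_mul']
  push_cast
  have h : ∀ x, (T.c x : ℂ) * μV x * (-(l : ℂ) * (‖f x‖ : ℂ) ^ 2)
      = -(l : ℂ) * ((T.c x : ℂ) * μV x * (‖f x‖ : ℂ) ^ 2) := fun x => by
    ring
  have h' : ∀ x y t, (T.faceWeight x y t : ℂ) * μF x y t *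
        (-(l : ℂ) * (‖ψ.1 (x, y, t)‖ : ℂ) ^ 2)
      = -(l : ℂ) * ((T.faceWeight x y t : ℂ) * μF x y t * (‖ψ.1 (x, y, t)‖ : ℂ) ^ 2) :=
    fun x y t => by ring
  simp only [h, h', ← Finset.mul_sum]
  ring

/-! ### Cut-off functions -/

/-- A cut-off function `χ` with values in `[0, 1]`, vanishing outside `S₁`, whose first differences
along the edges and second differences on the faces are bounded by `K` in the weighted sense. The
finite set `S` contains `S₁` and its neighbours, so that all sums can be taken over `S`. -/
structure IsCutoff (K : ℝ) (S₁ S : Finset V) (χ : V → ℝ) : Prop where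
  thicken_subset : T.thicken S₁ ⊆ S
  eq_zero : ∀ x, x ∉ S₁ → χ x = 0
  nonneg : ∀ x, 0 ≤ χ x
  le_one : ∀ x, χ x ≤ 1
  edge : ∀ y ∈ S, ∑ x ∈ S, T.edgeWeight x y * |χ x - χ y| ^ 2 ≤ K * T.c y
  face : ∀ x ∈ S, ∀ y ∈ S, ∑ t ∈ S, T.faceWeight x y t * |χ x + χ y - 2 * χ t| ^ 2
    ≤ K * T.edgeWeight x y

theorem IsChiComplete.exists_isCutoff {T : MagneticTriangulation V} (hT : T.IsChiComplete) :
    ∃ K : ℝ, 0 < K ∧ ∀ U : Finset V, ∃ S₁ S : Finset V, ∃ χ : V → ℝ, T.IsCutoff K S₁ S χ ∧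
      U ⊆ S ∧ ∀ x ∈ U, χ x = 1 := by
  classical
  obtain ⟨K, hK, B, χ, hB, hBV, hχ, hedge, hface⟩ := hT
  refine ⟨K, hK, fun U => ?_⟩
  obtain ⟨n, hn⟩ : ∃ n, U ⊆ B n := by
    induction U using Finset.induction_on with
    | empty => exact ⟨0, Finset.empty_subset _⟩
    | insert a U _ ih =>
      obtain ⟨n, hn⟩ := ih
      obtain ⟨m, hm⟩ := hBV a
      exact ⟨max n m, Finset.insert_subset (hB (le_max_right n m) hm)
        (hn.trans (hB (le_max_left n m)))⟩
  obtain ⟨hfin, h01, h1⟩ := hχ n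
  have hU1 : ∀ x ∈ U, χ n x = 1 := fun x hx => h1 x (hn hx)
  refine ⟨hfin.toFinset, T.thicken hfin.toFinset, χ n, ?_, fun x hx => ?_, hU1⟩
  · refine ⟨subset_rfl, fun x hx => by simpa using hx, fun x => (h01 x).1, fun x => (h01 x).2,
      fun y _ => ?_, fun x _ y _ => ?_⟩
    · have h2 := hedge n y
      rw [one_div, inv_mul_le_iff₀ (T.c_pos y), mul_comm (T.c y)] at h2
      refine le_trans ?_ h2
      rw [← Finset.sum_filter_add_sum_filter_not _ (fun x => x ∈ T.nbr y)]
      rw [Finset.sum_eq_zero (s := Finset.filter (fun x => ¬ x ∈ T.nbr y) _), add_zero]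
      · rw [Finset.filter_mem_eq_inter]
        refine (Finset.sum_le_sum_of_subset_of_nonneg Finset.inter_subset_right
          fun x _ _ => ?_).trans
          (le_of_eq (Finset.sum_congr rfl fun x hx => ?_))
        · exact mul_nonneg (T.edgeWeight_nonneg _ _) (by positivity)
        · have := (T.mem_nbr.1 hx).symm
          rw [abs_sub_comm (χ n x)]
          simp [edgeWeight, this]
      · intro x hx
        have hx' : ¬ T.graph.Adj x y := fun h =>
          (Finset.mem_filter.1 hx).2 (T.mem_nbr.2 h.symm)
        rw [T.edgeWeight_eq_zero hx', zero_mul]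
    · by_cases hxy : T.graph.Adj x y
      · have h2 := hface n x y hxy
        rw [one_div, inv_mul_le_iff₀ (T.r_pos x y hxy), mul_comm (T.r x y)] at h2
        rw [edgeWeight, if_pos hxy]
        refine le_trans ?_ h2
        rw [← Finset.sum_filter_add_sum_filter_not _ (fun t => t ∈ T.faceNbr x y)]
        rw [Finset.sum_eq_zero (s := Finset.filter (fun t => ¬ t ∈ T.faceNbr x y) _), add_zero]
        · rw [Finset.filter_mem_eq_inter]
          refine (Finset.sum_le_sum_of_subset_of_nonneg Finset.inter_subset_right
            fun t _ _ => ?_).trans (le_of_eq (Finset.sum_congr rfl fun t ht => ?_))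
          · exact mul_nonneg (T.faceWeight_nonneg _ _ _) (by positivity)
          · rw [show χ n x + χ n y - 2 * χ n t = χ n x - χ n t + (χ n y - χ n t) by ring]
            simp [faceWeight, T.mem_faceNbr.1 ht]
        · intro t ht
          have ht' : ¬ T.face x y t := fun h => (Finset.mem_filter.1 ht).2 (T.mem_faceNbr.2 h)
          rw [T.faceWeight_eq_zero ht', zero_mul]
      · rw [T.edgeWeight_eq_zero hxy, mul_zero]
        refine le_of_eq (Finset.sum_eq_zero fun t _ => ?_)
        rw [T.faceWeight_eq_zero fun h => hxy (T.face_cycle _ _ _ h).1, zero_mul]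
  · refine T.mem_thicken_of_mem (hfin.mem_toFinset.2 ?_)
    rw [Function.mem_support, hU1 x hx]
    exact one_ne_zero

namespace IsCutoff

variable {T} {K : ℝ} {S₁ S : Finset V} {χ : V → ℝ} (h : T.IsCutoff K S₁ S χ)

include h

theorem sum_edge_le (w : V → ℝ) :
    ∑ x ∈ S, ∑ y ∈ S, T.edgeWeight x y * (|χ x - χ y| * w y) ^ 2
      ≤ K * ∑ y ∈ S, T.c y * w y ^ 2 := by
  rw [Finset.sum_comm, Finset.mul_sum]
  refine Finset.sum_le_sum fun y hy => ?_
  calc ∑ x ∈ S, T.edgeWeight x y * (|χ x - χ y| * w y) ^ 2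
      = (∑ x ∈ S, T.edgeWeight x y * |χ x - χ y| ^ 2) * w y ^ 2 := by
        rw [Finset.sum_mul]; exact Finset.sum_congr rfl fun x _ => by ring
    _ ≤ (K * T.c y) * w y ^ 2 := by gcongr; exact h.edge y hy
    _ = _ := by ring

theorem sum_face_le (w : V → V → ℝ) :
    ∑ x ∈ S, ∑ y ∈ S, ∑ t ∈ S, T.faceWeight x y t * (|χ x + χ y - 2 * χ t| * w x y) ^ 2
      ≤ K * ∑ x ∈ S, ∑ y ∈ S, T.edgeWeight x y * w x y ^ 2 := by
  simp only [Finset.mul_sum]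
  refine Finset.sum_le_sum fun x hx => Finset.sum_le_sum fun y hy => ?_
  calc ∑ t ∈ S, T.faceWeight x y t * (|χ x + χ y - 2 * χ t| * w x y) ^ 2
      = (∑ t ∈ S, T.faceWeight x y t * |χ x + χ y - 2 * χ t| ^ 2) * w x y ^ 2 := by
        rw [Finset.sum_mul]; exact Finset.sum_congr rfl fun t _ => by ring
    _ ≤ (K * T.edgeWeight x y) * w x y ^ 2 := by gcongr; exact h.face x hx y hy
    _ = _ := by ring

end IsCutoff

end MagneticTriangulation

namespace MagneticTriangulation

variable {V : Type*} {T : MagneticTriangulation V}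

/-! ### The error terms, and the vertices and faces -/

namespace IsCutoff

variable {K : ℝ} {S₁ S : Finset V} {χ : V → ℝ}

/-- An error term on the edges whose factor `m` is at most `k |χ(x) - χ(y)| a(y) b(x, y)` is bounded
by the energy of `v` with the weight `a²` and that of `u` with the weight `b²`. -/
theorem sum_edge_commutator_le (h : T.IsCutoff K S₁ S χ) {k : ℝ} {m : V → V → ℝ} {a : V → ℝ}
    {b : V → V → ℝ} (hm : ∀ x y, m x y ≤ k * (|χ x - χ y| * (a y * b x y)))
    {v : V → ℝ} (hv : ∀ y, 0 ≤ v y) {u : V → V → ℝ} (hu : ∀ x y, 0 ≤ u x y) (hk : 0 ≤ k) :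
    ∑ x ∈ S, ∑ y ∈ S, T.edgeWeight x y * (m x y * v y * u x y)
      ≤ k * (√(K * ∑ y ∈ S, T.c y * (a y * v y) ^ 2)
        * √(∑ x ∈ S, ∑ y ∈ S, T.edgeWeight x y * (b x y * u x y) ^ 2)) := by
  refine le_trans ?_ (mul_le_mul_of_nonneg_left (weighted_cauchy_schwarz₂ S T.edgeWeight
    (fun x y => |χ x - χ y| * (a y * v y)) (fun x y => b x y * u x y) T.edgeWeight_nonneg
    (h.sum_edge_le fun y => a y * v y) le_rfl) hk)
  simp only [Finset.mul_sum]
  refine Finset.sum_le_sum fun x _ => Finset.sum_le_sum fun y _ => ?_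
  calc T.edgeWeight x y * (m x y * v y * u x y)
      ≤ T.edgeWeight x y * (k * (|χ x - χ y| * (a y * b x y)) * v y * u x y) := by
        have := T.edgeWeight_nonneg x y
        have := hv y
        have := hu x y
        gcongr
        exact hm x y
    _ = _ := by ring

/-- An error term on the faces whose factor `m` is at most
`k |χ(x) + χ(y) - 2 χ(t)| a(x, y) b(x, y, t)` is bounded by the energy of `u` with the weight `a²`
and that of `v` with the weight `b²`. -/
theorem sum_face_commutator_le (h : T.IsCutoff K S₁ S χ) {k : ℝ} {m : V → V → V → ℝ}
    {a : V → V → ℝ} {b : V → V → V → ℝ}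
    (hm : ∀ x y t, m x y t ≤ k * (|χ x + χ y - 2 * χ t| * (a x y * b x y t)))
    {v : V → V → V → ℝ} (hv : ∀ x y t, 0 ≤ v x y t) {u : V → V → ℝ} (hu : ∀ x y, 0 ≤ u x y)
    (hk : 0 ≤ k) :
    ∑ x ∈ S, ∑ y ∈ S, ∑ t ∈ S, T.faceWeight x y t * (m x y t * v x y t * u x y)
      ≤ k * (√(K * ∑ x ∈ S, ∑ y ∈ S, T.edgeWeight x y * (a x y * u x y) ^ 2)
        * √(∑ x ∈ S, ∑ y ∈ S, ∑ t ∈ S, T.faceWeight x y t * (b x y t * v x y t) ^ 2)) := by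
  refine le_trans ?_ (mul_le_mul_of_nonneg_left (weighted_cauchy_schwarz₃ S T.faceWeight
    (fun x y t => |χ x + χ y - 2 * χ t| * (a x y * u x y)) (fun x y t => b x y t * v x y t)
    T.faceWeight_nonneg (h.sum_face_le fun x y => a x y * u x y) le_rfl) hk)
  simp only [Finset.mul_sum]
  refine Finset.sum_le_sum fun x _ => Finset.sum_le_sum fun y _ => Finset.sum_le_sum fun t _ => ?_
  calc T.faceWeight x y t * (m x y t * v x y t * u x y)
      ≤ T.faceWeight x y t *
        (k * (|χ x + χ y - 2 * χ t| * (a x y * b x y t)) * v x y t * u x y) := by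
        have := T.faceWeight_nonneg x y t
        have := hv x y t
        have := hu x y
        gcongr
        exact hm x y t
    _ = _ := by ring

/-- The weights `χ(x)²` on the vertices, `((χ(x) + χ(y)) / 2)²` on the edges and `m²` on the
faces, `m` being the median of the three values, bound all the error terms by the energy on the
edges, which absorbs them. -/
theorem vertex_face_le (h : T.IsCutoff K S₁ S χ) (hK : 0 ≤ K) {l : ℝ} {f : V → ℂ}
    {ψ : T.skewFace} (hf : T.delta0 (T.d0 f + T.delta1 ψ) = -(l : ℂ) • f)
    (hψ : T.d1 (T.d0 f + T.delta1 ψ) = -(l : ℂ) • ψ) :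
    l * (∑ x ∈ S, T.c x * χ x ^ 2 * ‖f x‖ ^ 2
      + 1 / 6 * ∑ x ∈ S, ∑ y ∈ S, ∑ t ∈ S, T.faceWeight x y t * median (χ x) (χ y) (χ t) ^ 2 *
        ‖ψ.1 (x, y, t)‖ ^ 2)
    ≤ 9 / 4 * K * (∑ x ∈ S, T.c x * ‖f x‖ ^ 2
      + ∑ x ∈ S, ∑ y ∈ S, ∑ t ∈ S, T.faceWeight x y t * ‖ψ.1 (x, y, t)‖ ^ 2) := by
  have hen := T.vertex_face_energy_le h.thicken_subset (fun x => χ x ^ 2)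
    (fun x y => ((χ x + χ y) / 2) ^ 2) (fun x y t => median (χ x) (χ y) (χ t) ^ 2)
    (fun x hx => by simp [h.eq_zero x hx])
    (fun x y hx hy => by simp [h.eq_zero x hx, h.eq_zero y hy])
    (fun x y => by rw [add_comm]) (fun x y t => by rw [median_rot]) hf hψ
  set w := T.d0 f + T.delta1 ψ with hw
  have h1 := h.sum_edge_commutator_le (k := 3 / 2) (a := fun _ => 1)
    (b := fun x y => (χ x + χ y) / 2) (m := fun x y => |χ y ^ 2 - ((χ x + χ y) / 2) ^ 2|)
    (fun x y => by
      rw [one_mul]; exact abs_sq_sub_mean_sq_le (h.nonneg x) (h.nonneg y))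
    (v := fun y => ‖f y‖) (fun y => norm_nonneg _) (u := fun x y => ‖w.1 (x, y)‖)
    (fun x y => norm_nonneg _) (by norm_num)
  have h2 := h.sum_face_commutator_le (k := 3 / 2) (a := fun x y => (χ x + χ y) / 2)
    (b := fun _ _ _ => 1)
    (m := fun x y t => |median (χ x) (χ y) (χ t) ^ 2 - ((χ x + χ y) / 2) ^ 2|)
    (fun x y t => by
      rw [mul_one]; exact abs_median_sq_sub_le (h.nonneg x) (h.nonneg y) _)
    (v := fun x y t => ‖ψ.1 (x, y, t)‖) (fun x y t => norm_nonneg _)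
    (u := fun x y => ‖w.1 (x, y)‖) (fun x y => norm_nonneg _) (by norm_num)
  simp only [one_mul] at h1 h2
  simp only [mul_pow] at h1 h2
  simp only [mul_assoc] at h1 h2 hen ⊢
  set Pw := ∑ x ∈ S, ∑ y ∈ S, T.edgeWeight x y * (((χ x + χ y) / 2) ^ 2 * ‖w.1 (x, y)‖ ^ 2)
  set Nf := ∑ x ∈ S, T.c x * ‖f x‖ ^ 2
  set Np := ∑ x ∈ S, ∑ y ∈ S, ∑ t ∈ S, T.faceWeight x y t * ‖ψ.1 (x, y, t)‖ ^ 2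
  have hP : 0 ≤ Pw := Finset.sum_nonneg fun x _ => Finset.sum_nonneg fun y _ =>
    mul_nonneg (T.edgeWeight_nonneg x y) (by positivity)
  have hN : 0 ≤ Nf := Finset.sum_nonneg fun x _ => mul_nonneg (T.c_pos x).le (by positivity)
  have hNp : 0 ≤ Np := Finset.sum_nonneg fun x _ => Finset.sum_nonneg fun y _ =>
    Finset.sum_nonneg fun t _ => mul_nonneg (T.faceWeight_nonneg x y t) (by positivity)
  have k1 := mul_sqrt_mul_sqrt_le (k := 3 / 2) (p := 9 / 4) (q := 1 / 4) (mul_nonneg hK hN) hP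
    (by norm_num) (by norm_num) (by norm_num)
  have k2 := mul_sqrt_mul_sqrt_le (k := 3 / 2) (p := 1 / 4 / K) (q := 9 / 4 * K)
    (mul_nonneg hK hP) hNp (by positivity) (by positivity)
  rcases hK.eq_or_lt with hK0 | hK0
  · rw [← hK0] at h1 h2 ⊢
    simp only [zero_mul, mul_zero, Real.sqrt_zero] at h1 h2 ⊢
    linarith
  · have k3 := k2 (by field_simp; norm_num)
    have : 1 / 4 / K * (K * Pw) = 1 / 4 * Pw := by field_simp
    rw [this] at k3
    have : 0 ≤ K * Np := mul_nonneg hK hNp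
    linarith

end IsCutoff

end MagneticTriangulation

namespace MagneticTriangulation

variable {V : Type*} {T : MagneticTriangulation V}

/-! ### The a priori estimate on the edges -/

theorem norm_d0_le (g : V → ℂ) (x y : V) : ‖(T.d0 g).1 (x, y)‖ ≤ ‖g x‖ + ‖g y‖ := by
  by_cases h : T.graph.Adj x y
  · simp only [d0, LinearMap.coe_mk, AddHom.coe_mk, h, if_true]
    refine (norm_sub_le _ _).trans (le_of_eq ?_)
    rw [norm_mul, norm_mul, norm_phase, norm_phase]
    ring
  · rw [(T.d0 g).2.2 x y h, norm_zero]
    positivity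

theorem norm_le_norm_add_norm_d0 (g : V → ℂ) {x y : V} (h : T.graph.Adj x y) :
    ‖g y‖ ≤ ‖g x‖ + ‖(T.d0 g).1 (x, y)‖ := by
  have h1 : (T.d0 g).1 (x, y) + phase (T.α x y / 2) * g x = phase (T.α y x / 2) * g y := by
    simp only [d0, LinearMap.coe_mk, AddHom.coe_mk, h, if_true]
    ring
  have h2 := norm_add_le ((T.d0 g).1 (x, y)) (phase (T.α x y / 2) * g x)
  rw [h1, norm_mul, norm_mul, norm_phase, norm_phase] at h2
  linarith

namespace IsCutoff

variable {K : ℝ} {S₁ S : Finset V} {χ : V → ℝ}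

theorem abs_sub_le_one (h : T.IsCutoff K S₁ S χ) (x y : V) : |χ x - χ y| ≤ 1 :=
  abs_le.2 ⟨by linarith [h.nonneg x, h.le_one y], by linarith [h.nonneg y, h.le_one x]⟩

/-- The energy inequality for the squares of the means of `χ` on the vertices, edges and faces.
When `χ(y)` is small compared to `χ(x)`, the weight `χ(y)²` does not control the error term with
`δ⁰ φ(y)` on the edge `(x, y)`, which is why the fourth powers of the differences of `χ` come in. -/
theorem sum_mean_sq_le (h : T.IsCutoff K S₁ S χ) {l : ℝ} (hl : 0 ≤ l) {φ : T.skewEdge}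
    (heq : T.d0 (T.delta0 φ) + T.delta1 (T.d1 φ) = -(l : ℂ) • φ) :
    ∑ x ∈ S, T.c x * (χ x * ‖T.delta0 φ x‖) ^ 2
      + (∑ x ∈ S, ∑ y ∈ S, ∑ t ∈ S, T.faceWeight x y t *
        ((χ x + χ y + χ t) / 3 * ‖(T.d1 φ).1 (x, y, t)‖) ^ 2) / 6
    ≤ √(K * ∑ x ∈ S, T.c x * (χ x * ‖T.delta0 φ x‖) ^ 2)
        * √(∑ x ∈ S, ∑ y ∈ S, T.edgeWeight x y * ‖φ.1 (x, y)‖ ^ 2)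
      + 1 / 4 * (√(∑ x ∈ S, ∑ y ∈ S, T.edgeWeight x y *
          (|χ x - χ y| ^ 2 * ‖T.delta0 φ y‖) ^ 2)
        * √(∑ x ∈ S, ∑ y ∈ S, T.edgeWeight x y * ‖φ.1 (x, y)‖ ^ 2))
      + 5 / 24 * (√(∑ x ∈ S, ∑ y ∈ S, ∑ t ∈ S, T.faceWeight x y t *
          ((χ x + χ y + χ t) / 3 * ‖(T.d1 φ).1 (x, y, t)‖) ^ 2)
        * √(K * ∑ x ∈ S, ∑ y ∈ S, T.edgeWeight x y * ‖φ.1 (x, y)‖ ^ 2)) := by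
  have hen := T.edge_energy_le h.thicken_subset (fun x => χ x ^ 2)
    (fun x y => ((χ x + χ y) / 2) ^ 2) (fun x y t => ((χ x + χ y + χ t) / 3) ^ 2)
    (fun x hx => by simp [h.eq_zero x hx])
    (fun x y hx hy => by simp [h.eq_zero x hx, h.eq_zero y hy])
    (fun x y => by rw [add_comm]) (fun x y t => by ring) heq
  have h1 := h.sum_edge_commutator_le (k := 1) (a := χ) (b := fun _ _ => 1)
    (m := fun x y => |χ x - χ y| * χ y) (fun x y => by rw [mul_one, one_mul])
    (v := fun y => ‖T.delta0 φ y‖) (fun y => norm_nonneg _) (u := fun x y => ‖φ.1 (x, y)‖)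
    (fun x y => norm_nonneg _) (by norm_num)
  have h2 := weighted_cauchy_schwarz₂ S T.edgeWeight
    (fun x y => |χ x - χ y| ^ 2 * ‖T.delta0 φ y‖) (fun x y => ‖φ.1 (x, y)‖) T.edgeWeight_nonneg
    le_rfl le_rfl
  have h3 := h.sum_face_commutator_le (k := 5 / 12) (a := fun _ _ => 1)
    (b := fun x y t => (χ x + χ y + χ t) / 3)
    (m := fun x y t => |((χ x + χ y + χ t) / 3) ^ 2 - ((χ x + χ y) / 2) ^ 2|)
    (fun x y t => by
      rw [one_mul]; exact abs_mean_sq_sub_le (h.nonneg x) (h.nonneg y) (h.nonneg t))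
    (v := fun x y t => ‖(T.d1 φ).1 (x, y, t)‖) (fun x y t => norm_nonneg _)
    (u := fun x y => ‖φ.1 (x, y)‖) (fun x y => norm_nonneg _) (by norm_num)
  have h4 : ∑ x ∈ S, ∑ y ∈ S, T.edgeWeight x y *
        (|χ y ^ 2 - ((χ x + χ y) / 2) ^ 2| * ‖T.delta0 φ y‖ * ‖φ.1 (x, y)‖)
      ≤ ∑ x ∈ S, ∑ y ∈ S, T.edgeWeight x y *
        (|χ x - χ y| * χ y * ‖T.delta0 φ y‖ * ‖φ.1 (x, y)‖)
      + 1 / 4 * ∑ x ∈ S, ∑ y ∈ S, T.edgeWeight x y *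
        (|χ x - χ y| ^ 2 * ‖T.delta0 φ y‖ * ‖φ.1 (x, y)‖) := by
    simp only [Finset.mul_sum, ← Finset.sum_add_distrib]
    refine Finset.sum_le_sum fun x _ => Finset.sum_le_sum fun y _ => ?_
    have e := mul_le_mul_of_nonneg_left (abs_sq_sub_mean_sq_le' (a := χ x) (h.nonneg y))
      (mul_nonneg (T.edgeWeight_nonneg x y)
        (mul_nonneg (norm_nonneg (T.delta0 φ y)) (norm_nonneg (φ.1 (x, y)))))
    linarith
  have h5 : 0 ≤ l / 2 * ∑ x ∈ S, ∑ y ∈ S, T.edgeWeight x y * ((χ x + χ y) / 2) ^ 2 *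
      ‖φ.1 (x, y)‖ ^ 2 :=
    mul_nonneg (by linarith) (Finset.sum_nonneg fun x _ => Finset.sum_nonneg fun y _ =>
      mul_nonneg (mul_nonneg (T.edgeWeight_nonneg x y) (by positivity)) (by positivity))
  have h6 := mul_comm (√(K * ∑ x ∈ S, ∑ y ∈ S, T.edgeWeight x y * ‖φ.1 (x, y)‖ ^ 2))
    (√(∑ x ∈ S, ∑ y ∈ S, ∑ t ∈ S, T.faceWeight x y t *
          ((χ x + χ y + χ t) / 3 * ‖(T.d1 φ).1 (x, y, t)‖) ^ 2))
  simp only [one_mul] at h1 h3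
  simp only [mul_pow, mul_assoc] at hen h1 h2 h3 h4 h5 h6 ⊢
  linarith

/-- The energy inequality for weights that only see the variation of `χ`. -/
theorem sum_diam_sq_le (h : T.IsCutoff K S₁ S χ) {l : ℝ} (hl : 0 ≤ l) {φ : T.skewEdge}
    (heq : T.d0 (T.delta0 φ) + T.delta1 (T.d1 φ) = -(l : ℂ) • φ) :
    (∑ x ∈ S, ∑ y ∈ S, ∑ t ∈ S, T.faceWeight x y t *
        (diam₃ (χ x) (χ y) (χ t) * ‖(T.d1 φ).1 (x, y, t)‖) ^ 2) / 6
    ≤ √(∑ x ∈ S, ∑ y ∈ S, T.edgeWeight x y * (|χ x - χ y| ^ 2 * ‖T.delta0 φ y‖) ^ 2)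
        * √(∑ x ∈ S, ∑ y ∈ S, T.edgeWeight x y * ‖φ.1 (x, y)‖ ^ 2)
      + 1 / 2 * (√(∑ x ∈ S, ∑ y ∈ S, ∑ t ∈ S, T.faceWeight x y t *
          (diam₃ (χ x) (χ y) (χ t) * ‖(T.d1 φ).1 (x, y, t)‖) ^ 2)
        * √(K * ∑ x ∈ S, ∑ y ∈ S, T.edgeWeight x y * ‖φ.1 (x, y)‖ ^ 2)) := by
  have hen := T.edge_energy_le h.thicken_subset (fun _ => 0)
    (fun x y => |χ x - χ y| ^ 2) (fun x y t => diam₃ (χ x) (χ y) (χ t) ^ 2)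
    (fun x hx => rfl)
    (fun x y hx hy => by simp [h.eq_zero x hx, h.eq_zero y hy])
    (fun x y => by rw [abs_sub_comm]) (fun x y t => by rw [diam₃_rot]) heq
  have h2 := weighted_cauchy_schwarz₂ S T.edgeWeight
    (fun x y => |χ x - χ y| ^ 2 * ‖T.delta0 φ y‖) (fun x y => ‖φ.1 (x, y)‖) T.edgeWeight_nonneg
    le_rfl le_rfl
  have h3 := h.sum_face_commutator_le (k := 1) (a := fun _ _ => 1)
    (b := fun x y t => diam₃ (χ x) (χ y) (χ t))
    (m := fun x y t => |diam₃ (χ x) (χ y) (χ t) ^ 2 - |χ x - χ y| ^ 2|)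
    (fun x y t => by
      rw [one_mul, one_mul]; exact abs_diam₃_sq_sub_le _ _ _)
    (v := fun x y t => ‖(T.d1 φ).1 (x, y, t)‖) (fun x y t => norm_nonneg _)
    (u := fun x y => ‖φ.1 (x, y)‖) (fun x y => norm_nonneg _) (by norm_num)
  have h5 : 0 ≤ l / 2 * ∑ x ∈ S, ∑ y ∈ S, T.edgeWeight x y * |χ x - χ y| ^ 2 *
      ‖φ.1 (x, y)‖ ^ 2 :=
    mul_nonneg (by linarith) (Finset.sum_nonneg fun x _ => Finset.sum_nonneg fun y _ =>
      mul_nonneg (mul_nonneg (T.edgeWeight_nonneg x y) (by positivity)) (by positivity))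
  have h6 := mul_comm (√(K * ∑ x ∈ S, ∑ y ∈ S, T.edgeWeight x y * ‖φ.1 (x, y)‖ ^ 2))
    (√(∑ x ∈ S, ∑ y ∈ S, ∑ t ∈ S, T.faceWeight x y t *
          (diam₃ (χ x) (χ y) (χ t) * ‖(T.d1 φ).1 (x, y, t)‖) ^ 2))
  simp only [one_mul] at h3
  simp only [mul_zero, zero_mul, Finset.sum_const_zero, zero_add, zero_sub, abs_neg, abs_pow,
    abs_abs] at hen
  simp only [mul_pow, mul_assoc] at hen h2 h3 h5 h6 ⊢
  linarith

/-- At the end of an edge where `χ` is larger, the difference of `χ` is at most its value; at the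
other end, `g` is bounded by its value at the first one and by `d⁰ g`. -/
theorem sum_pow_four_norm_le (h : T.IsCutoff K S₁ S χ) (g : V → ℂ) :
    ∑ x ∈ S, ∑ y ∈ S, T.edgeWeight x y * (|χ x - χ y| ^ 2 * ‖g y‖) ^ 2
      ≤ 3 * K * ∑ x ∈ S, T.c x * (χ x * ‖g x‖) ^ 2
        + 2 * ∑ x ∈ S, ∑ y ∈ S, T.edgeWeight x y *
          (|χ x - χ y| ^ 2 * ‖(T.d0 g).1 (x, y)‖) ^ 2 := by
  have h1 := h.sum_edge_le fun y => χ y * ‖g y‖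
  have h2 : ∑ x ∈ S, ∑ y ∈ S, T.edgeWeight x y * (|χ x - χ y| * (χ x * ‖g x‖)) ^ 2
      = ∑ x ∈ S, ∑ y ∈ S, T.edgeWeight x y * (|χ x - χ y| * (χ y * ‖g y‖)) ^ 2 := by
    rw [Finset.sum_comm]
    refine Finset.sum_congr rfl fun x _ => Finset.sum_congr rfl fun y _ => ?_
    rw [T.edgeWeight_symm, abs_sub_comm]
  have h3 : ∑ x ∈ S, ∑ y ∈ S, T.edgeWeight x y * (|χ x - χ y| ^ 2 * ‖g y‖) ^ 2
      ≤ ∑ x ∈ S, ∑ y ∈ S, T.edgeWeight x y * (|χ x - χ y| * (χ y * ‖g y‖)) ^ 2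
        + 2 * ∑ x ∈ S, ∑ y ∈ S, T.edgeWeight x y * (|χ x - χ y| * (χ x * ‖g x‖)) ^ 2
        + 2 * ∑ x ∈ S, ∑ y ∈ S, T.edgeWeight x y *
          (|χ x - χ y| ^ 2 * ‖(T.d0 g).1 (x, y)‖) ^ 2 := by
    simp only [Finset.mul_sum, ← Finset.sum_add_distrib]
    refine Finset.sum_le_sum fun x _ => Finset.sum_le_sum fun y _ => ?_
    by_cases hxy : T.graph.Adj x y
    · have hρ := T.edgeWeight_nonneg x y
      have hd := abs_nonneg (χ x - χ y)
      have ha := norm_nonneg ((T.d0 g).1 (x, y))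
      have hx := norm_nonneg (g x)
      have hy := norm_nonneg (g y)
      have key : (|χ x - χ y| ^ 2 * ‖g y‖) ^ 2 ≤ (|χ x - χ y| * (χ y * ‖g y‖)) ^ 2
          + 2 * (|χ x - χ y| * (χ x * ‖g x‖)) ^ 2
          + 2 * (|χ x - χ y| ^ 2 * ‖(T.d0 g).1 (x, y)‖) ^ 2 := by
        rcases le_total (χ x) (χ y) with hle | hle
        · -- the difference of `χ` is at most its value at `y`
          have e : |χ x - χ y| ≤ χ y := abs_le.2 ⟨by linarith [h.nonneg x], by
            linarith [h.nonneg y]⟩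
          have e1 : |χ x - χ y| ^ 2 * ‖g y‖ ≤ |χ x - χ y| * (χ y * ‖g y‖) := by
            have := mul_le_mul_of_nonneg_left e (mul_nonneg hd hy)
            nlinarith
          have e2 := pow_le_pow_left₀ (by positivity) e1 2
          have : 0 ≤ 2 * (|χ x - χ y| * (χ x * ‖g x‖)) ^ 2 := by positivity
          have : 0 ≤ 2 * (|χ x - χ y| ^ 2 * ‖(T.d0 g).1 (x, y)‖) ^ 2 := by positivity
          linarith
        · have e : |χ x - χ y| ≤ χ x := abs_le.2 ⟨by linarith [h.nonneg x], by
            linarith [h.nonneg y]⟩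
          have e0 := norm_le_norm_add_norm_d0 g hxy
          have e1 : |χ x - χ y| ^ 2 * ‖g y‖ ≤ |χ x - χ y| * (χ x * ‖g x‖)
              + |χ x - χ y| ^ 2 * ‖(T.d0 g).1 (x, y)‖ := by
            have i1 := mul_le_mul_of_nonneg_left e (mul_nonneg hd hx)
            have i2 := mul_le_mul_of_nonneg_left e0 (sq_nonneg |χ x - χ y|)
            nlinarith
          have e2 := pow_le_pow_left₀ (by positivity) e1 2
          have : 0 ≤ (|χ x - χ y| * (χ y * ‖g y‖)) ^ 2 := by positivity
          nlinarith [sq_nonneg (|χ x - χ y| * (χ x * ‖g x‖)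
              - |χ x - χ y| ^ 2 * ‖(T.d0 g).1 (x, y)‖)]
      have := mul_le_mul_of_nonneg_left key hρ
      linarith
    · simp [T.edgeWeight_eq_zero hxy]
  linarith

/-- `diam₃_pow_six_le` brings in second differences, which cost a factor `K` by `sum_face_le`. -/
theorem sum_diam_pow_six_le (h : T.IsCutoff K S₁ S χ) (n : V → ℝ) :
    ∑ x ∈ S, ∑ y ∈ S, ∑ t ∈ S, T.faceWeight x y t * (diam₃ (χ x) (χ y) (χ t) ^ 3 * n x) ^ 2
      ≤ 8192 * K * ∑ x ∈ S, ∑ y ∈ S, T.edgeWeight x y * (|χ x - χ y| ^ 2 * n y) ^ 2 := by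
  have h1 := h.sum_face_le fun x y => |χ x - χ y| ^ 2 * n x
  have h2 : ∑ x ∈ S, ∑ y ∈ S, T.edgeWeight x y * (|χ x - χ y| ^ 2 * n x) ^ 2
      = ∑ x ∈ S, ∑ y ∈ S, T.edgeWeight x y * (|χ x - χ y| ^ 2 * n y) ^ 2 := by
    rw [Finset.sum_comm]
    refine Finset.sum_congr rfl fun x _ => Finset.sum_congr rfl fun y _ => ?_
    rw [T.edgeWeight_symm, abs_sub_comm]
  have h3 : ∑ x ∈ S, ∑ y ∈ S, ∑ t ∈ S, T.faceWeight x y t *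
        (|χ x + χ t - 2 * χ y| * (|χ x - χ t| ^ 2 * n x)) ^ 2
      = ∑ x ∈ S, ∑ y ∈ S, ∑ t ∈ S, T.faceWeight x y t *
        (|χ x + χ y - 2 * χ t| * (|χ x - χ y| ^ 2 * n x)) ^ 2 := by
    refine Finset.sum_congr rfl fun x _ => ?_
    rw [Finset.sum_comm]
    refine Finset.sum_congr rfl fun y _ => Finset.sum_congr rfl fun t _ => ?_
    rw [T.faceWeight_swap]
  have h4 : ∑ x ∈ S, ∑ y ∈ S, ∑ t ∈ S, T.faceWeight x y t *
        (diam₃ (χ x) (χ y) (χ t) ^ 3 * n x) ^ 2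
      ≤ 4096 * ∑ x ∈ S, ∑ y ∈ S, ∑ t ∈ S, T.faceWeight x y t *
        (|χ x + χ y - 2 * χ t| * (|χ x - χ y| ^ 2 * n x)) ^ 2
      + 4096 * ∑ x ∈ S, ∑ y ∈ S, ∑ t ∈ S, T.faceWeight x y t *
        (|χ x + χ t - 2 * χ y| * (|χ x - χ t| ^ 2 * n x)) ^ 2 := by
    simp only [Finset.mul_sum, ← Finset.sum_add_distrib]
    refine Finset.sum_le_sum fun x _ => Finset.sum_le_sum fun y _ =>
      Finset.sum_le_sum fun t _ => ?_
    have e := mul_le_mul_of_nonneg_left (diam₃_pow_six_le (χ x) (χ y) (χ t))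
      (mul_nonneg (T.faceWeight_nonneg x y t) (sq_nonneg (n x)))
    linarith
  rw [h2] at h1
  linarith

/-- The equation, tested with `|χ(x) - χ(y)|⁴ d⁰ δ⁰ φ`. -/
theorem sum_pow_four_d0_delta0_le (h : T.IsCutoff K S₁ S χ) {l : ℝ} (hl : 0 ≤ l)
    {φ : T.skewEdge} (heq : T.d0 (T.delta0 φ) + T.delta1 (T.d1 φ) = -(l : ℂ) • φ) :
    ∑ x ∈ S, ∑ y ∈ S, T.edgeWeight x y *
        (|χ x - χ y| ^ 2 * ‖(T.d0 (T.delta0 φ)).1 (x, y)‖) ^ 2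
    ≤ l * (√(∑ x ∈ S, ∑ y ∈ S, T.edgeWeight x y *
        (|χ x - χ y| ^ 2 * ‖(T.d0 (T.delta0 φ)).1 (x, y)‖) ^ 2)
        * √(∑ x ∈ S, ∑ y ∈ S, T.edgeWeight x y * ‖φ.1 (x, y)‖ ^ 2))
      + √(∑ x ∈ S, ∑ y ∈ S, ∑ t ∈ S, T.faceWeight x y t *
          (diam₃ (χ x) (χ y) (χ t) * ‖(T.d1 φ).1 (x, y, t)‖) ^ 2)
        * √(32768 * K * ∑ x ∈ S, ∑ y ∈ S, T.edgeWeight x y *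
          (|χ x - χ y| ^ 2 * ‖T.delta0 φ y‖) ^ 2) := by
  set g := T.delta0 φ with hg
  set ψ := T.d1 φ with hψ
  have h1 := weighted_cauchy_schwarz₂ S T.edgeWeight
    (fun x y => |χ x - χ y| ^ 2 * ‖(T.d0 g).1 (x, y)‖) (fun x y => ‖φ.1 (x, y)‖)
    T.edgeWeight_nonneg le_rfl le_rfl
  have hZ := h.sum_diam_pow_six_le fun x => ‖g x‖
  have hZ' : ∑ x ∈ S, ∑ y ∈ S, ∑ t ∈ S, T.faceWeight x y t *
        (diam₃ (χ x) (χ y) (χ t) ^ 3 * ‖g y‖) ^ 2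
      = ∑ x ∈ S, ∑ y ∈ S, ∑ t ∈ S, T.faceWeight x y t *
        (diam₃ (χ x) (χ y) (χ t) ^ 3 * ‖g x‖) ^ 2 := by
    rw [Finset.sum_comm]
    refine Finset.sum_congr rfl fun x _ => Finset.sum_congr rfl fun y _ =>
      Finset.sum_congr rfl fun t _ => ?_
    rw [diam₃_swap, T.faceWeight_rot, T.faceWeight_swap]
  have hB : ∑ x ∈ S, ∑ y ∈ S, ∑ t ∈ S, T.faceWeight x y t *
        (diam₃ (χ x) (χ y) (χ t) ^ 3 * (‖g x‖ + ‖g y‖)) ^ 2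
      ≤ 32768 * K * ∑ x ∈ S, ∑ y ∈ S, T.edgeWeight x y * (|χ x - χ y| ^ 2 * ‖g y‖) ^ 2 := by
    have : ∑ x ∈ S, ∑ y ∈ S, ∑ t ∈ S, T.faceWeight x y t *
        (diam₃ (χ x) (χ y) (χ t) ^ 3 * (‖g x‖ + ‖g y‖)) ^ 2
      ≤ 2 * ∑ x ∈ S, ∑ y ∈ S, ∑ t ∈ S, T.faceWeight x y t *
        (diam₃ (χ x) (χ y) (χ t) ^ 3 * ‖g x‖) ^ 2
      + 2 * ∑ x ∈ S, ∑ y ∈ S, ∑ t ∈ S, T.faceWeight x y t *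
        (diam₃ (χ x) (χ y) (χ t) ^ 3 * ‖g y‖) ^ 2 := by
      simp only [Finset.mul_sum, ← Finset.sum_add_distrib]
      refine Finset.sum_le_sum fun x _ => Finset.sum_le_sum fun y _ =>
        Finset.sum_le_sum fun t _ => ?_
      have e : (‖g x‖ + ‖g y‖) ^ 2 ≤ 2 * ‖g x‖ ^ 2 + 2 * ‖g y‖ ^ 2 := by
        nlinarith [sq_nonneg (‖g x‖ - ‖g y‖)]
      have := mul_le_mul_of_nonneg_left e (mul_nonneg (T.faceWeight_nonneg x y t)
        (sq_nonneg (diam₃ (χ x) (χ y) (χ t) ^ 3)))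
      linarith
    linarith
  -- `|χ(x) - χ(y)|⁴ ≤ diam⁴` is split as `diam · diam³`
  have h2 := weighted_cauchy_schwarz₃ S T.faceWeight
    (fun x y t => diam₃ (χ x) (χ y) (χ t) * ‖ψ.1 (x, y, t)‖)
    (fun x y t => diam₃ (χ x) (χ y) (χ t) ^ 3 * (‖g x‖ + ‖g y‖))
    T.faceWeight_nonneg le_rfl hB
  refine le_trans ?_ (add_le_add (mul_le_mul_of_nonneg_left h1 hl) h2)
  simp only [Finset.mul_sum, ← Finset.sum_add_distrib]
  refine Finset.sum_le_sum fun x _ => Finset.sum_le_sum fun y _ => ?_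
  have hρ := T.edgeWeight_nonneg x y
  have hd := abs_nonneg (χ x - χ y)
  have hd1 := h.abs_sub_le_one x y
  have ha := norm_nonneg ((T.d0 g).1 (x, y))
  have hφ := norm_nonneg (φ.1 (x, y))
  have hr : 0 ≤ ∑ t ∈ S, T.faceWeight x y t * (diam₃ (χ x) (χ y) (χ t) * ‖ψ.1 (x, y, t)‖ *
      (diam₃ (χ x) (χ y) (χ t) ^ 3 * (‖g x‖ + ‖g y‖))) :=
    Finset.sum_nonneg fun t _ => by
      have := T.faceWeight_nonneg x y t
      have := diam₃_nonneg (χ x) (χ y) (χ t)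
      positivity
  by_cases hxy : x ∈ S₁ ∨ y ∈ S₁
  swap
  · rw [not_or] at hxy
    simp only [h.eq_zero x hxy.1, h.eq_zero y hxy.2, sub_self, abs_zero] at hr ⊢
    simpa using hr
  have e1 : ‖(T.d0 g).1 (x, y)‖ ≤ l * ‖φ.1 (x, y)‖ + ‖(T.delta1 ψ).1 (x, y)‖ := by
    have e := congrArg (fun η : T.skewEdge => η.1 (x, y)) heq
    simp only [Submodule.coe_add, Pi.add_apply, Submodule.coe_smul, Pi.smul_apply,
      smul_eq_mul] at e
    rw [eq_sub_of_add_eq e]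
    refine (norm_sub_le _ _).trans (le_of_eq ?_)
    rw [norm_mul, norm_neg, Complex.norm_real, Real.norm_eq_abs, abs_of_nonneg hl]
  have e2 : T.edgeWeight x y * ‖(T.delta1 ψ).1 (x, y)‖
      ≤ ∑ t ∈ S, T.faceWeight x y t * ‖ψ.1 (x, y, t)‖ := by
    have e := congrArg norm (T.edgeWeight_mul_delta1 h.thicken_subset ψ hxy)
    rw [norm_mul, Complex.norm_real, Real.norm_eq_abs, abs_of_nonneg hρ] at e
    rw [e]
    refine (norm_sum_le _ _).trans (Finset.sum_le_sum fun t _ => le_of_eq ?_)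
    rw [norm_mul, norm_mul, norm_phase, one_mul, Complex.norm_real, Real.norm_eq_abs,
      abs_of_nonneg (T.faceWeight_nonneg x y t)]
  have e3 : |χ x - χ y| ^ 4 * ‖(T.d0 g).1 (x, y)‖ * ∑ t ∈ S, T.faceWeight x y t * ‖ψ.1 (x, y, t)‖
      ≤ ∑ t ∈ S, T.faceWeight x y t * (diam₃ (χ x) (χ y) (χ t) * ‖ψ.1 (x, y, t)‖ *
      (diam₃ (χ x) (χ y) (χ t) ^ 3 * (‖g x‖ + ‖g y‖))) := by
    rw [Finset.mul_sum]
    refine Finset.sum_le_sum fun t _ => ?_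
    have hσ := T.faceWeight_nonneg x y t
    calc |χ x - χ y| ^ 4 * ‖(T.d0 g).1 (x, y)‖ * (T.faceWeight x y t * ‖ψ.1 (x, y, t)‖)
        ≤ diam₃ (χ x) (χ y) (χ t) ^ 4 * (‖g x‖ + ‖g y‖) *
          (T.faceWeight x y t * ‖ψ.1 (x, y, t)‖) := by
          gcongr
          · exact abs_sub_le_diam₃ _ _ _
          · exact norm_d0_le g x y
      _ = _ := by ring
  have e4 : |χ x - χ y| ^ 4 ≤ |χ x - χ y| ^ 2 := pow_le_pow_of_le_one hd hd1 (by norm_num)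
  calc T.edgeWeight x y * (|χ x - χ y| ^ 2 * ‖(T.d0 g).1 (x, y)‖) ^ 2
      = T.edgeWeight x y * |χ x - χ y| ^ 4 * ‖(T.d0 g).1 (x, y)‖ * ‖(T.d0 g).1 (x, y)‖ := by ring
    _ ≤ T.edgeWeight x y * |χ x - χ y| ^ 4 * ‖(T.d0 g).1 (x, y)‖ *
        (l * ‖φ.1 (x, y)‖ + ‖(T.delta1 ψ).1 (x, y)‖) := by gcongr
    _ = l * (T.edgeWeight x y * (|χ x - χ y| ^ 4 * ‖(T.d0 g).1 (x, y)‖ * ‖φ.1 (x, y)‖))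
        + |χ x - χ y| ^ 4 * ‖(T.d0 g).1 (x, y)‖ *
          (T.edgeWeight x y * ‖(T.delta1 ψ).1 (x, y)‖) := by ring
    _ ≤ l * (T.edgeWeight x y * (|χ x - χ y| ^ 2 * ‖(T.d0 g).1 (x, y)‖ * ‖φ.1 (x, y)‖))
        + |χ x - χ y| ^ 4 * ‖(T.d0 g).1 (x, y)‖ *
          ∑ t ∈ S, T.faceWeight x y t * ‖ψ.1 (x, y, t)‖ := by gcongr
    _ ≤ _ := by gcongr

end IsCutoff

/-- The a priori estimate: if `φ` solves `Δ φ = -l φ`, then `δ⁰ φ` and `d¹ φ`, cut off by `χ`, are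
bounded by `φ`. -/
theorem exists_cutoff_bound {K : ℝ} (hK : 0 ≤ K) {l : ℝ} (hl : 0 ≤ l) :
    ∃ C : ℝ, ∀ {V : Type*} (T : MagneticTriangulation V) {S₁ S : Finset V} {χ : V → ℝ},
      T.IsCutoff K S₁ S χ → ∀ φ : T.skewEdge,
      T.d0 (T.delta0 φ) + T.delta1 (T.d1 φ) = -(l : ℂ) • φ →
      ∑ x ∈ S, T.c x * (χ x * ‖T.delta0 φ x‖) ^ 2
        ≤ C * ∑ x ∈ S, ∑ y ∈ S, T.edgeWeight x y * ‖φ.1 (x, y)‖ ^ 2 ∧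
      ∑ x ∈ S, ∑ y ∈ S, ∑ t ∈ S, T.faceWeight x y t *
          ((χ x + χ y + χ t) / 3 * ‖(T.d1 φ).1 (x, y, t)‖) ^ 2
        ≤ C * ∑ x ∈ S, ∑ y ∈ S, T.edgeWeight x y * ‖φ.1 (x, y)‖ ^ 2 := by
  obtain ⟨C, hC⟩ := exists_bound_of_energy_system l hK
  refine ⟨C, fun T S₁ S χ h φ heq => hC _ _ _ _ _ _ ?_ ?_ ?_ ?_ ?_ ?_ (h.sum_mean_sq_le hl heq)
    (h.sum_diam_sq_le hl heq) (h.sum_pow_four_d0_delta0_le hl heq)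
    (h.sum_pow_four_norm_le (T.delta0 φ))⟩
  · exact Finset.sum_nonneg fun x _ => mul_nonneg (T.c_pos x).le (sq_nonneg _)
  all_goals
    first
    | exact Finset.sum_nonneg fun x _ => Finset.sum_nonneg fun y _ =>
        mul_nonneg (T.edgeWeight_nonneg x y) (sq_nonneg _)
    | exact Finset.sum_nonneg fun x _ => Finset.sum_nonneg fun y _ => Finset.sum_nonneg fun t _ =>
        mul_nonneg (T.faceWeight_nonneg x y t) (sq_nonneg _)

end MagneticTriangulation

/-! ### Vanishing of the square-summable solutions -/

/-- If `l E ≤ k sup E` with `k < l` for a bounded nonnegative family `E`, then `E = 0`. -/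
theorem eq_zero_of_forall_exists_mul_le {ι : Type*} [Nonempty ι] {E : ι → ℝ} (h0 : ∀ i, 0 ≤ E i)
    (hb : BddAbove (Set.range E)) {k l : ℝ} (hk : 0 ≤ k) (hkl : k < l)
    (h : ∀ i, ∃ j, l * E i ≤ k * E j) (i : ι) : E i = 0 := by
  have hl : 0 < l := hk.trans_lt hkl
  have h1 : ⨆ i, E i ≤ k / l * ⨆ i, E i := ciSup_le fun i => by
    obtain ⟨j, hj⟩ := h i
    rw [div_mul_eq_mul_div, le_div_iff₀' hl]
    exact hj.trans (mul_le_mul_of_nonneg_left (le_ciSup hb j) hk)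
  have h2 : k / l < 1 := (div_lt_one hl).2 hkl
  have h3 := le_ciSup hb i
  have h4 := h0 i
  refine le_antisymm ?_ h4
  nlinarith

namespace MagneticTriangulation

variable {V : Type*} {T : MagneticTriangulation V}

theorem sum_sum_le_of_subset {U S : Finset V} (h : U ⊆ S) {f g : V → V → ℝ}
    (hg : ∀ x y, 0 ≤ g x y) (hfg : ∀ x ∈ U, ∀ y ∈ U, f x y ≤ g x y) :
    ∑ x ∈ U, ∑ y ∈ U, f x y ≤ ∑ x ∈ S, ∑ y ∈ S, g x y :=
  (Finset.sum_le_sum fun x hx => (Finset.sum_le_sum fun y hy => hfg x hx y hy).trans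
    (Finset.sum_le_sum_of_subset_of_nonneg h fun y _ _ => hg x y)).trans
    (Finset.sum_le_sum_of_subset_of_nonneg h fun x _ _ => Finset.sum_nonneg fun y _ => hg x y)

theorem sum_sum_sum_le_of_subset {U S : Finset V} (h : U ⊆ S) {f g : V → V → V → ℝ}
    (hg : ∀ x y t, 0 ≤ g x y t) (hfg : ∀ x ∈ U, ∀ y ∈ U, ∀ t ∈ U, f x y t ≤ g x y t) :
    ∑ x ∈ U, ∑ y ∈ U, ∑ t ∈ U, f x y t ≤ ∑ x ∈ S, ∑ y ∈ S, ∑ t ∈ S, g x y t :=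
  (Finset.sum_le_sum fun x hx => sum_sum_le_of_subset h (hg x) (hfg x hx)).trans
    (Finset.sum_le_sum_of_subset_of_nonneg h fun x _ _ => Finset.sum_nonneg fun y _ =>
      Finset.sum_nonneg fun t _ => hg x y t)

theorem edge_eq_zero_of_sum_eq_zero (φ : T.skewEdge)
    (h : ∀ U : Finset V, ∑ x ∈ U, ∑ y ∈ U, T.edgeWeight x y * ‖φ.1 (x, y)‖ ^ 2 = 0) : φ = 0 := by
  classical
  refine Subtype.ext (funext fun ⟨x, y⟩ => ?_)
  by_cases hxy : T.graph.Adj x y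
  · have hn : ∀ a b, 0 ≤ T.edgeWeight a b * ‖φ.1 (a, b)‖ ^ 2 := fun a b =>
      mul_nonneg (T.edgeWeight_nonneg a b) (sq_nonneg _)
    have h1 := (Finset.sum_eq_zero_iff_of_nonneg fun a _ =>
      Finset.sum_nonneg fun b _ => hn a b).1 (h {x, y}) x (by simp)
    have h2 := (Finset.sum_eq_zero_iff_of_nonneg fun b _ => hn x b).1 h1 y (by simp)
    have h3 := (T.r_pos x y hxy).ne'
    simpa [edgeWeight, hxy, h3] using h2
  · exact φ.2.2 x y hxy

theorem face_eq_zero_of_sum_eq_zero (ψ : T.skewFace)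
    (h : ∀ U : Finset V, ∑ x ∈ U, ∑ y ∈ U, ∑ t ∈ U, T.faceWeight x y t * ‖ψ.1 (x, y, t)‖ ^ 2 = 0) :
    ψ = 0 := by
  classical
  refine Subtype.ext (funext fun ⟨x, y, t⟩ => ?_)
  by_cases hxy : T.face x y t
  · have hn : ∀ a b c, 0 ≤ T.faceWeight a b c * ‖ψ.1 (a, b, c)‖ ^ 2 := fun a b c =>
      mul_nonneg (T.faceWeight_nonneg a b c) (sq_nonneg _)
    have h1 := (Finset.sum_eq_zero_iff_of_nonneg fun a _ => Finset.sum_nonneg fun b _ =>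
      Finset.sum_nonneg fun c _ => hn a b c).1 (h {x, y, t}) x (by simp)
    have h2 := (Finset.sum_eq_zero_iff_of_nonneg fun b _ =>
      Finset.sum_nonneg fun c _ => hn x b c).1 h1 y (by simp)
    have h3 := (Finset.sum_eq_zero_iff_of_nonneg fun c _ => hn x y c).1 h2 t (by simp)
    have h4 := (T.s_pos x y t hxy).ne'
    simpa [faceWeight, hxy, h4] using h3
  · exact ψ.2.2.2 x y t hxy

/-- A square-summable solution of `Δ (f, ψ) = -l (f, ψ)` vanishes if `l` is large. -/
theorem vertex_face_eq_zero {K : ℝ} (hK : 0 < K)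
    (hcut : ∀ U : Finset V, ∃ S₁ S : Finset V, ∃ χ : V → ℝ, T.IsCutoff K S₁ S χ ∧
      U ⊆ S ∧ ∀ x ∈ U, χ x = 1) {l : ℝ} (hl : 27 / 2 * K < l) {f : V → ℂ} {ψ : T.skewFace}
    (hf : T.delta0 (T.d0 f + T.delta1 ψ) = -(l : ℂ) • f)
    (hψ : T.d1 (T.d0 f + T.delta1 ψ) = -(l : ℂ) • ψ)
    (hfb : BddAbove (Set.range fun U : Finset V => ∑ x ∈ U, T.c x * ‖f x‖ ^ 2))
    (hψb : BddAbove (Set.range fun U : Finset V =>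
      ∑ x ∈ U, ∑ y ∈ U, ∑ t ∈ U, T.faceWeight x y t * ‖ψ.1 (x, y, t)‖ ^ 2)) :
    f = 0 ∧ ψ = 0 := by
  have hl0 : 0 ≤ l := by linarith
  have hn0 : ∀ U : Finset V, 0 ≤ ∑ x ∈ U, T.c x * ‖f x‖ ^ 2 := fun U =>
    Finset.sum_nonneg fun x _ => mul_nonneg (T.c_pos x).le (sq_nonneg _)
  have hn2 : ∀ U : Finset V, 0 ≤ ∑ x ∈ U, ∑ y ∈ U, ∑ t ∈ U,
      T.faceWeight x y t * ‖ψ.1 (x, y, t)‖ ^ 2 := fun U =>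
    Finset.sum_nonneg fun x _ => Finset.sum_nonneg fun y _ => Finset.sum_nonneg fun t _ =>
      mul_nonneg (T.faceWeight_nonneg x y t) (sq_nonneg _)
  have hE := eq_zero_of_forall_exists_mul_le (E := fun U : Finset V =>
      ∑ x ∈ U, T.c x * ‖f x‖ ^ 2
        + 1 / 6 * ∑ x ∈ U, ∑ y ∈ U, ∑ t ∈ U, T.faceWeight x y t * ‖ψ.1 (x, y, t)‖ ^ 2)
    (fun U => by linarith [hn0 U, hn2 U]) (by
      obtain ⟨A, hA⟩ := hfb
      obtain ⟨B, hB⟩ := hψb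
      refine ⟨A + 1 / 6 * B, ?_⟩
      rintro _ ⟨U, rfl⟩
      have hA' := hA ⟨U, rfl⟩
      have hB' := hB ⟨U, rfl⟩
      dsimp only at hA' hB' ⊢
      linarith) (k := 27 / 2 * K) (l := l) (by linarith) hl (fun U => by
      obtain ⟨S₁, S, χ, hχ, hUS, h1⟩ := hcut U
      refine ⟨S, ?_⟩
      have e := hχ.vertex_face_le hK.le hf hψ
      have e0 : ∑ x ∈ U, T.c x * ‖f x‖ ^ 2 ≤ ∑ x ∈ S, T.c x * χ x ^ 2 * ‖f x‖ ^ 2 := by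
        refine (Finset.sum_le_sum fun x hx => ?_).trans
          (Finset.sum_le_sum_of_subset_of_nonneg hUS fun x _ _ =>
            mul_nonneg (mul_nonneg (T.c_pos x).le (sq_nonneg _)) (sq_nonneg _))
        rw [h1 x hx, one_pow, mul_one]
      have e2 : ∑ x ∈ U, ∑ y ∈ U, ∑ t ∈ U, T.faceWeight x y t * ‖ψ.1 (x, y, t)‖ ^ 2
          ≤ ∑ x ∈ S, ∑ y ∈ S, ∑ t ∈ S, T.faceWeight x y t *
            median (χ x) (χ y) (χ t) ^ 2 * ‖ψ.1 (x, y, t)‖ ^ 2 := by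
        refine sum_sum_sum_le_of_subset hUS (fun x y t => mul_nonneg (mul_nonneg
          (T.faceWeight_nonneg x y t) (sq_nonneg _)) (sq_nonneg _)) fun x hx y hy t ht => ?_
        rw [h1 x hx, h1 y hy, h1 t ht]
        simp [median]
      have e3 := mul_le_mul_of_nonneg_left (add_le_add e0
        (mul_le_mul_of_nonneg_left e2 (by norm_num : (0 : ℝ) ≤ 1 / 6))) hl0
      have e4 := mul_nonneg hK.le (hn0 S)
      refine e3.trans (e.trans ?_)
      linarith)
  have hE0 : ∀ U : Finset V, ∑ x ∈ U, T.c x * ‖f x‖ ^ 2 = 0 := fun U => by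
    have := hE U
    linarith [hn0 U, hn2 U]
  have hE2 : ∀ U : Finset V, ∑ x ∈ U, ∑ y ∈ U, ∑ t ∈ U,
      T.faceWeight x y t * ‖ψ.1 (x, y, t)‖ ^ 2 = 0 := fun U => by
    have := hE U
    linarith [hn0 U, hn2 U]
  refine ⟨funext fun x => ?_, face_eq_zero_of_sum_eq_zero ψ hE2⟩
  have := hE0 {x}
  simpa [(T.c_pos x).ne'] using this

/-- A square-summable solution of `Δ φ = -l φ` vanishes if `l` is large: the a priori estimate
shows that `δ⁰ φ` and `d¹ φ` are square-summable, so that their energies absorb the error terms. -/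
theorem edge_eq_zero {K : ℝ} (hK : 0 < K)
    (hcut : ∀ U : Finset V, ∃ S₁ S : Finset V, ∃ χ : V → ℝ, T.IsCutoff K S₁ S χ ∧
      U ⊆ S ∧ ∀ x ∈ U, χ x = 1) {l : ℝ} (hl : 3 * K ≤ l) {φ : T.skewEdge}
    (heq : T.d0 (T.delta0 φ) + T.delta1 (T.d1 φ) = -(l : ℂ) • φ)
    (hφb : BddAbove (Set.range fun U : Finset V =>
      ∑ x ∈ U, ∑ y ∈ U, T.edgeWeight x y * ‖φ.1 (x, y)‖ ^ 2)) :
    φ = 0 := by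
  have hl0 : 0 ≤ l := by linarith
  set W0 : Finset V → ℝ := fun U => ∑ x ∈ U, T.c x * ‖T.delta0 φ x‖ ^ 2 with hW0
  set W2 : Finset V → ℝ := fun U => ∑ x ∈ U, ∑ y ∈ U, ∑ t ∈ U,
    T.faceWeight x y t * ‖(T.d1 φ).1 (x, y, t)‖ ^ 2 with hW2
  set P : Finset V → ℝ := fun U => ∑ x ∈ U, ∑ y ∈ U, T.edgeWeight x y * ‖φ.1 (x, y)‖ ^ 2 with hP
  have hn0 : ∀ U, 0 ≤ W0 U := fun U =>
    Finset.sum_nonneg fun x _ => mul_nonneg (T.c_pos x).le (sq_nonneg _)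
  have hn2 : ∀ U, 0 ≤ W2 U := fun U =>
    Finset.sum_nonneg fun x _ => Finset.sum_nonneg fun y _ => Finset.sum_nonneg fun t _ =>
      mul_nonneg (T.faceWeight_nonneg x y t) (sq_nonneg _)
  have hnP : ∀ U, 0 ≤ P U := fun U =>
    Finset.sum_nonneg fun x _ => Finset.sum_nonneg fun y _ =>
      mul_nonneg (T.edgeWeight_nonneg x y) (sq_nonneg _)
  obtain ⟨M, hM⟩ := hφb
  have hPM : ∀ U, P U ≤ M := fun U => hM ⟨U, rfl⟩
  obtain ⟨C, hC⟩ := exists_cutoff_bound hK.le hl0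
  have hbd : ∀ U, W0 U ≤ |C| * M ∧ W2 U ≤ |C| * M := fun U => by
    obtain ⟨S₁, S, χ, hχ, hUS, h1⟩ := hcut U
    obtain ⟨c0, c2⟩ := hC T hχ φ heq
    have hCP : C * P S ≤ |C| * M :=
      mul_le_mul (le_abs_self C) (hPM S) (hnP S) (abs_nonneg C)
    constructor
    · refine le_trans ?_ (c0.trans hCP)
      refine (Finset.sum_le_sum fun x hx => ?_).trans
        (Finset.sum_le_sum_of_subset_of_nonneg hUS fun x _ _ =>
          mul_nonneg (T.c_pos x).le (sq_nonneg _))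
      rw [h1 x hx, one_mul]
    · refine le_trans ?_ (c2.trans hCP)
      refine sum_sum_sum_le_of_subset hUS (fun x y t => mul_nonneg
        (T.faceWeight_nonneg x y t) (sq_nonneg _)) fun x hx y hy t ht => ?_
      rw [h1 x hx, h1 y hy, h1 t ht]
      norm_num
  have hE := eq_zero_of_forall_exists_mul_le (E := fun U => W0 U + 1 / 6 * W2 U + l / 2 * P U)
    (fun U => by
      have := mul_nonneg hl0 (hnP U)
      linarith [hn0 U, hn2 U]) (by
      refine ⟨|C| * M + 1 / 6 * (|C| * M) + l / 2 * M, ?_⟩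
      rintro _ ⟨U, rfl⟩
      have := mul_le_mul_of_nonneg_left (hPM U) hl0
      have hh := hbd U
      dsimp only
      linarith) (k := 1 / 2) (l := 1) (by norm_num) (by norm_num) (fun U => by
      obtain ⟨S₁, S, χ, hχ, hUS, h1⟩ := hcut U
      refine ⟨S, ?_⟩
      have hen := T.edge_energy_le hχ.thicken_subset (fun x => χ x ^ 2)
        (fun x y => ((χ x + χ y) / 2) ^ 2) (fun x y t => ((χ x + χ y + χ t) / 3) ^ 2)
        (fun x hx => by simp [hχ.eq_zero x hx])
        (fun x y hx hy => by simp [hχ.eq_zero x hx, hχ.eq_zero y hy])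
        (fun x y => by rw [add_comm]) (fun x y t => by ring) heq
      have e0 : W0 U ≤ ∑ x ∈ S, T.c x * χ x ^ 2 * ‖T.delta0 φ x‖ ^ 2 := by
        refine (Finset.sum_le_sum fun x hx => ?_).trans
          (Finset.sum_le_sum_of_subset_of_nonneg hUS fun x _ _ =>
            mul_nonneg (mul_nonneg (T.c_pos x).le (sq_nonneg _)) (sq_nonneg _))
        rw [h1 x hx, one_pow, mul_one]
      have e1 : P U ≤ ∑ x ∈ S, ∑ y ∈ S, T.edgeWeight x y *
          ((χ x + χ y) / 2) ^ 2 * ‖φ.1 (x, y)‖ ^ 2 := by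
        refine sum_sum_le_of_subset hUS (fun x y => mul_nonneg (mul_nonneg
          (T.edgeWeight_nonneg x y) (sq_nonneg _)) (sq_nonneg _)) fun x hx y hy => ?_
        rw [h1 x hx, h1 y hy]
        norm_num
      have e2 : W2 U ≤ ∑ x ∈ S, ∑ y ∈ S, ∑ t ∈ S, T.faceWeight x y t *
            ((χ x + χ y + χ t) / 3) ^ 2 * ‖(T.d1 φ).1 (x, y, t)‖ ^ 2 := by
        refine sum_sum_sum_le_of_subset hUS (fun x y t => mul_nonneg (mul_nonneg
          (T.faceWeight_nonneg x y t) (sq_nonneg _)) (sq_nonneg _)) fun x hx y hy t ht => ?_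
        rw [h1 x hx, h1 y hy, h1 t ht]
        norm_num
      have c1 := hχ.sum_edge_commutator_le (k := 1) (a := fun _ => 1) (b := fun _ _ => 1)
        (m := fun x y => |χ y ^ 2 - ((χ x + χ y) / 2) ^ 2|) (fun x y => by
          rw [one_mul, mul_one, mul_one]
          exact abs_sq_sub_mean_sq_le_abs (hχ.nonneg x) (hχ.le_one x) (hχ.nonneg y) (hχ.le_one y))
        (v := fun y => ‖T.delta0 φ y‖) (fun y => norm_nonneg _) (u := fun x y => ‖φ.1 (x, y)‖)
        (fun x y => norm_nonneg _) (by norm_num)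
      have c2 := hχ.sum_face_commutator_le (k := 5 / 12) (a := fun _ _ => 1) (b := fun _ _ _ => 1)
        (m := fun x y t => |((χ x + χ y + χ t) / 3) ^ 2 - ((χ x + χ y) / 2) ^ 2|)
        (fun x y t => by
          refine (abs_mean_sq_sub_le (hχ.nonneg x) (hχ.nonneg y) (hχ.nonneg t)).trans ?_
          have hm : (χ x + χ y + χ t) / 3 ≤ 1 := by
            linarith [hχ.le_one x, hχ.le_one y, hχ.le_one t]
          rw [one_mul]
          gcongr)
        (v := fun x y t => ‖(T.d1 φ).1 (x, y, t)‖) (fun x y t => norm_nonneg _)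
        (u := fun x y => ‖φ.1 (x, y)‖) (fun x y => norm_nonneg _) (by norm_num)
      simp only [one_mul] at c1 c2
      have k1 := mul_sqrt_mul_sqrt_le (k := 1) (q := K / 2)
        (mul_nonneg hK.le (hn0 S)) (hnP S) (p := 1 / 2 / K) (by positivity) (by positivity)
        (by field_simp; norm_num)
      have k2 := mul_sqrt_mul_sqrt_le (k := 5 / 24) (p := 1 / 4) (q := 1 / 12)
        (mul_nonneg hK.le (hnP S)) (hn2 S) (by norm_num) (by norm_num) (by norm_num)
      have k3 : 1 / 2 / K * (K * W0 S) = 1 / 2 * W0 S := by field_simp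
      rw [k3] at k1
      have k4 := mul_le_mul_of_nonneg_right hl (hnP S)
      have k5 := mul_le_mul_of_nonneg_left e1 (by linarith : 0 ≤ l / 2)
      dsimp only [W0, W2, P] at *
      linarith)
  refine edge_eq_zero_of_sum_eq_zero φ fun U => ?_
  have h1 := hE U
  have h3 : l * P U ≤ 0 := by
    linarith [hn0 U, hn2 U]
  exact le_antisymm (nonpos_of_mul_nonpos_right h3 (by linarith)) (hnP U)

end MagneticTriangulation

namespace MagneticTriangulation

variable {V : Type*} (T : MagneticTriangulation V)

/-! ### The scalar product of a cochain with a cochain of finite support -/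

/-- The cochain `F` vanishes on all vertices, edges and faces that are not contained in `U`. -/
structure SupportedIn (U : Finset V) (F : T.Cochain) : Prop where
  vertex : ∀ x, x ∉ U → F.1 x = 0
  edge : ∀ x y, ¬ (x ∈ U ∧ y ∈ U) → F.2.1.1 (x, y) = 0
  face : ∀ x y t, ¬ (x ∈ U ∧ y ∈ U ∧ t ∈ U) → F.2.2.1 (x, y, t) = 0

variable {T}

theorem SupportedIn.mono {U U' : Finset V} (h : U ⊆ U') {F : T.Cochain} (hF : T.SupportedIn U F) :
    T.SupportedIn U' F :=
  ⟨fun x hx => hF.vertex x fun h' => hx (h h'),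
    fun x y hxy => hF.edge x y fun h' => hxy ⟨h h'.1, h h'.2⟩,
    fun x y t hxy => hF.face x y t fun h' => hxy ⟨h h'.1, h h'.2.1, h h'.2.2⟩⟩

theorem exists_supportedIn {F : T.Cochain} (hF : F ∈ T.finCochain) :
    ∃ U, T.SupportedIn U F := by
  classical
  obtain ⟨h0, h1, h2⟩ := hF
  refine ⟨h0.toFinset ∪ h1.toFinset.image Prod.fst ∪ h2.toFinset.image Prod.fst,
    fun x hx => ?_, fun x y hxy => ?_, fun x y t hxy => ?_⟩
  · by_contra h
    exact hx (Finset.mem_union_left _ (Finset.mem_union_left _ (by simpa using h)))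
  · by_contra h
    have h' : F.2.1.1 (y, x) ≠ 0 := fun h' => h (by rw [F.2.1.2.1 x y, h', neg_zero])
    refine hxy ⟨?_, ?_⟩
    · exact Finset.mem_union_left _ (Finset.mem_union_right _
        (Finset.mem_image.2 ⟨(x, y), by simpa using h, rfl⟩))
    · exact Finset.mem_union_left _ (Finset.mem_union_right _
        (Finset.mem_image.2 ⟨(y, x), by simpa using h', rfl⟩))
  · by_contra h
    have h' : F.2.2.1 (y, t, x) ≠ 0 := by rwa [← F.2.2.2.2.1 x y t]
    have h'' : F.2.2.1 (t, x, y) ≠ 0 := by rwa [← F.2.2.2.2.1 y t x]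
    refine hxy ⟨?_, ?_, ?_⟩
    · exact Finset.mem_union_right _ (Finset.mem_image.2 ⟨(x, y, t), by simpa using h, rfl⟩)
    · exact Finset.mem_union_right _ (Finset.mem_image.2 ⟨(y, t, x), by simpa using h', rfl⟩)
    · exact Finset.mem_union_right _ (Finset.mem_image.2 ⟨(t, x, y), by simpa using h'', rfl⟩)

variable (T)

open Classical in
/-- The restriction of a cochain to the vertices, edges and faces contained in `U`. -/
def truncate (U : Finset V) (F : T.Cochain) : T.Cochain :=
  (fun x => if x ∈ U then F.1 x else 0,
    ⟨fun e => if e.1 ∈ U ∧ e.2 ∈ U then F.2.1.1 e else 0, by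
      refine ⟨fun x y => ?_, fun x y h => by simp [F.2.1.2.2 x y h]⟩
      by_cases h : x ∈ U ∧ y ∈ U
      · simp [h.1, h.2, F.2.1.2.1 x y]
      · have h' : ¬ (y ∈ U ∧ x ∈ U) := fun h' => h h'.symm
        simp only [h, h', if_false, neg_zero]⟩,
    ⟨fun f => if f.1 ∈ U ∧ f.2.1 ∈ U ∧ f.2.2 ∈ U then F.2.2.1 f else 0, by
      refine ⟨fun x y t => ?_, fun x y t => ?_, fun x y t h => by simp [F.2.2.2.2.2 x y t h]⟩
      · by_cases h : x ∈ U ∧ y ∈ U ∧ t ∈ U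
        · simp [h.1, h.2.1, h.2.2, F.2.2.2.1 x y t]
        · have h' : ¬ (x ∈ U ∧ t ∈ U ∧ y ∈ U) := fun h' => h ⟨h'.1, h'.2.2, h'.2.1⟩
          simp only [h, h', if_false, neg_zero]
      · by_cases h : x ∈ U ∧ y ∈ U ∧ t ∈ U
        · simp [h.1, h.2.1, h.2.2, F.2.2.2.2.1 x y t]
        · have h' : ¬ (y ∈ U ∧ t ∈ U ∧ x ∈ U) := fun h' => h ⟨h'.2.2, h'.1, h'.2.1⟩
          simp only [h, h', if_false]⟩)

theorem supportedIn_truncate (U : Finset V) (F : T.Cochain) :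
    T.SupportedIn U (T.truncate U F) :=
  ⟨fun _ hx => if_neg hx, fun _ _ h => if_neg h, fun _ _ _ h => if_neg h⟩

variable {T}

theorem SupportedIn.mem_finCochain {U : Finset V} {F : T.Cochain} (hF : T.SupportedIn U F) :
    F ∈ T.finCochain := by
  refine ⟨U.finite_toSet.subset fun x hx => ?_, (U ×ˢ U).finite_toSet.subset fun ⟨x, y⟩ hx => ?_,
    (U ×ˢ U ×ˢ U).finite_toSet.subset fun ⟨x, y, t⟩ hx => ?_⟩
  · by_contra h
    exact hx (hF.vertex x h)
  · by_contra h
    exact hx (hF.edge x y fun h' => h (by simp [h'.1, h'.2]))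
  · by_contra h
    exact hx (hF.face x y t fun h' => h (by simp [h'.1, h'.2.1, h'.2.2]))

variable (T)

/-- The scalar product of `ℓ²(T)`, for two cochains one of which has finite support. -/
def pairing (F G : T.Cochain) : ℂ :=
  (∑' x, (T.c x : ℂ) * (conj (F.1 x) * G.1 x))
    + ((∑' e : V × V, ((T.r e.1 e.2 / 2 : ℝ) : ℂ) * (conj (F.2.1.1 e) * G.2.1.1 e))
    + ∑' f : V × V × V, ((T.s f.1 f.2.1 f.2.2 / 6 : ℝ) : ℂ) *
      (conj (F.2.2.1 f) * G.2.2.1 f))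

variable {T}

theorem pairing_eq_sum {U : Finset V} {G : T.Cochain} (hG : T.SupportedIn U G) (F : T.Cochain) :
    T.pairing F G = ∑ x ∈ U, (T.c x : ℂ) * (conj (F.1 x) * G.1 x)
      + 1 / 2 * ∑ x ∈ U, ∑ y ∈ U, (T.edgeWeight x y : ℂ) *
        (conj (F.2.1.1 (x, y)) * G.2.1.1 (x, y))
      + 1 / 6 * ∑ x ∈ U, ∑ y ∈ U, ∑ t ∈ U, (T.faceWeight x y t : ℂ) *
        (conj (F.2.2.1 (x, y, t)) * G.2.2.1 (x, y, t)) := by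
  unfold pairing
  rw [tsum_eq_sum (s := U) fun x hx => by rw [hG.vertex x hx, mul_zero, mul_zero],
    tsum_eq_sum (s := U ×ˢ U) fun e he => by
      rw [hG.edge e.1 e.2 fun h => he (Finset.mem_product.2 h), mul_zero, mul_zero],
    tsum_eq_sum (s := U ×ˢ U ×ˢ U) fun f hf => by
      rw [hG.face f.1 f.2.1 f.2.2 fun h => hf (by simp [h.1, h.2.1, h.2.2]), mul_zero, mul_zero],
    Finset.sum_product, Finset.sum_product, add_assoc]
  simp only [Finset.sum_product, Finset.mul_sum]
  congr 2
  · refine Finset.sum_congr rfl fun x _ => Finset.sum_congr rfl fun y _ => ?_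
    by_cases h : T.graph.Adj x y
    · rw [edgeWeight, if_pos h]; push_cast; ring
    · rw [G.2.1.2.2 x y h]; simp
  · refine Finset.sum_congr rfl fun x _ => Finset.sum_congr rfl fun y _ =>
      Finset.sum_congr rfl fun t _ => ?_
    by_cases h : T.face x y t
    · rw [faceWeight, if_pos h]; push_cast; ring
    · rw [G.2.2.2.2.2 x y t h]; simp

theorem pairing_add_left (F F' : T.Cochain) {G : T.Cochain} (hG : G ∈ T.finCochain) :
    T.pairing (F + F') G = T.pairing F G + T.pairing F' G := by
  obtain ⟨U, hU⟩ := exists_supportedIn hG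
  simp only [pairing_eq_sum hU, Prod.fst_add, Prod.snd_add, Pi.add_apply, Submodule.coe_add,
    map_add, add_mul, mul_add, Finset.sum_add_distrib]
  ring

theorem pairing_smul_left (l : ℝ) (F G : T.Cochain) :
    T.pairing ((l : ℂ) • F) G = (l : ℂ) * T.pairing F G := by
  simp only [pairing, Prod.smul_fst, Prod.smul_snd, Pi.smul_apply, Submodule.coe_smul, smul_eq_mul,
    map_mul, Complex.conj_ofReal, mul_add, ← tsum_mul_left, mul_assoc, mul_left_comm (l : ℂ)]

/-- The scalar product with the cochains of finite support separates the cochains. -/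
theorem eq_zero_of_pairing_eq_zero {F : T.Cochain}
    (h : ∀ G ∈ T.finCochain, T.pairing F G = 0) : F = 0 := by
  have key : ∀ U : Finset V, ∑ x ∈ U, T.c x * ‖F.1 x‖ ^ 2
      + 1 / 2 * ∑ x ∈ U, ∑ y ∈ U, T.edgeWeight x y * ‖F.2.1.1 (x, y)‖ ^ 2
      + 1 / 6 * ∑ x ∈ U, ∑ y ∈ U, ∑ t ∈ U, T.faceWeight x y t * ‖F.2.2.1 (x, y, t)‖ ^ 2 = 0 := by
    intro U
    have h1 := h _ (T.supportedIn_truncate U F).mem_finCochain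
    rw [pairing_eq_sum (T.supportedIn_truncate U F)] at h1
    have e0 : ∑ x ∈ U, (T.c x : ℂ) * (conj (F.1 x) * (T.truncate U F).1 x)
        = ∑ x ∈ U, (T.c x : ℂ) * (‖F.1 x‖ : ℂ) ^ 2 :=
      Finset.sum_congr rfl fun x hx => by simp [truncate, hx, Complex.conj_mul']
    have e1 : ∑ x ∈ U, ∑ y ∈ U, (T.edgeWeight x y : ℂ) *
          (conj (F.2.1.1 (x, y)) * (T.truncate U F).2.1.1 (x, y))
        = ∑ x ∈ U, ∑ y ∈ U, (T.edgeWeight x y : ℂ) * (‖F.2.1.1 (x, y)‖ : ℂ) ^ 2 :=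
      Finset.sum_congr rfl fun x hx => Finset.sum_congr rfl fun y hy => by
        simp [truncate, hx, hy, Complex.conj_mul']
    have e2 : ∑ x ∈ U, ∑ y ∈ U, ∑ t ∈ U, (T.faceWeight x y t : ℂ) *
          (conj (F.2.2.1 (x, y, t)) * (T.truncate U F).2.2.1 (x, y, t))
        = ∑ x ∈ U, ∑ y ∈ U, ∑ t ∈ U, (T.faceWeight x y t : ℂ) *
          (‖F.2.2.1 (x, y, t)‖ : ℂ) ^ 2 :=
      Finset.sum_congr rfl fun x hx => Finset.sum_congr rfl fun y hy =>
        Finset.sum_congr rfl fun t ht => by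
          simp [truncate, hx, hy, ht, Complex.conj_mul']
    rw [e0, e1, e2] at h1
    refine Complex.ofReal_injective ?_
    push_cast
    exact h1
  have n0 : ∀ U : Finset V, 0 ≤ ∑ x ∈ U, T.c x * ‖F.1 x‖ ^ 2 := fun U =>
    Finset.sum_nonneg fun x _ => mul_nonneg (T.c_pos x).le (sq_nonneg _)
  have n1 : ∀ U : Finset V, 0 ≤ ∑ x ∈ U, ∑ y ∈ U, T.edgeWeight x y * ‖F.2.1.1 (x, y)‖ ^ 2 :=
    fun U => Finset.sum_nonneg fun x _ => Finset.sum_nonneg fun y _ =>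
      mul_nonneg (T.edgeWeight_nonneg x y) (sq_nonneg _)
  have n2 : ∀ U : Finset V, 0 ≤ ∑ x ∈ U, ∑ y ∈ U, ∑ t ∈ U,
      T.faceWeight x y t * ‖F.2.2.1 (x, y, t)‖ ^ 2 := fun U =>
    Finset.sum_nonneg fun x _ => Finset.sum_nonneg fun y _ => Finset.sum_nonneg fun t _ =>
      mul_nonneg (T.faceWeight_nonneg x y t) (sq_nonneg _)
  refine Prod.ext (funext fun x => ?_) (Prod.ext ?_ ?_)
  · have h1 : ∑ x ∈ {x}, T.c x * ‖F.1 x‖ ^ 2 = 0 := by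
      linarith [key {x}, n0 {x}, n1 {x}, n2 {x}]
    simpa [(T.c_pos x).ne'] using h1
  · exact edge_eq_zero_of_sum_eq_zero _ fun U => by linarith [key U, n0 U, n1 U, n2 U]
  · exact face_eq_zero_of_sum_eq_zero _ fun U => by linarith [key U, n0 U, n1 U, n2 U]

/-- Green's formula, when one of the two factors vanishes wherever they could meet outside `S₁`. The
weights in `cutoff_identity` are then taken equal to `1` inside `S₁`. -/
theorem sum_green {S S₁ : Finset V} (hS : T.thicken S₁ ⊆ S) (g : V → ℂ) (φ : T.skewEdge)
    (ψ : T.skewFace) (h0 : ∀ x, x ∉ S₁ → T.delta0 φ x = 0 ∨ g x = 0)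
    (h1 : ∀ x y, ¬ (x ∈ S₁ ∧ y ∈ S₁) → φ.1 (x, y) = 0 ∨ (T.d0 g + T.delta1 ψ).1 (x, y) = 0)
    (h2 : ∀ x y, ¬ (x ∈ S₁ ∧ y ∈ S₁) → φ.1 (x, y) = 0 ∨ g y = 0)
    (h3 : ∀ x y t, ¬ (x ∈ S₁ ∧ y ∈ S₁) → φ.1 (x, y) = 0 ∨ ψ.1 (x, y, t) = 0) :
    ∑ x ∈ S, (T.c x : ℂ) * (conj (T.delta0 φ x) * g x)
      + 1 / 6 * ∑ x ∈ S, ∑ y ∈ S, ∑ t ∈ S, (T.faceWeight x y t : ℂ) *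
        (conj ((T.d1 φ).1 (x, y, t)) * ψ.1 (x, y, t))
    = 1 / 2 * ∑ x ∈ S, ∑ y ∈ S, (T.edgeWeight x y : ℂ) *
        (conj (φ.1 (x, y)) * (T.d0 g + T.delta1 ψ).1 (x, y)) := by
  classical
  have key := T.cutoff_identity hS (fun x => if x ∈ S₁ then 1 else 0)
    (fun x y => if x ∈ S₁ ∧ y ∈ S₁ then 1 else 0) (fun _ _ _ => 1)
    (fun x hx => if_neg hx) (fun x y hx _ => if_neg fun h => hx h.1)
    (fun x y => by simp only [and_comm]) (fun _ _ _ => rfl) g φ ψ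
  have e0 : ∀ x, (T.c x : ℂ) * ((if x ∈ S₁ then 1 else 0 : ℝ) : ℂ) * (conj (T.delta0 φ x) * g x)
      = (T.c x : ℂ) * (conj (T.delta0 φ x) * g x) := fun x => by
    by_cases hx : x ∈ S₁
    · simp [hx]
    · rcases h0 x hx with h | h <;> simp [h]
  have e1 : ∀ x y, (T.edgeWeight x y : ℂ) * ((if x ∈ S₁ ∧ y ∈ S₁ then 1 else 0 : ℝ) : ℂ) *
      (conj (φ.1 (x, y)) * (T.d0 g + T.delta1 ψ).1 (x, y))
      = (T.edgeWeight x y : ℂ) * (conj (φ.1 (x, y)) * (T.d0 g + T.delta1 ψ).1 (x, y)) :=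
    fun x y => by
      by_cases hx : x ∈ S₁ ∧ y ∈ S₁
      · simp [hx]
      · rcases h1 x y hx with h | h <;> simp only [h, map_zero, zero_mul, mul_zero]
  have e2 : ∀ x y, (T.edgeWeight x y : ℂ) * (((if y ∈ S₁ then 1 else 0 : ℝ) : ℂ)
      - ((if x ∈ S₁ ∧ y ∈ S₁ then 1 else 0 : ℝ) : ℂ)) *
      (conj (φ.1 (x, y)) * phase (T.α y x / 2) * g y) = 0 := fun x y => by
    by_cases hx : x ∈ S₁ ∧ y ∈ S₁
    · simp [hx]
    · rcases h2 x y hx with h | h <;> simp only [h, map_zero, zero_mul, mul_zero]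
  have e3 : ∀ x y t, (T.faceWeight x y t : ℂ) * (((1 : ℝ) : ℂ)
      - ((if x ∈ S₁ ∧ y ∈ S₁ then 1 else 0 : ℝ) : ℂ)) *
      (conj (φ.1 (x, y)) * phase ((T.α t x + T.α t y) / 6) * ψ.1 (x, y, t)) = 0 := fun x y t => by
    by_cases hx : x ∈ S₁ ∧ y ∈ S₁
    · simp [hx]
    · rcases h3 x y t hx with h | h <;> simp only [h, map_zero, zero_mul, mul_zero]
  simp only [e0, e1, e2, e3] at key
  simp only [Finset.sum_const_zero, mul_zero, add_zero, Complex.ofReal_one, mul_one] at key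
  exact sub_eq_zero.1 key

/-- The Gauß–Bonnet operator is formally self-adjoint; only one of the cochains has to have finite
support. -/
theorem pairing_gaussBonnetAll (F : T.Cochain) {G : T.Cochain} (hG : G ∈ T.finCochain) :
    T.pairing F (T.gaussBonnetAll G) = T.pairing (T.gaussBonnetAll F) G := by
  classical
  obtain ⟨U₀, hU₀⟩ := exists_supportedIn hG
  obtain ⟨U', hU'⟩ := exists_supportedIn (T.gaussBonnet ⟨G, hG⟩).2
  set U₁ := T.thicken U₀ ∪ U' with hU₁
  have h01 : U₀ ⊆ U₁ := fun x hx => Finset.mem_union_left _ (T.mem_thicken_of_mem hx)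
  have hU : U₁ ⊆ T.thicken U₁ := fun x hx => T.mem_thicken_of_mem hx
  have hG₁ := hU₀.mono h01
  have hTG : T.SupportedIn U₁ (T.gaussBonnetAll G) := hU'.mono Finset.subset_union_right
  rw [pairing_eq_sum (hTG.mono hU), pairing_eq_sum (hG₁.mono hU)]
  have g1 := sum_green (T := T) (S₁ := U₁) subset_rfl G.1 F.2.1 G.2.2
    (fun x hx => Or.inr (hG₁.vertex x hx)) (fun x y h => Or.inr (hTG.edge x y h))
    (fun x y h => by
      by_cases hxy : T.graph.Adj x y
      · refine Or.inr (hU₀.vertex y fun hy => h ⟨?_, h01 hy⟩)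
        exact Finset.mem_union_left _ (T.mem_thicken_of_adj hy hxy.symm)
      · exact Or.inl (F.2.1.2.2 x y hxy))
    (fun x y t h => Or.inr (hG₁.face x y t fun h' => h ⟨h'.1, h'.2.1⟩))
  have g2 := sum_green (T := T) (S₁ := U₁) subset_rfl F.1 G.2.1 F.2.2
    (fun x hx => Or.inl (hTG.vertex x hx)) (fun x y h => Or.inl (hG₁.edge x y h))
    (fun x y h => Or.inl (hG₁.edge x y h)) (fun x y t h => Or.inl (hG₁.edge x y h))
  have g3 := congrArg conj g2
  simp only [map_add, map_mul, map_sum, map_div₀, map_one, map_ofNat, Complex.conj_conj,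
    Complex.conj_ofReal] at g3
  simp only [mul_comm (G.2.1.1 _), mul_comm _ (conj _)] at g1 g3 ⊢
  change _ + 1 / 2 * ∑ x ∈ _, ∑ y ∈ _, _ * (conj (F.2.1.1 (x, y)) *
    (T.d0 G.1 + T.delta1 G.2.2).1 (x, y)) + _ = ∑ x ∈ _, _ * (conj (T.delta0 F.2.1 x) * _)
    + 1 / 2 * ∑ x ∈ _, ∑ y ∈ _, _ * (conj ((T.d0 F.1 + T.delta1 F.2.2).1 (x, y)) * _) + _
  rw [← g1, ← g3]
  simp only [gaussBonnetAll, LinearMap.coe_mk, AddHom.coe_mk]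
  ring

end MagneticTriangulation

namespace MagneticTriangulation

variable {V : Type*} {T : MagneticTriangulation V}

/-! ### The Laplacian in the Hilbert space -/

variable (T) in
/-- The cochain underlying an element of `ℓ²(T)`. -/
def toCochain (u : T.L2) : T.Cochain :=
  (u.fst.toFun, ⟨u.snd.fst.toFun, u.snd.fst.toFun_mem⟩, ⟨u.snd.snd.toFun, u.snd.snd.toFun_mem⟩)

theorem inner_toL2 (u : T.L2) (G : T.finCochain) :
    inner ℂ u (T.toL2 G) = T.pairing (T.toCochain u) G.1 := by
  rw [WithLp.prod_inner_apply, WithLp.prod_inner_apply]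
  rfl

theorem inner_toL2_toL2 (F G : T.finCochain) :
    inner ℂ (T.toL2 F) (T.toL2 G) = T.pairing F.1 G.1 :=
  inner_toL2 _ _

theorem toUnbounded_apply (A : T.finCochain →ₗ[ℂ] T.finCochain) (F : T.finCochain) :
    T.toUnbounded A ⟨T.toL2 F, F, rfl⟩ = T.toL2 (A F) := by
  change T.toL2 (A ((LinearEquiv.ofInjective T.toL2 T.toL2_injective).symm ⟨T.toL2 F, F, rfl⟩)) = _
  congr 2
  rw [LinearEquiv.symm_apply_eq]
  rfl

theorem toCochain_injective : Function.Injective T.toCochain := fun u v h => by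
  have h1 : u.fst = v.fst := WeightedL2.toFun_injective (congrArg Prod.fst h)
  have h2 : u.snd.fst = v.snd.fst :=
    WeightedL2.toFun_injective (congrArg (fun F : T.Cochain => F.2.1.1) h)
  have h3 : u.snd.snd = v.snd.snd :=
    WeightedL2.toFun_injective (congrArg (fun F : T.Cochain => F.2.2.1) h)
  exact WithLp.ofLp_injective 2 (Prod.ext h1 (WithLp.ofLp_injective 2 (Prod.ext h2 h3)))

theorem dense_range_toL2 : Dense (LinearMap.range T.toL2 : Set T.L2) := by
  rw [Submodule.dense_iff_topologicalClosure_eq_top, Submodule.topologicalClosure_eq_top_iff,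
    Submodule.eq_bot_iff]
  intro u hu
  refine toCochain_injective (eq_zero_of_pairing_eq_zero fun G hG => ?_)
  rw [← inner_toL2 u ⟨G, hG⟩]
  exact (Submodule.mem_orthogonal' _ u).1 hu _ ⟨_, rfl⟩

/-- The Laplacian acts on the left as a difference expression, defined for all cochains. -/
theorem pairing_hodgeLaplacian (F : T.Cochain) (G : T.finCochain) :
    T.pairing F (T.hodgeLaplacian G).1
      = T.pairing (T.gaussBonnetAll (T.gaussBonnetAll F)) G.1 := by
  rw [← pairing_gaussBonnetAll _ G.2]
  exact pairing_gaussBonnetAll F (T.gaussBonnet G).2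

theorem bddAbove_sum_vertex (u : T.L2) :
    BddAbove (Set.range fun U : Finset V => ∑ x ∈ U, T.c x * ‖(T.toCochain u).1 x‖ ^ 2) := by
  refine ⟨∑' x, T.c x * ‖u.fst.toFun x‖ ^ 2, ?_⟩
  rintro _ ⟨U, rfl⟩
  exact u.fst.toFun_summable.sum_le_tsum U fun x _ => mul_nonneg (T.c_pos x).le (sq_nonneg _)

theorem bddAbove_sum_edge (u : T.L2) :
    BddAbove (Set.range fun U : Finset V =>
      ∑ x ∈ U, ∑ y ∈ U, T.edgeWeight x y * ‖(T.toCochain u).2.1.1 (x, y)‖ ^ 2) := by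
  refine ⟨2 * ∑' e : V × V, T.r e.1 e.2 / 2 * ‖u.snd.fst.toFun e‖ ^ 2, ?_⟩
  rintro _ ⟨U, rfl⟩
  have key : ∀ x y, T.edgeWeight x y * ‖u.snd.fst.toFun (x, y)‖ ^ 2
      = 2 * (T.r x y / 2 * ‖u.snd.fst.toFun (x, y)‖ ^ 2) := fun x y => by
    by_cases h : T.graph.Adj x y
    · rw [edgeWeight, if_pos h]; ring
    · rw [u.snd.fst.toFun_mem.2 x y h]; simp
  have h := u.snd.fst.toFun_summable.sum_le_tsum (U ×ˢ U) fun e _ => by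
    have h1 := key e.1 e.2
    have h2 := mul_nonneg (T.edgeWeight_nonneg e.1 e.2) (sq_nonneg ‖u.snd.fst.toFun e‖)
    linarith
  rw [Finset.sum_product] at h
  have h' := mul_le_mul_of_nonneg_left h zero_le_two
  rw [Finset.mul_sum] at h'
  refine le_trans (le_of_eq (Finset.sum_congr rfl fun x _ => ?_)) h'
  rw [Finset.mul_sum]
  exact Finset.sum_congr rfl fun y _ => key x y

theorem bddAbove_sum_face (u : T.L2) :
    BddAbove (Set.range fun U : Finset V =>
      ∑ x ∈ U, ∑ y ∈ U, ∑ t ∈ U,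
        T.faceWeight x y t * ‖(T.toCochain u).2.2.1 (x, y, t)‖ ^ 2) := by
  refine ⟨6 * ∑' f : V × V × V, T.s f.1 f.2.1 f.2.2 / 6 * ‖u.snd.snd.toFun f‖ ^ 2, ?_⟩
  rintro _ ⟨U, rfl⟩
  have key : ∀ x y t, T.faceWeight x y t * ‖u.snd.snd.toFun (x, y, t)‖ ^ 2
      = 6 * (T.s x y t / 6 * ‖u.snd.snd.toFun (x, y, t)‖ ^ 2) := fun x y t => by
    by_cases h : T.face x y t
    · rw [faceWeight, if_pos h]; ring
    · rw [u.snd.snd.toFun_mem.2.2 x y t h]; simp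
  have h := u.snd.snd.toFun_summable.sum_le_tsum (U ×ˢ U ×ˢ U) fun e _ => by
    have h1 := key e.1 e.2.1 e.2.2
    have h2 := mul_nonneg (T.faceWeight_nonneg e.1 e.2.1 e.2.2) (sq_nonneg ‖u.snd.snd.toFun e‖)
    linarith
  simp only [Finset.sum_product] at h
  have h' := mul_le_mul_of_nonneg_left h (by norm_num : (0 : ℝ) ≤ 6)
  refine le_trans (le_of_eq ?_) h'
  simp only [Finset.mul_sum]
  exact Finset.sum_congr rfl fun x _ => Finset.sum_congr rfl fun y _ =>
    Finset.sum_congr rfl fun t _ => key x y t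

/-- An element of `ℓ²(T)` that is orthogonal to the range of `Δ + l` is a solution of
`Δ u = -l u`. -/
theorem gaussBonnetAll_sq_eq {u : T.L2} {l : ℝ}
    (h : ∀ G : T.finCochain, inner ℂ u (T.toL2 (T.hodgeLaplacian G) + (l : ℂ) • T.toL2 G) = 0) :
    T.gaussBonnetAll (T.gaussBonnetAll (T.toCochain u)) = -(l : ℂ) • T.toCochain u := by
  refine Eq.trans (eq_neg_of_add_eq_zero_left ?_) (neg_smul (l : ℂ) (T.toCochain u)).symm
  refine eq_zero_of_pairing_eq_zero fun G hG => ?_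
  have h1 := h ⟨G, hG⟩
  rw [inner_add_right, inner_smul_right, inner_toL2, inner_toL2, pairing_hodgeLaplacian] at h1
  rw [pairing_add_left _ _ hG, pairing_smul_left]
  exact h1

/-- A solution of `Δ u = -l u` in `ℓ²(T)` vanishes if `l` is large; the vertices and faces
decouple from the edges. -/
theorem eq_zero_of_gaussBonnetAll_sq_eq {K : ℝ} (hK : 0 < K)
    (hcut : ∀ U : Finset V, ∃ S₁ S : Finset V, ∃ χ : V → ℝ, T.IsCutoff K S₁ S χ ∧
      U ⊆ S ∧ ∀ x ∈ U, χ x = 1) {l : ℝ} (hl : 27 / 2 * K < l) {u : T.L2}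
    (h : T.gaussBonnetAll (T.gaussBonnetAll (T.toCochain u)) = -(l : ℂ) • T.toCochain u) :
    u = 0 := by
  have h0 := congrArg Prod.fst h
  have h1 := congrArg (fun F : T.Cochain => F.2.1) h
  have h2 := congrArg (fun F : T.Cochain => F.2.2) h
  obtain ⟨e0, e2⟩ := vertex_face_eq_zero hK hcut hl h0 h2 (bddAbove_sum_vertex u)
    (bddAbove_sum_face u)
  have e1 := edge_eq_zero hK hcut (by linarith) h1 (bddAbove_sum_edge u)
  exact toCochain_injective (Prod.ext e0 (Prod.ext e1 e2))

end MagneticTriangulation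

end

theorem corollary7p1 {V : Type*} [Countable V] (T : MagneticTriangulation V)
    (hT : T.IsChiComplete) :
    IsEssentiallySelfAdjoint (T.toUnbounded T.hodgeLaplacian) := by
  obtain ⟨K, hK, hcut⟩ := hT.exists_isCutoff
  have hl : 27 / 2 * K < 14 * K := by linarith
  refine isEssentiallySelfAdjoint_of_nonneg MagneticTriangulation.dense_range_toL2 ?_ ?_
    (by positivity : 0 < 14 * K) ?_
  · rintro ⟨_, F, rfl⟩ ⟨_, G, rfl⟩
    rw [MagneticTriangulation.toUnbounded_apply, MagneticTriangulation.toUnbounded_apply,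
      MagneticTriangulation.inner_toL2_toL2, MagneticTriangulation.inner_toL2_toL2,
      MagneticTriangulation.pairing_hodgeLaplacian]
    rfl
  · rintro ⟨_, F, rfl⟩
    rw [MagneticTriangulation.toUnbounded_apply, MagneticTriangulation.inner_toL2_toL2]
    have h : T.pairing F.1 (T.hodgeLaplacian F).1
        = inner ℂ (T.toL2 (T.gaussBonnet F)) (T.toL2 (T.gaussBonnet F)) := by
      rw [MagneticTriangulation.inner_toL2_toL2]
      exact MagneticTriangulation.pairing_gaussBonnetAll F.1 (T.gaussBonnet F).2
    rw [h]
    exact inner_self_nonneg (𝕜 := ℂ) (x := T.toL2 (T.gaussBonnet F))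
  · intro u hu
    refine MagneticTriangulation.eq_zero_of_gaussBonnetAll_sq_eq hK hcut hl
      (MagneticTriangulation.gaussBonnetAll_sq_eq fun G => ?_)
    have h := hu ⟨T.toL2 G, G, rfl⟩
    rwa [MagneticTriangulation.toUnbounded_apply] at h
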